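/- Let $n\ge 1$, let $M$ be a smooth $n$-dimensional manifold and let $\pi:\mathcal Q\to M$ be a smooth fibre bundle (more generally, a smooth fibred manifold: around every point of $\mathcal Q$ there are charts $(x^\mu,\varphi^K)$ of $\mathcal Q$ adapted to a chart $(x^\mu)$ of $M$), with fibres of finite dimension $N$. For a fibred manifold $Y\to M$ let $VY=\ker T(Y\to M)$ be its vertical bundle, $J^1Y$ its first jet bundle, and $V^*Y\otimes_Y\Lambda^kM$ the bundle over $Y$ of vertical covectors with values in $k$-forms on $M$; all of these are fibred manifolds over $M$. Put $$\mathcal P=V^*\mathcal Q\otimes_{\mathcal Q}\Lambda^{n-1}M,\qquad \Pi:\mathcal P\to\mathcal Q,\qquad \mathcal Q^I=J^1\mathcal Q .$$ There is a unique map $\kappa:J^1(V\mathcal Q)\to V(J^1\mathcal Q)$ such that $\kappa\big(j^1_x(\partial_t s_t|_{t=0})\big)=\partial_t\,(j^1_xs_t)|_{t=0}$ for all smooth one-parameter families $s_t$ of local sections of $\mathcal Q$; it is a diffeomorphism. Let $\theta_p=\Pi^*p$ be the canonical $\Lambda^{n-1}M$-valued vertical one-form on $\mathcal P$. There is a unique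 vertical two-form $\omega=\delta\theta$ on $\mathcal P$ which is the exterior derivative of $\theta$ along the fibres of $\mathcal P\to M$, and there is a unique $\Lambda^nM$-valued vertical two-form $\widetilde\omega^I=\mathrm d\omega$ on $J^1\mathcal P$ which is the space-time differential of $\omega$, i.e. $\widetilde\omega^I_{\zeta}(w_1,w_2)=\mathrm d\big(\omega_p(v_1,v_2)\big)|_x$ whenever $\zeta=j^1_xp$ and $w_i\in V_\zeta J^1\mathcal P$ is the jet at $x$ (in the sense above, with $\mathcal P$ in place of $\mathcal Q$) of a section $v_i$ of $V\mathcal P$ along the section $p$. There is a unique map $$\Psi: J^1\mathcal P\longrightarrow V^*\mathcal Q^I\otimes_{\mathcal Q^I}\Lambda^nM$$ over $\mathcal Q^I$ (where $J^1\mathcal P\to\mathcal Q^I$ is $j^1\Pi$) such that $$\langle \kappa(j^1_xv),\Psi(j^1_xp)\rangle=\mathrm d\langle v,p\rangle|_x\in\Lambda^n_xM$$ for all local sections $p$ of $\mathcal P\to M$ and $v$ of $V\mathcal Q\to M$ lying over the same section of $\mathcal Q\to M$. Moreover: 1. $\Psi$ is a surjective smooth submersion, and it is linear on the fibres over $\mathcal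 Q^I$ (linear combinations of jets of momenta over the same section of $\mathcal Q$ being the jets of the linear combinations). 2. $\ker T_\zeta\Psi$ is the degeneracy space $\{X\in V_\zeta J^1\mathcal P:\ \widetilde\omega^I(X,\cdot)=0\}$ for every $\zeta\in J^1\mathcal P$, and the fibres $\Psi^{-1}(\eta)$ are exactly the leaves of this degeneracy distribution (two points lie on the same leaf if they are joined by a finite chain of smooth curves tangent to the distribution). 3. Consequently $\Psi$ descends to an identification of the infinitesimal phase bundle: the leaf space $\mathcal P^I=J^1\mathcal P/(\text{degeneracy of }\widetilde\omega^I)$, with the quotient topology, has a smooth structure for which $J^1\mathcal P\to\mathcal P^I$ is a smooth submersion, and the map $\mathcal P^I\to V^*\mathcal Q^I\otimes_{\mathcal Q^I}\Lambda^nM$ induced by $\Psi$ is a diffeomorphism (over $\mathcal Q^I$, and linear on fibres by 1). -/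

import Mathlib

open Set Filter Topology
open scoped ContDiff Manifold

noncomputable section

universe u

/-- The tangent map `T_x f : T_x X → T_{f x} X'` of a map between manifolds modelled on the normed
spaces `V`, `V'` (the tangent space of a manifold modelled on `V` is, in Mathlib, a copy of `V`). -/
abbrev tmap (V V' : Type*) [NormedAddCommGroup V] [NormedSpace ℝ V]
    [NormedAddCommGroup V'] [NormedSpace ℝ V']
    {X X' : Type*} [TopologicalSpace X] [ChartedSpace V X] [TopologicalSpace X']
    [ChartedSpace V' X'] (f : X → X') (x : X) : V →L[ℝ] V' :=
  mfderiv 𝓘(ℝ, V) 𝓘(ℝ, V') f x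

section Basics

variable {V V' V'' : Type*} [NormedAddCommGroup V] [NormedSpace ℝ V]
  [NormedAddCommGroup V'] [NormedSpace ℝ V'] [NormedAddCommGroup V''] [NormedSpace ℝ V'']
  {X X' X'' : Type*} [TopologicalSpace X] [ChartedSpace V X] [TopologicalSpace X']
  [ChartedSpace V' X'] [TopologicalSpace X''] [ChartedSpace V'' X'']

theorem tmap_comp {g : X' → X''} {f : X → X'} (x : X)
    (hg : MDifferentiableAt 𝓘(ℝ, V') 𝓘(ℝ, V'') g (f x))
    (hf : MDifferentiableAt 𝓘(ℝ, V) 𝓘(ℝ, V') f x) :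
    tmap V V'' (g ∘ f) x = (tmap V' V'' g (f x)).comp (tmap V V' f x) :=
  mfderiv_comp x hg hf

theorem tmap_congr {f g : X → X'} {x : X} (h : f =ᶠ[𝓝 x] g) :
    tmap V V' f x = tmap V V' g x :=
  h.mfderiv_eq

/-- The differential at `x` of a chart of the smooth structure, as an isomorphism. -/
def chartIso [IsManifold 𝓘(ℝ, V) ∞ X] {e : OpenPartialHomeomorph X V}
    (he : e ∈ IsManifold.maximalAtlas 𝓘(ℝ, V) ∞ X) {x : X} (hx : x ∈ e.source) : V ≃L[ℝ] V :=
  ContinuousLinearEquiv.equivOfInverse (tmap V V e x) (tmap V V e.symm (e x))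
    (fun v => by
      have h1 := (contMDiffAt_of_mem_maximalAtlas he hx).mdifferentiableAt (by simp)
      have h2 := (contMDiffAt_symm_of_mem_maximalAtlas he (e.map_source hx)).mdifferentiableAt
        (by simp)
      have h3 := tmap_comp x h2 h1
      have h4 : tmap V V (e.symm ∘ e) x = ContinuousLinearMap.id ℝ V := by
        rw [tmap_congr (f := e.symm ∘ e) (g := id) (e.eventually_left_inverse hx)]
        exact mfderiv_id
      rw [h4] at h3
      exact (DFunLike.congr_fun h3 v).symm)
    (fun v => by
      have hx' := e.map_source hx
      have h1 : MDifferentiableAt 𝓘(ℝ, V) 𝓘(ℝ, V) e (e.symm (e x)) := by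
        rw [e.left_inv hx]
        exact (contMDiffAt_of_mem_maximalAtlas he hx).mdifferentiableAt (by simp)
      have h2 := (contMDiffAt_symm_of_mem_maximalAtlas he hx').mdifferentiableAt (by simp)
      have h3 := tmap_comp (e x) h1 h2
      have h4 : tmap V V (e ∘ e.symm) (e x) = ContinuousLinearMap.id ℝ V := by
        rw [tmap_congr (f := e ∘ e.symm) (g := id) (e.eventually_right_inverse hx')]
        exact mfderiv_id
      rw [h4, e.left_inv hx] at h3
      exact (DFunLike.congr_fun h3 v).symm)

theorem chartIso_apply [IsManifold 𝓘(ℝ, V) ∞ X] {e : OpenPartialHomeomorph X V}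
    (he : e ∈ IsManifold.maximalAtlas 𝓘(ℝ, V) ∞ X) {x : X} (hx : x ∈ e.source) (v : V) :
    chartIso he hx v = tmap V V e x v := rfl

/-- Change of charts. -/
theorem chartIso_symm_trans [IsManifold 𝓘(ℝ, V) ∞ X] {e e' : OpenPartialHomeomorph X V}
    (he : e ∈ IsManifold.maximalAtlas 𝓘(ℝ, V) ∞ X)
    (he' : e' ∈ IsManifold.maximalAtlas 𝓘(ℝ, V) ∞ X) {x : X} (hx : x ∈ e.source)
    (hx' : x ∈ e'.source) (v : V) :
    chartIso he' hx' ((chartIso he hx).symm v) = fderiv ℝ (e.symm.trans e') (e x) v := by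
  have h1 : MDifferentiableAt 𝓘(ℝ, V) 𝓘(ℝ, V) e' (e.symm (e x)) := by
    rw [e.left_inv hx]
    exact (contMDiffAt_of_mem_maximalAtlas he' hx').mdifferentiableAt (by simp)
  have h2 := (contMDiffAt_symm_of_mem_maximalAtlas he (e.map_source hx)).mdifferentiableAt
    (n := ∞) (by simp)
  have h3 := tmap_comp (e x) h1 h2
  rw [e.left_inv hx] at h3
  have h4 : tmap V V (e' ∘ e.symm) (e x) = fderiv ℝ (e.symm.trans e') (e x) :=
    mfderiv_eq_fderiv
  rw [← h4, h3]
  rfl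

theorem contDiffOn_trans [IsManifold 𝓘(ℝ, V) ∞ X] {e e' : OpenPartialHomeomorph X V}
    (he : e ∈ IsManifold.maximalAtlas 𝓘(ℝ, V) ∞ X)
    (he' : e' ∈ IsManifold.maximalAtlas 𝓘(ℝ, V) ∞ X) :
    ContDiffOn ℝ ∞ (e.symm.trans e') (e.symm.trans e').source := by
  rw [← contMDiffOn_iff_contDiffOn]
  exact contMDiffOn_of_mem_contDiffGroupoid
    (IsManifold.compatible_of_mem_maximalAtlas he he')

end Basics

/-! ### Fibred manifolds -/

section Fibred

variable (E F : Type*) [NormedAddCommGroup E] [NormedSpace ℝ E]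
  [NormedAddCommGroup F] [NormedSpace ℝ F]
  {M Y : Type*} [TopologicalSpace M] [ChartedSpace E M]
  [TopologicalSpace Y] [ChartedSpace (E × F) Y]

/-- A chart of `Y` adapted to `π : Y → M`: a smooth chart `z ↦ (x, φ)` of `Y` and a smooth chart
`c` of `M` such that `x = c (π z)`. -/
structure AdaptedChart (π : Y → M) where
  /-- the chart of the total space -/
  e : OpenPartialHomeomorph Y (E × F)
  /-- the chart of the base -/
  c : OpenPartialHomeomorph M E
  e_mem : e ∈ IsManifold.maximalAtlas 𝓘(ℝ, E × F) ∞ Y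
  c_mem : c ∈ IsManifold.maximalAtlas 𝓘(ℝ, E) ∞ M
  map_source : ∀ z ∈ e.source, π z ∈ c.source
  fst_eq : ∀ z ∈ e.source, (e z).1 = c (π z)

/-- `π : Y → M` is a smooth fibred manifold (with base modelled on `E` and fibres modelled on `F`):
around every point of the total space there is an adapted chart. Every smooth fibre bundle with
fibre a manifold modelled on `F` is of this kind. -/
class IsFibredManifold (π : Y → M) : Prop where
  base_isManifold : IsManifold 𝓘(ℝ, E) ∞ M
  total_isManifold : IsManifold 𝓘(ℝ, E × F) ∞ Y
  exists_adaptedChart : ∀ z : Y, ∃ a : AdaptedChart E F π, z ∈ a.e.source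

/-- The vertical space `V_z Y = ker T_z π`, i.e. the tangent space at `z` of the fibre through
`z`. -/
def vert (π : Y → M) (z : Y) : Submodule ℝ (E × F) :=
  LinearMap.ker (tmap (E × F) E π z).toLinearMap

variable {E F} {π : Y → M}

theorem mem_vert {z : Y} {X : E × F} : X ∈ vert E F π z ↔ tmap (E × F) E π z X = 0 := Iff.rfl

variable [hπ : IsFibredManifold E F π]

variable (E F π) in
theorem IsFibredManifold.contMDiff : ContMDiff 𝓘(ℝ, E × F) 𝓘(ℝ, E) ∞ π := by
  have := hπ.base_isManifold
  have := hπ.total_isManifold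
  intro z
  obtain ⟨a, ha⟩ := hπ.exists_adaptedChart z
  have h1 : π =ᶠ[𝓝 z] (a.c.symm ∘ Prod.fst ∘ a.e) := by
    filter_upwards [a.e.open_source.mem_nhds ha] with y hy
    simp [a.fst_eq y hy, a.c.left_inv (a.map_source y hy)]
  refine ContMDiffAt.congr_of_eventuallyEq ?_ h1
  refine ContMDiffAt.comp z (g := a.c.symm) (I' := 𝓘(ℝ, E)) ?_
    (ContMDiffAt.comp z (g := Prod.fst) (I' := 𝓘(ℝ, E × F)) ?_
      (contMDiffAt_of_mem_maximalAtlas a.e_mem ha))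
  · apply contMDiffAt_symm_of_mem_maximalAtlas a.c_mem
    simpa [a.fst_eq z ha] using a.c.map_source (a.map_source z ha)
  · exact contDiff_fst.contMDiff.contMDiffAt

variable (E F π) in
theorem IsFibredManifold.mdifferentiableAt (z : Y) :
    MDifferentiableAt 𝓘(ℝ, E × F) 𝓘(ℝ, E) π z :=
  (IsFibredManifold.contMDiff E F π z).mdifferentiableAt (by simp)

namespace AdaptedChart

variable (a b : AdaptedChart E F π) {z : Y} (hz : z ∈ a.e.source) (hz' : z ∈ b.e.source)

/-- The differential of an adapted chart of the total space. -/
def dE : (E × F) ≃L[ℝ] (E × F) :=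
  haveI := hπ.total_isManifold
  chartIso a.e_mem hz

/-- The differential of the underlying chart of the base. -/
def dC : E ≃L[ℝ] E :=
  haveI := hπ.base_isManifold
  chartIso a.c_mem (a.map_source z hz)

theorem dE_fst (X : E × F) : (a.dE hz X).1 = a.dC hz (tmap (E × F) E π z X) := by
  have := hπ.base_isManifold
  have := hπ.total_isManifold
  have h1 : Prod.fst ∘ a.e =ᶠ[𝓝 z] a.c ∘ π := by
    filter_upwards [a.e.open_source.mem_nhds hz] with y hy using a.fst_eq y hy
  have h2 := tmap_congr (V := E × F) (V' := E) h1
  have h3 := (contMDiffAt_of_mem_maximalAtlas a.e_mem hz).mdifferentiableAt (n := ∞) (by simp)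
  have h4 := (contMDiffAt_of_mem_maximalAtlas a.c_mem (a.map_source z hz)).mdifferentiableAt
    (n := ∞) (by simp)
  have h5 : MDifferentiableAt 𝓘(ℝ, E × F) 𝓘(ℝ, E) (Prod.fst : E × F → E) (a.e z) :=
    contDiff_fst.contMDiff.contMDiffAt.mdifferentiableAt (n := 1) (by simp)
  have h6 : tmap (E × F) E (Prod.fst : E × F → E) (a.e z) = ContinuousLinearMap.fst ℝ E F := by
    rw [tmap, mfderiv_eq_fderiv]; exact fderiv_fst
  rw [tmap_comp z h5 h3, tmap_comp z h4 (IsFibredManifold.mdifferentiableAt E F π z), h6] at h2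
  exact DFunLike.congr_fun h2 X

theorem tmap_dE_symm (X : E × F) :
    tmap (E × F) E π z ((a.dE hz).symm X) = (a.dC hz).symm X.1 := by
  have := a.dE_fst hz ((a.dE hz).symm X)
  simpa using congrArg (a.dC hz).symm this.symm

theorem dE_symm_mem_vert (g : F) : (a.dE hz).symm (0, g) ∈ vert E F π z := by
  rw [mem_vert, a.tmap_dE_symm hz]; simp

theorem dE_vert {X : E × F} (hX : X ∈ vert E F π z) : a.dE hz X = (0, (a.dE hz X).2) := by
  have := a.dE_fst hz X
  rw [mem_vert.1 hX, map_zero] at this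
  exact Prod.ext this rfl

/-- An adapted chart trivializes the vertical spaces over its domain. -/
def vertIso : vert E F π z ≃L[ℝ] F :=
  ContinuousLinearEquiv.equivOfInverse
    ((ContinuousLinearMap.snd ℝ E F).comp ((a.dE hz).toContinuousLinearMap.comp
      (vert E F π z).subtypeL))
    (((a.dE hz).symm.toContinuousLinearMap.comp (ContinuousLinearMap.inr ℝ E F)).codRestrict
      (vert E F π z) (a.dE_symm_mem_vert hz))
    (fun X => by
      apply Subtype.ext
      change (a.dE hz).symm (0, (a.dE hz X).2) = X
      rw [← a.dE_vert hz X.2]; simp)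
    (fun g => by
      change (a.dE hz ((a.dE hz).symm (0, g))).2 = g
      simp)

theorem vertIso_apply (X : vert E F π z) : a.vertIso hz X = (a.dE hz X).2 := rfl

theorem vertIso_symm_apply (g : F) :
    ((a.vertIso hz).symm g : E × F) = (a.dE hz).symm (0, g) := rfl

/-- The transition map between two adapted charts. -/
def trans : OpenPartialHomeomorph (E × F) (E × F) := a.e.symm.trans b.e

/-- The transition map between the underlying charts of the base. -/
def transBase : OpenPartialHomeomorph E E := a.c.symm.trans b.c

theorem contDiffOn_trans : ContDiffOn ℝ ∞ (a.trans b) (a.trans b).source :=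
  haveI := hπ.total_isManifold
  _root_.contDiffOn_trans a.e_mem b.e_mem

theorem contDiffOn_transBase : ContDiffOn ℝ ∞ (a.transBase b) (a.transBase b).source :=
  haveI := hπ.base_isManifold
  _root_.contDiffOn_trans a.c_mem b.c_mem

theorem dE_trans (X : E × F) :
    b.dE hz' ((a.dE hz).symm X) = fderiv ℝ (a.trans b) (a.e z) X :=
  haveI := hπ.total_isManifold
  chartIso_symm_trans a.e_mem b.e_mem hz hz' X

theorem dC_trans (X : E) :
    b.dC hz' ((a.dC hz).symm X) = fderiv ℝ (a.transBase b) (a.e z).1 X := by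
  have := hπ.base_isManifold
  rw [a.fst_eq z hz]
  exact chartIso_symm_trans a.c_mem b.c_mem (a.map_source z hz) (b.map_source z hz') X

theorem mem_trans_source {q : E × F} :
    q ∈ (a.trans b).source ↔ q ∈ a.e.target ∧ a.e.symm q ∈ b.e.source := by
  simp [trans]

theorem fst_mem_transBase_source {q : E × F} (hq : q ∈ (a.trans b).source) :
    q.1 ∈ (a.transBase b).source := by
  rw [mem_trans_source] at hq
  have h := a.e.map_target hq.1
  have h1 := a.fst_eq _ h
  rw [a.e.right_inv hq.1] at h1
  have h2 := a.map_source _ h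
  simp only [transBase, OpenPartialHomeomorph.trans_source, OpenPartialHomeomorph.symm_source,
    mem_inter_iff, mem_preimage]
  rw [h1, a.c.left_inv h2]
  exact ⟨a.c.map_source h2, b.map_source _ hq.2⟩

theorem trans_maps {q : E × F} (hq : q ∈ (a.trans b).source) :
    a.trans b q ∈ (b.trans a).source := by
  rw [mem_trans_source] at hq ⊢
  have : (a.trans b) q = b.e (a.e.symm q) := rfl
  rw [this]
  refine ⟨b.e.map_source hq.2, ?_⟩
  rw [b.e.left_inv hq.2]
  exact a.e.map_target hq.1

end AdaptedChart

end Fibred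

/-! ### Bundles over a fibred manifold whose charts are induced by the adapted charts -/

section Lift

variable (E F : Type*) [NormedAddCommGroup E] [NormedSpace ℝ E]
  [NormedAddCommGroup F] [NormedSpace ℝ F]
  (G : Type*) [NormedAddCommGroup G] [NormedSpace ℝ G]
  {M Y : Type*} [TopologicalSpace M] [ChartedSpace E M]
  [TopologicalSpace Y] [ChartedSpace (E × F) Y]

/-- Data from which a set `Z` over the fibred manifold `Y → M` becomes a smooth manifold: every
adapted chart `(x, φ)` of `Y` induces fibre coordinates `g` (`coord`) on `Z`, hence a chart
`(x, φ, g)` of `Z`, and the changes of these charts are smooth. -/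
structure LiftData (π : Y → M) {Z : Type*} (pt : Z → Y) where
  coord : ∀ (a : AdaptedChart E F π) (z : Z), pt z ∈ a.e.source → G
  build : ∀ (a : AdaptedChart E F π) (y : Y), y ∈ a.e.source → G → Z
  pt_build : ∀ a y hy g, pt (build a y hy g) = y
  coord_build : ∀ a y hy g, coord a (build a y hy g) ((pt_build a y hy g).symm ▸ hy) = g
  build_coord : ∀ a z hz, build a (pt z) hz (coord a z hz) = z
  /-- the change of fibre coordinates -/
  change : ∀ (_ _ : AdaptedChart E F π), E × (F × G) → G
  contDiffOn_change : ∀ a b, ContDiffOn ℝ ∞ (change a b)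
    {q | (q.1, q.2.1) ∈ (a.trans b).source}
  coord_eq : ∀ a b z hz hz',
    coord b z hz' = change a b ((a.e (pt z)).1, ((a.e (pt z)).2, coord a z hz))

namespace LiftData

variable {E F G} {π : Y → M} {Z : Type*} {pt : Z → Y} (L : LiftData E F G π pt)

variable [hπ : IsFibredManifold E F π]

/-- An adapted chart around a given point. -/
def _root_.AdaptedChart.at (E F : Type*) [NormedAddCommGroup E] [NormedSpace ℝ E]
    [NormedAddCommGroup F] [NormedSpace ℝ F]
    {M Y : Type*} [TopologicalSpace M] [ChartedSpace E M]
    [TopologicalSpace Y] [ChartedSpace (E × F) Y] (π : Y → M) [hπ : IsFibredManifold E F π]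
    (y : Y) : AdaptedChart E F π := (hπ.exists_adaptedChart y).choose

theorem _root_.AdaptedChart.mem_at (y : Y) : y ∈ (AdaptedChart.at E F π y).e.source :=
  (hπ.exists_adaptedChart y).choose_spec

open Classical in
/-- The chart `(x, φ, g)` of `Z` induced by an adapted chart `(x, φ)` of `Y`. -/
def chart (a : AdaptedChart E F π) : PartialEquiv Z (E × (F × G)) where
  toFun z := ((a.e (pt z)).1, ((a.e (pt z)).2,
    if hz : pt z ∈ a.e.source then L.coord a z hz else 0))
  invFun q := if hq : (q.1, q.2.1) ∈ a.e.target
    then L.build a (a.e.symm (q.1, q.2.1)) (a.e.map_target hq) q.2.2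
    else L.build _ _ (AdaptedChart.mem_at (E := E) (F := F) (π := π) (a.e.symm 0)) 0
  source := {z | pt z ∈ a.e.source}
  target := {q | (q.1, q.2.1) ∈ a.e.target}
  map_source' z hz := a.e.map_source hz
  map_target' q hq := by
    simp only [mem_ofPred_eq] at hq ⊢
    rw [dif_pos hq, L.pt_build]
    exact a.e.map_target hq
  left_inv' z hz := by
    have h : (a.e (pt z)) ∈ a.e.target := a.e.map_source hz
    simp only [Prod.mk.eta]
    rw [dif_pos h, dif_pos (show pt z ∈ a.e.source from hz)]
    have key : ∀ y (hy : y ∈ a.e.source), y = pt z →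
        L.build a y hy (L.coord a z hz) = z := by
      rintro y hy rfl
      exact L.build_coord a z hz
    exact key _ _ (a.e.left_inv hz)
  right_inv' q hq := by
    simp only [mem_ofPred_eq] at hq
    simp only [dif_pos hq, L.pt_build, a.e.right_inv hq, dif_pos (a.e.map_target hq)]
    rw [L.coord_build]

theorem chart_source (a : AdaptedChart E F π) : (L.chart a).source = {z | pt z ∈ a.e.source} := rfl

theorem chart_target (a : AdaptedChart E F π) :
    (L.chart a).target = {q | (q.1, q.2.1) ∈ a.e.target} := rfl

theorem chart_apply (a : AdaptedChart E F π) {z : Z} (hz : pt z ∈ a.e.source) :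
    L.chart a z = ((a.e (pt z)).1, ((a.e (pt z)).2, L.coord a z hz)) := by
  simp [chart, hz]

theorem chart_symm_apply (a : AdaptedChart E F π) {q : E × (F × G)}
    (hq : (q.1, q.2.1) ∈ a.e.target) :
    (L.chart a).symm q = L.build a (a.e.symm (q.1, q.2.1)) (a.e.map_target hq) q.2.2 := by
  simp [chart, hq]

theorem pt_chart_symm (a : AdaptedChart E F π) {q : E × (F × G)}
    (hq : (q.1, q.2.1) ∈ a.e.target) : pt ((L.chart a).symm q) = a.e.symm (q.1, q.2.1) := by
  rw [chart_symm_apply L a hq, L.pt_build]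

theorem trans_source (a b : AdaptedChart E F π) :
    ((L.chart a).symm.trans (L.chart b)).source = {q | (q.1, q.2.1) ∈ (a.trans b).source} := by
  ext q
  simp only [PartialEquiv.trans_source, PartialEquiv.symm_source, chart_target, mem_inter_iff,
    mem_ofPred_eq, mem_preimage, chart_source, AdaptedChart.mem_trans_source]
  constructor
  · rintro ⟨h1, h2⟩
    rw [L.pt_chart_symm a h1] at h2
    exact ⟨h1, h2⟩
  · rintro ⟨h1, h2⟩
    rw [L.pt_chart_symm a h1]
    exact ⟨h1, h2⟩

theorem trans_apply (a b : AdaptedChart E F π) {q : E × (F × G)}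
    (hq : (q.1, q.2.1) ∈ (a.trans b).source) :
    (L.chart a).symm.trans (L.chart b) q =
      ((a.trans b (q.1, q.2.1)).1, ((a.trans b (q.1, q.2.1)).2, L.change a b q)) := by
  have hq' := AdaptedChart.mem_trans_source a b |>.1 hq
  have h1 : pt ((L.chart a).symm q) = a.e.symm (q.1, q.2.1) := L.pt_chart_symm a hq'.1
  have hz : (L.chart a).symm q ∈ (L.chart a).source := (L.chart a).map_target hq'.1
  have hz' : pt ((L.chart a).symm q) ∈ b.e.source := by rw [h1]; exact hq'.2
  have h2 : L.chart a ((L.chart a).symm q) = q := (L.chart a).right_inv hq'.1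
  have h3 := L.coord_eq a b ((L.chart a).symm q) hz hz'
  rw [← L.chart_apply a hz, h2] at h3
  rw [PartialEquiv.coe_trans, Function.comp_apply, L.chart_apply b hz', h3, h1]
  rfl

theorem isOpen_trans_source (a b : AdaptedChart E F π) :
    IsOpen ((L.chart a).symm.trans (L.chart b)).source := by
  rw [trans_source]
  exact (a.trans b).open_source.preimage (by fun_prop)

theorem contDiffOn_trans (a b : AdaptedChart E F π) :
    ContDiffOn ℝ ∞ ((L.chart a).symm.trans (L.chart b))
      ((L.chart a).symm.trans (L.chart b)).source := by
  have h1 : ContDiffOn ℝ ∞ (fun q : E × (F × G) => a.trans b (q.1, q.2.1))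
      {q | (q.1, q.2.1) ∈ (a.trans b).source} :=
    (a.contDiffOn_trans b).comp (f := fun q : E × (F × G) => (q.1, q.2.1))
      (by fun_prop) (fun q hq => hq)
  rw [trans_source]
  refine ContDiffOn.congr (f := fun q => ((a.trans b (q.1, q.2.1)).1,
    ((a.trans b (q.1, q.2.1)).2, L.change a b q))) ?_ (fun q hq => L.trans_apply a b hq)
  exact h1.fst.prodMk (h1.snd.prodMk (L.contDiffOn_change a b))

/-- The smooth structure of `Z`. -/
def core : ChartedSpaceCore (E × (F × G)) Z where
  atlas := range L.chart
  chartAt z := L.chart (AdaptedChart.at E F π (pt z))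
  mem_chart_source z := AdaptedChart.mem_at (E := E) (F := F) (π := π) (pt z)
  chart_mem_atlas z := mem_range_self _
  open_source := by
    rintro _ _ ⟨a, rfl⟩ ⟨b, rfl⟩
    exact L.isOpen_trans_source a b
  continuousOn_toFun := by
    rintro _ _ ⟨a, rfl⟩ ⟨b, rfl⟩
    exact (L.contDiffOn_trans a b).continuousOn

theorem isManifold :
    @IsManifold ℝ _ (E × (F × G)) _ _ (E × (F × G)) _ 𝓘(ℝ, E × (F × G)) ∞ Z
      L.core.toTopologicalSpace L.core.toChartedSpace := by
  let := L.core.toTopologicalSpace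
  let := L.core.toChartedSpace
  apply isManifold_of_contDiffOn
  intro e e' he he'
  obtain ⟨_, ⟨a, rfl⟩, rfl⟩ := mem_iUnion₂.1 he
  obtain ⟨_, ⟨b, rfl⟩, rfl⟩ := mem_iUnion₂.1 he'
  exact (L.contDiffOn_trans a b).mono fun q hq => hq.1

/-- The chart of `Z` induced by an adapted chart of `Y`, as a homeomorphism. -/
def chartHomeo (a : AdaptedChart E F π) :
    @OpenPartialHomeomorph Z (E × (F × G)) L.core.toTopologicalSpace _ :=
  L.core.openPartialHomeomorph (L.chart a) (mem_range_self a)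

theorem chartHomeo_mem_maximalAtlas (a : AdaptedChart E F π) :
    letI := L.core.toTopologicalSpace
    letI := L.core.toChartedSpace
    L.chartHomeo a ∈ IsManifold.maximalAtlas 𝓘(ℝ, E × (F × G)) ∞ Z := by
  let := L.core.toTopologicalSpace
  let := L.core.toChartedSpace
  have := L.isManifold
  apply IsManifold.subset_maximalAtlas
  exact mem_iUnion₂.2 ⟨_, mem_range_self a, rfl⟩

/-- The adapted chart of `Z → M` induced by an adapted chart of `Y → M`. -/
def adapted (a : AdaptedChart E F π) :
    letI := L.core.toTopologicalSpace
    letI := L.core.toChartedSpace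
    AdaptedChart E (F × G) (π ∘ pt) :=
  letI := L.core.toTopologicalSpace
  letI := L.core.toChartedSpace
  { e := L.chartHomeo a
    c := a.c
    e_mem := L.chartHomeo_mem_maximalAtlas a
    c_mem := a.c_mem
    map_source := fun z hz => a.map_source (pt z) hz
    fst_eq := fun z hz => a.fst_eq (pt z) hz }

theorem isFibredManifold :
    letI := L.core.toTopologicalSpace
    letI := L.core.toChartedSpace
    IsFibredManifold E (F × G) (π ∘ pt) :=
  letI := L.core.toTopologicalSpace
  letI := L.core.toChartedSpace
  { base_isManifold := hπ.base_isManifold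
    total_isManifold := L.isManifold
    exists_adaptedChart := fun z =>
      ⟨L.adapted (AdaptedChart.at E F π (pt z)), AdaptedChart.mem_at (pt z)⟩ }

theorem contMDiff_pt :
    letI := L.core.toTopologicalSpace
    letI := L.core.toChartedSpace
    ContMDiff 𝓘(ℝ, E × (F × G)) 𝓘(ℝ, E × F) ∞ pt := by
  let := L.core.toTopologicalSpace
  let := L.core.toChartedSpace
  have := L.isManifold
  have := hπ.total_isManifold
  intro z
  let a := AdaptedChart.at E F π (pt z)
  have ha : pt z ∈ a.e.source := AdaptedChart.mem_at (pt z)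
  have h1 : pt =ᶠ[𝓝 z] (a.e.symm ∘ (fun q => (q.1, q.2.1)) ∘ L.chartHomeo a) := by
    filter_upwards [(L.chartHomeo a).open_source.mem_nhds ha] with y hy
    exact (a.e.left_inv hy).symm
  refine ContMDiffAt.congr_of_eventuallyEq ?_ h1
  refine ContMDiffAt.comp z (g := a.e.symm) (I' := 𝓘(ℝ, E × F)) ?_
    (ContMDiffAt.comp z (g := fun q : E × (F × G) => (q.1, q.2.1))
      (I' := 𝓘(ℝ, E × (F × G))) ?_
      (contMDiffAt_of_mem_maximalAtlas (L.chartHomeo_mem_maximalAtlas a) ha))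
  · exact contMDiffAt_symm_of_mem_maximalAtlas a.e_mem (a.e.map_source ha)
  · exact ContDiff.contMDiff (by fun_prop) |>.contMDiffAt

end LiftData

end Lift

/-! ### Vertical bundle, first jet bundle, and bundles of form-valued vertical covectors -/

/-- `Λᵏ(E*)`: the alternating `k`-forms on `E`. For `x` in a manifold `M` modelled on `E` this is
the fibre `Λᵏ T*_x M`, as `T_x M` is a copy of `E`. -/
def AltForm (E : Type*) [NormedAddCommGroup E] [NormedSpace ℝ E] (k : ℕ) : Type _ :=
  E [⋀^Fin k]→L[ℝ] ℝ

section AltForm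

variable {E : Type*} [NormedAddCommGroup E] [NormedSpace ℝ E] {k : ℕ}

instance : NormedAddCommGroup (AltForm E k) :=
  inferInstanceAs (NormedAddCommGroup (E [⋀^Fin k]→L[ℝ] ℝ))

instance : NormedSpace ℝ (AltForm E k) :=
  inferInstanceAs (NormedSpace ℝ (E [⋀^Fin k]→L[ℝ] ℝ))

/-- A form, as a continuous alternating map (this is the identity map). -/
def AltForm.toAlt : AltForm E k ≃ₗᵢ[ℝ] (E [⋀^Fin k]→L[ℝ] ℝ) :=
  LinearIsometryEquiv.refl ℝ (E [⋀^Fin k]→L[ℝ] ℝ)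

@[ext] theorem AltForm.ext {f g : AltForm E k} (h : ∀ v, f.toAlt v = g.toAlt v) : f = g :=
  AltForm.toAlt.injective (ContinuousAlternatingMap.ext h)

/-- Pull-back of alternating forms along a linear map, as a linear map of the form. -/
def AltForm.pullback (k : ℕ) (R : E →L[ℝ] E) : AltForm E k →L[ℝ] AltForm E k :=
  (AltForm.toAlt (E := E) (k := k)).symm.toContinuousLinearEquiv.toContinuousLinearMap.comp
    ((ContinuousAlternatingMap.compContinuousLinearMapCLM R).comp
      (AltForm.toAlt (E := E) (k := k)).toContinuousLinearEquiv.toContinuousLinearMap)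

theorem AltForm.pullback_apply (R : E →L[ℝ] E) (f : AltForm E k) (v : Fin k → E) :
    (AltForm.pullback k R f).toAlt v = f.toAlt fun i => R (v i) := rfl

theorem AltForm.pullback_comp_apply (R S : E →L[ℝ] E) (f : AltForm E k) :
    AltForm.pullback k (R.comp S) f = AltForm.pullback k S (AltForm.pullback k R f) := rfl

theorem AltForm.pullback_id_apply (f : AltForm E k) :
    AltForm.pullback k (ContinuousLinearMap.id ℝ E) f = f := rfl

@[simp] theorem AltForm.pullback_symm_apply (e : E ≃L[ℝ] E) (f : AltForm E k) :
    AltForm.pullback k (e.symm : E →L[ℝ] E) (AltForm.pullback k (e : E →L[ℝ] E) f) = f := by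
  ext v; simp [AltForm.pullback_apply]

@[simp] theorem AltForm.pullback_apply_symm (e : E ≃L[ℝ] E) (f : AltForm E k) :
    AltForm.pullback k (e : E →L[ℝ] E) (AltForm.pullback k (e.symm : E →L[ℝ] E) f) = f := by
  ext v; simp [AltForm.pullback_apply]

/-- The alternatization of multilinear forms, as a continuous linear map. -/
def altCLM (E : Type*) [NormedAddCommGroup E] [NormedSpace ℝ E] (k : ℕ) :
    ContinuousMultilinearMap ℝ (fun _ : Fin k => E) ℝ →L[ℝ] E [⋀^Fin k]→L[ℝ] ℝ :=
  LinearMap.mkContinuous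
    { toFun := ContinuousMultilinearMap.alternatization
      map_add' := map_add _
      map_smul' := fun c f => by
        ext v
        simp [ContinuousMultilinearMap.alternatization_apply_apply, Finset.mul_sum,
          mul_left_comm, Units.smul_def] }
    (Fintype.card (Equiv.Perm (Fin k))) (fun f => by
      refine ContinuousAlternatingMap.opNorm_le_bound _ (by positivity) fun v => ?_
      change ‖ContinuousMultilinearMap.alternatization f v‖ ≤ _
      rw [ContinuousMultilinearMap.alternatization_apply_apply]
      refine (norm_sum_le _ _).trans ?_
      refine (Finset.sum_le_card_nsmul _ _ (‖f‖ * ∏ i, ‖v i‖) fun σ _ => ?_).trans ?_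
      · have h := f.le_opNorm (v ∘ σ)
        have h2 : ∏ i, ‖(v ∘ σ) i‖ = ∏ i, ‖v i‖ := Equiv.prod_comp σ fun i => ‖v i‖
        rw [h2] at h
        rcases Int.units_eq_one_or (Equiv.Perm.sign σ) with hs | hs <;> simpa [hs] using h
      · simp [Finset.card_univ, mul_assoc])

theorem altCLM_apply (f : E [⋀^Fin k]→L[ℝ] ℝ) :
    altCLM E k f.toContinuousMultilinearMap = (k.factorial : ℝ) • f := by
  ext v
  have h := AlternatingMap.coe_alternatization f.toAlternatingMap
  have h' := DFunLike.congr_fun h v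
  simp only [AlternatingMap.smul_apply, Fintype.card_fin] at h'
  change ContinuousMultilinearMap.alternatization _ v = _
  rw [ContinuousMultilinearMap.alternatization_apply_apply]
  rw [MultilinearMap.alternatization_apply] at h'
  simpa [Function.comp_def] using h'

theorem contDiff_pullback : ContDiff ℝ ∞ (AltForm.pullback (E := E) k) := by
  have h1 : ContDiff ℝ ∞ (fun R : E →L[ℝ] E =>
      (ContinuousAlternatingMap.compContinuousLinearMapCLM R :
        (E [⋀^Fin k]→L[ℝ] ℝ) →L[ℝ] (E [⋀^Fin k]→L[ℝ] ℝ))) := by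
    have h1 : (fun R : E →L[ℝ] E =>
      (ContinuousAlternatingMap.compContinuousLinearMapCLM R :
        (E [⋀^Fin k]→L[ℝ] ℝ) →L[ℝ] (E [⋀^Fin k]→L[ℝ] ℝ))) = fun R =>
        ((k.factorial : ℝ)⁻¹ • altCLM E k).comp
          ((ContinuousMultilinearMap.compContinuousLinearMapContinuousMultilinear ℝ
            (fun _ : Fin k => E) (fun _ => E) ℝ (fun _ => R)).comp
            (ContinuousAlternatingMap.toContinuousMultilinearMapCLM ℝ)) := by
      funext R
      ext1 f
      have h2 := altCLM_apply (f.compContinuousLinearMap R)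
      have h3 : (f.compContinuousLinearMap R).toContinuousMultilinearMap =
        ContinuousMultilinearMap.compContinuousLinearMap f.toContinuousMultilinearMap
          (fun _ => R) := rfl
      rw [h3] at h2
      change f.compContinuousLinearMap R = (k.factorial : ℝ)⁻¹ • altCLM E k
        (ContinuousMultilinearMap.compContinuousLinearMap f.toContinuousMultilinearMap
          (fun _ => R))
      rw [h2, inv_smul_smul₀ (by positivity)]
    rw [h1]
    refine contDiff_const.clm_comp (ContDiff.clm_comp ?_ contDiff_const)
    exact (ContinuousMultilinearMap.contDiff _).comp (contDiff_pi.2 fun _ => contDiff_id)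
  exact contDiff_const.clm_comp (h1.clm_comp contDiff_const)

end AltForm

section Functors

variable (E F : Type*) [NormedAddCommGroup E] [NormedSpace ℝ E]
  [NormedAddCommGroup F] [NormedSpace ℝ F]
  {M Y : Type*} [TopologicalSpace M] [ChartedSpace E M]
  [TopologicalSpace Y] [ChartedSpace (E × F) Y]

/-- The vertical bundle `VY = ker Tπ` of `π : Y → M`. -/
@[ext] structure VertBundle (π : Y → M) where
  /-- the base point -/
  pt : Y
  /-- the vector -/
  vec : E × F
  vec_mem : vec ∈ vert E F π pt

/-- The first jet bundle `J¹Y` of `π : Y → M`: the jet at `x` of a section `s` is given by the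
point `s x` and by the linear map `T_x s : T_x M → T_{s x} Y`, a right inverse of `Tπ`. -/
@[ext] structure JetBundle (π : Y → M) where
  /-- the value of the jet -/
  pt : Y
  /-- the tangent map of the jet -/
  lin : E →L[ℝ] E × F
  comp_lin : (tmap (E × F) E π pt).comp lin = ContinuousLinearMap.id ℝ E

/-- The bundle `V*Y ⊗_Y ΛᵏM` over `Y`, of vertical covectors on `Y` with values in `k`-forms on
the base: its fibre at `y` is `Hom(V_y Y, Λᵏ T*_{π y} M) = V*_y Y ⊗ Λᵏ T*_{π y} M`. -/
@[ext] structure CovBundle (π : Y → M) (k : ℕ) where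
  /-- the base point -/
  pt : Y
  /-- the form-valued covector -/
  cov : vert E F π pt →L[ℝ] AltForm E k

variable {E F} {π : Y → M} [hπ : IsFibredManifold E F π]

section Smooth

theorem contDiffOn_fderiv_trans_comp (a b : AdaptedChart E F π)
    {G : Type*} [NormedAddCommGroup G] [NormedSpace ℝ G] :
    ContDiffOn ℝ ∞ (fun q : E × (F × G) => fderiv ℝ (a.trans b) (q.1, q.2.1))
      {q | (q.1, q.2.1) ∈ (a.trans b).source} :=
  ((a.contDiffOn_trans b).fderiv_of_isOpen (m := ∞) (a.trans b).open_source (by simp)).comp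
    (f := fun q : E × (F × G) => (q.1, q.2.1)) (by fun_prop) (fun q hq => hq)

theorem contDiffOn_trans_comp (a b : AdaptedChart E F π)
    {G : Type*} [NormedAddCommGroup G] [NormedSpace ℝ G] :
    ContDiffOn ℝ ∞ (fun q : E × (F × G) => a.trans b (q.1, q.2.1))
      {q | (q.1, q.2.1) ∈ (a.trans b).source} :=
  (a.contDiffOn_trans b).comp
    (f := fun q : E × (F × G) => (q.1, q.2.1)) (by fun_prop) (fun q hq => hq)

/-- The inverse of the derivative of the transition map, along the transition map. -/
theorem contDiffOn_fderiv_trans_symm (a b : AdaptedChart E F π)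
    {G : Type*} [NormedAddCommGroup G] [NormedSpace ℝ G] :
    ContDiffOn ℝ ∞ (fun q : E × (F × G) => fderiv ℝ (b.trans a) (a.trans b (q.1, q.2.1)))
      {q | (q.1, q.2.1) ∈ (a.trans b).source} :=
  ((b.contDiffOn_trans a).fderiv_of_isOpen (m := ∞) (b.trans a).open_source (by simp)).comp
    (contDiffOn_trans_comp a b) (fun _ hq => a.trans_maps b hq)

theorem contDiffOn_fderiv_transBase_symm (a b : AdaptedChart E F π)
    {G : Type*} [NormedAddCommGroup G] [NormedSpace ℝ G] :
    ContDiffOn ℝ ∞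
      (fun q : E × (F × G) => fderiv ℝ (b.transBase a) (a.trans b (q.1, q.2.1)).1)
      {q | (q.1, q.2.1) ∈ (a.trans b).source} :=
  ((b.contDiffOn_transBase a).fderiv_of_isOpen (m := ∞) (b.transBase a).open_source
    (by simp)).comp (contDiffOn_trans_comp a b).fst
    (fun _ hq => b.fst_mem_transBase_source a (a.trans_maps b hq))

theorem AdaptedChart.trans_apply (a b : AdaptedChart E F π) {y : Y} (hy : y ∈ a.e.source) :
    a.trans b (a.e y) = b.e y := by
  change b.e (a.e.symm (a.e y)) = _
  rw [a.e.left_inv hy]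

end Smooth

/-! #### The vertical bundle as a manifold -/

namespace VertBundle

variable (E F π) in
/-- Induced charts `(x, φ, v)` of the vertical bundle, where the vector is `v ∂/∂φ`. -/
def liftData : LiftData E F F π (pt : VertBundle E F π → Y) where
  coord a z hz := (a.dE hz z.vec).2
  build a y hy g := ⟨y, (a.dE hy).symm (0, g), a.dE_symm_mem_vert hy g⟩
  pt_build _ _ _ _ := rfl
  coord_build a y hy g := by simp
  build_coord a z hz := by
    ext1
    · rfl
    · simp [← a.dE_vert hz z.vec_mem]
  change a b q := (fderiv ℝ (a.trans b) (q.1, q.2.1) (0, q.2.2)).2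
  contDiffOn_change a b :=
    ((contDiffOn_fderiv_trans_comp a b).clm_apply (by fun_prop)).snd
  coord_eq a b z hz hz' := by
    rw [← a.dE_vert hz z.vec_mem, ← a.dE_trans b hz hz']
    simp

instance : TopologicalSpace (VertBundle E F π) := (liftData E F π).core.toTopologicalSpace

instance : ChartedSpace (E × (F × F)) (VertBundle E F π) := (liftData E F π).core.toChartedSpace

variable (E F π) in
/-- The projection `VY → M`. -/
def base : VertBundle E F π → M := π ∘ pt

instance : IsFibredManifold E (F × F) (base E F π) := (liftData E F π).isFibredManifold

end VertBundle

/-! #### The first jet bundle as a manifold -/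

namespace JetBundle

variable (E F π) in
/-- Induced charts `(x, φ, φ_μ)` of the first jet bundle. -/
def liftData : LiftData E F (E →L[ℝ] F) π (pt : JetBundle E F π → Y) where
  coord a z hz := ((ContinuousLinearMap.snd ℝ E F).comp
    (a.dE hz).toContinuousLinearMap).comp (z.lin.comp (a.dC hz).symm.toContinuousLinearMap)
  build a y hy B := ⟨y, (a.dE hy).symm.toContinuousLinearMap.comp
      (((ContinuousLinearMap.id ℝ E).prod B).comp (a.dC hy).toContinuousLinearMap), by
    ext X
    change tmap (E × F) E π y ((a.dE hy).symm (a.dC hy X, B (a.dC hy X))) = X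
    rw [a.tmap_dE_symm]; simp⟩
  pt_build _ _ _ _ := rfl
  coord_build a y hy g := by ext; simp
  build_coord a z hz := by
    ext1
    · rfl
    · ext1 X
      have h : (a.dE hz (z.lin X)).1 = a.dC hz X := by
        rw [a.dE_fst hz]
        exact congrArg _ (DFunLike.congr_fun z.comp_lin X)
      change (a.dE hz).symm (a.dC hz X, (a.dE hz (z.lin ((a.dC hz).symm (a.dC hz X)))).2) = _
      rw [ContinuousLinearEquiv.symm_apply_apply, ← h, Prod.mk.eta]
      simp
  change a b q := ((ContinuousLinearMap.snd ℝ E F).comp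
    (fderiv ℝ (a.trans b) (q.1, q.2.1))).comp
      (((ContinuousLinearMap.id ℝ E).prod q.2.2).comp
        (fderiv ℝ (b.transBase a) (a.trans b (q.1, q.2.1)).1))
  contDiffOn_change a b := by
    refine ContDiffOn.clm_comp (contDiffOn_const.clm_comp (contDiffOn_fderiv_trans_comp a b))
      (ContDiffOn.clm_comp ?_ (contDiffOn_fderiv_transBase_symm a b))
    have : (fun q : E × (F × (E →L[ℝ] F)) => (ContinuousLinearMap.id ℝ E).prod q.2.2) =
        fun q => ContinuousLinearMap.prodₗᵢ ℝ (ContinuousLinearMap.id ℝ E, q.2.2) := rfl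
    rw [this]
    exact (ContDiff.comp (LinearIsometryEquiv.contDiff _) (by fun_prop)).contDiffOn
  coord_eq a b z hz hz' := by
    ext1 X
    have h : ∀ X, (a.dE hz (z.lin X)).1 = a.dC hz X := fun X => by
      rw [a.dE_fst hz]
      exact congrArg _ (DFunLike.congr_fun z.comp_lin X)
    simp only [ContinuousLinearMap.comp_apply, Prod.mk.eta, a.trans_apply b hz]
    rw [← b.dC_trans a hz' hz]
    simp only [ContinuousLinearMap.prod_apply, ContinuousLinearMap.comp_apply,
      ContinuousLinearEquiv.coe_coe, ContinuousLinearEquiv.symm_apply_apply,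
      ContinuousLinearMap.coe_id', id_eq, ContinuousLinearMap.coe_snd']
    rw [← h, Prod.mk.eta, ← a.dE_trans b hz hz']
    simp

instance : TopologicalSpace (JetBundle E F π) := (liftData E F π).core.toTopologicalSpace

instance : ChartedSpace (E × (F × (E →L[ℝ] F))) (JetBundle E F π) :=
  (liftData E F π).core.toChartedSpace

variable (E F π) in
/-- The projection `J¹Y → M`. -/
def base : JetBundle E F π → M := π ∘ pt

instance : IsFibredManifold E (F × (E →L[ℝ] F)) (base E F π) := (liftData E F π).isFibredManifold

end JetBundle

/-! #### Bundles of form-valued vertical covectors as manifolds -/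

namespace CovBundle

variable {k : ℕ}

variable (E F π k) in
/-- Induced charts `(x, φ, p)` of `V*Y ⊗ ΛᵏM`, where the covector is `p δφ`, `p` a `k`-form. -/
def liftData : LiftData E F (F →L[ℝ] AltForm E k) π (pt : CovBundle E F π k → Y) where
  coord a z hz := (AltForm.pullback k (a.dC hz).symm.toContinuousLinearMap).comp
    (z.cov.comp (a.vertIso hz).symm.toContinuousLinearMap)
  build a y hy β := ⟨y, (AltForm.pullback k (a.dC hy).toContinuousLinearMap).comp
    (β.comp (a.vertIso hy).toContinuousLinearMap)⟩
  pt_build _ _ _ _ := rfl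
  coord_build a y hy g := by
    ext1 X
    simp
  build_coord a z hz := by
    ext1
    · rfl
    · apply heq_of_eq
      ext1 X
      simp
  change a b q := (AltForm.pullback k
      (fderiv ℝ (b.transBase a) (a.trans b (q.1, q.2.1)).1)).comp
    (q.2.2.comp ((ContinuousLinearMap.snd ℝ E F).comp
      ((fderiv ℝ (b.trans a) (a.trans b (q.1, q.2.1))).comp (ContinuousLinearMap.inr ℝ E F))))
  contDiffOn_change a b := by
    refine ContDiffOn.clm_comp
      (contDiff_pullback.comp_contDiffOn (contDiffOn_fderiv_transBase_symm a b))
      (ContDiffOn.clm_comp (by fun_prop) (contDiffOn_const.clm_comp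
        ((contDiffOn_fderiv_trans_symm a b).clm_comp contDiffOn_const)))
  coord_eq a b z hz hz' := by
    ext1 X
    have h1 : (b.vertIso hz').symm X =
        (a.vertIso hz).symm (fderiv ℝ (b.trans a) (b.e z.pt) (0, X)).2 := by
      apply (a.vertIso hz).injective
      rw [ContinuousLinearEquiv.apply_symm_apply, AdaptedChart.vertIso_apply,
        AdaptedChart.vertIso_symm_apply, b.dE_trans a hz' hz]
    have h2 : (fderiv ℝ (b.transBase a) (b.e z.pt).1) =
        (a.dC hz).toContinuousLinearMap.comp (b.dC hz').symm.toContinuousLinearMap := by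
      ext1 X
      rw [← b.dC_trans a hz' hz]; rfl
    simp only [Prod.mk.eta, a.trans_apply b hz, h2]
    ext v
    simp [h1, AltForm.pullback_apply]

instance : TopologicalSpace (CovBundle E F π k) := (liftData E F π k).core.toTopologicalSpace

instance : ChartedSpace (E × (F × (F →L[ℝ] AltForm E k))) (CovBundle E F π k) :=
  (liftData E F π k).core.toChartedSpace

variable (E F π k) in
/-- The projection `V*Y ⊗ ΛᵏM → M`. -/
def base : CovBundle E F π k → M := π ∘ pt

instance : IsFibredManifold E (F × (F →L[ℝ] AltForm E k)) (base E F π k) :=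
  (liftData E F π k).isFibredManifold

end CovBundle

end Functors

/-! ### Sections, jets, variations, and the operators `δ` and `d` -/

section Calculus

variable {E F : Type*} [NormedAddCommGroup E] [NormedSpace ℝ E]
  [NormedAddCommGroup F] [NormedSpace ℝ F]
  {M Y Y' : Type*} [TopologicalSpace M] [ChartedSpace E M]
  [TopologicalSpace Y] [ChartedSpace (E × F) Y]

/-- Exterior derivative at `x` of the differential `k`-form `x' ↦ β x' ∈ Λᵏ T*_{x'} M` on `M`,
computed in the preferred chart `c` at `x`: `(dβ)_x = c^* d((c⁻¹)^* β)`. -/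
def extDerivAt {k : ℕ} (β : M → AltForm E k) (x : M) : AltForm E (k + 1) :=
  AltForm.pullback (k + 1) (tmap E E (chartAt E x) x) (AltForm.toAlt.symm
    (extDeriv (fun u : E => (AltForm.pullback k (tmap E E (chartAt E x).symm u)
      (β ((chartAt E x).symm u))).toAlt) (chartAt E x x)))

variable (E F) in
/-- `s` is a smooth section of `π` near `x`. -/
def IsSectionAt (π : Y → M) (s : M → Y) (x : M) : Prop :=
  ∀ᶠ x' in 𝓝 x, π (s x') = x' ∧ ContMDiffAt 𝓘(ℝ, E) 𝓘(ℝ, E × F) ∞ s x'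

/-- `ζ` is the first jet `j¹ₓ s` at `x` of the local section `s`. -/
def IsJetAt {π : Y → M} (ζ : JetBundle E F π) (s : M → Y) (x : M) : Prop :=
  IsSectionAt E F π s x ∧ ζ.pt = s x ∧ ζ.lin = tmap E (E × F) s x

variable (E F) in
/-- `t ↦ s t` is a smooth one-parameter family of sections of `π` near `x`, for small `t`. -/
def IsVariationAt (π : Y → M) (s : ℝ → M → Y) (x : M) : Prop :=
  ∀ᶠ q : ℝ × M in 𝓝 (0, x), π (s q.1 q.2) = q.2 ∧
    ContMDiffAt (𝓘(ℝ, ℝ).prod 𝓘(ℝ, E)) 𝓘(ℝ, E × F) ∞ (fun q : ℝ × M => s q.1 q.2) q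

/-- The vertical vector `w ∈ V J¹Y` is the jet at `x` of the local section `v` of `VY → M`:
there is a family `s_t` of local sections of `Y` such that `v = ∂ₜ s_t` near `x` and
`w = ∂ₜ (j¹ₓ s_t)` at `t = 0`. -/
def IsJetOfVertical {π : Y → M} [IsFibredManifold E F π] (v : M → VertBundle E F π)
    (w : VertBundle E (F × (E →L[ℝ] F)) (JetBundle.base E F π)) (x : M) : Prop :=
  ∃ s : ℝ → M → Y, IsVariationAt E F π s x ∧
    (∀ᶠ x' in 𝓝 x, (v x').pt = s 0 x' ∧ (v x').vec = tmap ℝ (E × F) (fun t => s t x') 0 1) ∧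
    ∃ γ : ℝ → JetBundle E F π, (∀ᶠ t in 𝓝 (0 : ℝ), IsJetAt (γ t) (s t) x) ∧
      w.pt = γ 0 ∧ w.vec = tmap ℝ (E × (F × (E →L[ℝ] F))) γ 0 1

/-- `κ : J¹VY → VJ¹Y` is the canonical interchange map: it sends the first jet `j¹ₓ v` of a section
of `VY → M`, with `v = ∂ₜ s_t`, to the vertical vector `∂ₜ (j¹ₓ s_t)`. -/
def IsInterchange {π : Y → M} [IsFibredManifold E F π]
    (κ : JetBundle E (F × F) (VertBundle.base E F π) →
      VertBundle E (F × (E →L[ℝ] F)) (JetBundle.base E F π)) : Prop :=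
  ∀ (x : M) (v : M → VertBundle E F π) (ξ : JetBundle E (F × F) (VertBundle.base E F π))
    (w : VertBundle E (F × (E →L[ℝ] F)) (JetBundle.base E F π)),
    IsJetAt ξ v x → IsJetOfVertical v w x → κ ξ = w

open Classical in
/-- Evaluation of a form-valued vertical covector on a tangent vector `X` (zero if `X` is not
vertical). -/
def CovBundle.app {π : Y → M} {k : ℕ} (η : CovBundle E F π k) (X : E × F) : AltForm E k :=
  if h : X ∈ vert E F π η.pt then η.cov ⟨X, h⟩ else 0

variable (E F) in
/-- Vertical `r`-forms on `Y` with values in `k`-forms on the base, i.e. sections (not necessarily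
smooth) of `Λʳ V*Y ⊗ ΛᵏM`. -/
def VertForm (π : Y → M) (r k : ℕ) : Type _ :=
  ∀ y : Y, (vert E F π y) [⋀^Fin r]→L[ℝ] AltForm E k

open Classical in
/-- Evaluation of a vertical form on tangent vectors (zero if one of them is not vertical). -/
def VertForm.app {π : Y → M} {r k : ℕ} (α : VertForm E F π r k) (y : Y) (X : Fin r → E × F) :
    AltForm E k :=
  if h : ∀ i, X i ∈ vert E F π y then α y fun i => ⟨X i, h i⟩ else 0

/-- `Ω = δθ` is the vertical differential of the one-form `θ`, i.e. its exterior derivative along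
each fibre of `π`: for every smooth map `σ` from a neighbourhood of `0 ∈ ℝ²` to a fibre of `π`,
`σ^*Ω = d(σ^*θ)`. -/
def IsVerticalDifferential {π : Y → M} {k : ℕ} (θ : VertForm E F π 1 k)
    (Ω : VertForm E F π 2 k) : Prop :=
  ∀ σ : ℝ × ℝ → Y,
    (∀ᶠ a in 𝓝 (0 : ℝ × ℝ), π (σ a) = π (σ 0) ∧ ContMDiffAt 𝓘(ℝ, ℝ × ℝ) 𝓘(ℝ, E × F) ∞ σ a) →
    Ω.app (σ 0) ![tmap (ℝ × ℝ) (E × F) σ 0 (1, 0), tmap (ℝ × ℝ) (E × F) σ 0 (0, 1)] =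
      fderiv ℝ (fun a => θ.app (σ a) ![tmap (ℝ × ℝ) (E × F) σ a (0, 1)]) 0 (1, 0) -
      fderiv ℝ (fun a => θ.app (σ a) ![tmap (ℝ × ℝ) (E × F) σ a (1, 0)]) 0 (0, 1)

/-- `β = dα` is the space-time differential of the vertical `r`-form `α` on `Y` with values in
`k`-forms on `M`: a vertical `r`-form on `J¹Y` with values in `(k+1)`-forms on `M`. At
`ζ = j¹ₓ s`, on the vertical vectors `wᵢ = j¹ₓ vᵢ ∈ V J¹Y` with `vᵢ` sections of `VY` along `s`,
it is the exterior derivative at `x` of the `k`-form `α_s(v₁, …, v_r)` on `M`. -/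
def IsSpacetimeDifferential {π : Y → M} [IsFibredManifold E F π] {r k : ℕ}
    (α : VertForm E F π r k)
    (β : VertForm E (F × (E →L[ℝ] F)) (JetBundle.base E F π) r (k + 1)) : Prop :=
  ∀ (x : M) (s : M → Y) (ζ : JetBundle E F π) (v : Fin r → M → VertBundle E F π)
    (w : Fin r → VertBundle E (F × (E →L[ℝ] F)) (JetBundle.base E F π)),
    IsJetAt ζ s x → (∀ i, IsSectionAt E (F × F) (VertBundle.base E F π) (v i) x) →
    (∀ i, ∀ᶠ x' in 𝓝 x, (v i x').pt = s x') → (∀ i, IsJetOfVertical (v i) (w i) x) →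
    β.app ζ (fun i => (w i).vec) =
      extDerivAt (fun x' => α.app (s x') fun i => (v i x').vec) x

/-- The degeneracy space at `y` of a vertical two-form: the vertical vectors whose contraction with
the form vanishes. -/
def VertForm.degeneracy {π : Y → M} {k : ℕ} (Ω : VertForm E F π 2 k) (y : Y) : Set (E × F) :=
  {X | X ∈ vert E F π y ∧ ∀ X' ∈ vert E F π y, Ω.app y ![X, X'] = 0}

/-- Two points can be joined by a smooth curve tangent to the degeneracy distribution. -/
def VertForm.Joined {π : Y → M} {k : ℕ} (Ω : VertForm E F π 2 k) (y y' : Y) : Prop :=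
  ∃ γ : ℝ → Y, ContMDiff 𝓘(ℝ, ℝ) 𝓘(ℝ, E × F) ∞ γ ∧ γ 0 = y ∧ γ 1 = y' ∧
    ∀ t, tmap ℝ (E × F) γ t 1 ∈ Ω.degeneracy (γ t)

/-- Lying on the same leaf of the degeneracy distribution: the points can be joined by a finite
chain of smooth curves tangent to the distribution. -/
def VertForm.leafSetoid {π : Y → M} {k : ℕ} (Ω : VertForm E F π 2 k) : Setoid Y :=
  Relation.EqvGen.setoid Ω.Joined

/-- The degeneracy leaf through `y`. -/
def VertForm.leaf {π : Y → M} {k : ℕ} (Ω : VertForm E F π 2 k) (y : Y) : Set Y :=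
  {y' | Ω.leafSetoid y y'}

/-- The space of leaves `Y / (degeneracy of Ω)`, with the quotient topology. -/
abbrev VertForm.LeafSpace {π : Y → M} {k : ℕ} (Ω : VertForm E F π 2 k) : Type _ :=
  Quotient Ω.leafSetoid

end Calculus

/-! ### The phase bundle and its canonical forms -/

section Phase

variable (E F : Type*) [NormedAddCommGroup E] [NormedSpace ℝ E]
  [NormedAddCommGroup F] [NormedSpace ℝ F]
  {M Q : Type*} [TopologicalSpace M] [ChartedSpace E M]
  [TopologicalSpace Q] [ChartedSpace (E × F) Q] (π : Q → M) (m : ℕ)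

/-- The model of the fibres of `J¹Q → M`. -/
abbrev JetFibre : Type _ := F × (E →L[ℝ] F)

/-- The model of the fibres of `V*Q ⊗ ΛᵏM → M`. -/
abbrev CovFibre (k : ℕ) : Type _ := F × (F →L[ℝ] AltForm E k)

/-- The phase bundle `P = V*Q ⊗_Q Λᵐ M`, where `m = dim M - 1`. -/
abbrev PhaseBundle : Type _ := CovBundle E F π m

variable [IsFibredManifold E F π]

/-- The first jet extension `J¹P` of the phase bundle `P → M`. -/
abbrev JetPhaseBundle : Type _ :=
  JetBundle E (CovFibre E F m) (CovBundle.base E F π m)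

/-- The infinitesimal configuration bundle `Q^I = J¹Q`. -/
abbrev InfConfBundle : Type _ := JetBundle E F π

/-- The bundle `V*Q^I ⊗_{Q^I} Λᵏ M`. -/
abbrev InfCovBundle (k : ℕ) : Type _ :=
  CovBundle E (JetFibre E F) (JetBundle.base E F π) k

variable {E F π m}

theorem PhaseBundle.mdifferentiableAt_pt (p : PhaseBundle E F π m) :
    MDifferentiableAt 𝓘(ℝ, E × CovFibre E F m) 𝓘(ℝ, E × F)
      (CovBundle.pt : PhaseBundle E F π m → Q) p :=
  ((CovBundle.liftData E F π m).contMDiff_pt p).mdifferentiableAt (by simp)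

theorem PhaseBundle.tmap_base (p : PhaseBundle E F π m) :
    tmap (E × CovFibre E F m) E (CovBundle.base E F π m) p =
      (tmap (E × F) E π p.pt).comp
        (tmap (E × CovFibre E F m) (E × F) (CovBundle.pt : PhaseBundle E F π m → Q) p) :=
  tmap_comp p (IsFibredManifold.mdifferentiableAt E F π p.pt) (mdifferentiableAt_pt p)

/-- The restriction `V_p P → V_{Π p} Q` of the tangent map of `Π : P → Q`. -/
def PhaseBundle.vertProj (p : PhaseBundle E F π m) :
    vert E (CovFibre E F m) (CovBundle.base E F π m) p →L[ℝ] vert E F π p.pt :=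
  ((tmap (E × CovFibre E F m) (E × F) (CovBundle.pt : PhaseBundle E F π m → Q) p).comp
    (vert E (CovFibre E F m) (CovBundle.base E F π m) p).subtypeL).codRestrict _ fun X => by
      have h := mem_vert.1 X.2
      rw [tmap_base] at h
      exact h

variable (E F π m) in
/-- The canonical one-form `θ_p = Π^* p` on the phase bundle. -/
def canonicalForm : VertForm E (CovFibre E F m) (CovBundle.base E F π m) 1 m := fun p =>
  ContinuousAlternatingMap.ofSubsingleton ℝ _ _ (0 : Fin 1)
    (p.cov.comp (PhaseBundle.vertProj p))

variable (E F π m) in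
/-- The first jet extension `j¹Π : J¹P → J¹Q = Q^I` of the projection `Π : P → Q`. -/
def jetProj (ζ : JetPhaseBundle E F π m) : InfConfBundle E F π where
  pt := ζ.pt.pt
  lin := (tmap (E × CovFibre E F m) (E × F)
    (CovBundle.pt : PhaseBundle E F π m → Q) ζ.pt).comp ζ.lin
  comp_lin := by
    rw [← ContinuousLinearMap.comp_assoc, ← PhaseBundle.tmap_base]
    exact ζ.comp_lin

end Phase

/-! ### Properties of the map from jets of momenta to covectors on `Q^I` -/

section Pairing

variable {E F : Type*} [NormedAddCommGroup E] [NormedSpace ℝ E]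
  [NormedAddCommGroup F] [NormedSpace ℝ F]
  {M Q : Type*} [TopologicalSpace M] [ChartedSpace E M]
  [TopologicalSpace Q] [ChartedSpace (E × F) Q] {π : Q → M} [IsFibredManifold E F π] {m : ℕ}

/-- `Ψ` respects the fibrations over `Q^I`, and it is given by
`⟨w, Ψ(ζ)⟩ = (d⟨v, p⟩)ₓ` whenever `ζ = j¹ₓ p` for a local section `p` of `P → M` and `w ∈ V Q^I`
corresponds under `κ : J¹VQ ≅ VJ¹Q` to the jet `ξ = j¹ₓ v` of a local section `v` of `VQ → M` lying
over the same section of `Q → M` as `p`. -/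
structure IsJetPairing
    (κ : JetBundle E (F × F) (VertBundle.base E F π) →
      VertBundle E (JetFibre E F) (JetBundle.base E F π))
    (Ψ : JetPhaseBundle E F π m → InfCovBundle E F π (m + 1)) : Prop where
  pt_eq : ∀ ζ, (Ψ ζ).pt = jetProj E F π m ζ
  app_eq : ∀ (x : M) (p : M → PhaseBundle E F π m) (v : M → VertBundle E F π)
    (ζ : JetPhaseBundle E F π m) (ξ : JetBundle E (F × F) (VertBundle.base E F π)),
    IsJetAt ζ p x → IsJetAt ξ v x → (∀ᶠ x' in 𝓝 x, (v x').pt = (p x').pt) →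
    (Ψ ζ).app (κ ξ).vec = extDerivAt (fun x' => (p x').app (v x').vec) x

/-- `Ψ` is linear along the fibres of `J¹P → Q^I`, where linear combinations of jets of momenta over
the same section of `Q` are the jets of the linear combinations. -/
def IsFibrewiseLinear (Ψ : JetPhaseBundle E F π m → InfCovBundle E F π (m + 1)) : Prop :=
  ∀ (x : M) (p p' p'' : M → PhaseBundle E F π m) (ζ ζ' ζ'' : JetPhaseBundle E F π m) (a b : ℝ),
    IsJetAt ζ p x → IsJetAt ζ' p' x → IsJetAt ζ'' p'' x →
    (∀ᶠ x' in 𝓝 x, (p' x').pt = (p x').pt ∧ (p'' x').pt = (p x').pt ∧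
      ∀ X, (p'' x').app X = a • (p x').app X + b • (p' x').app X) →
    ∀ X, (Ψ ζ'').app X = a • (Ψ ζ).app X + b • (Ψ ζ').app X

end Pairing

/-- Smooth submersions between (finite-dimensional) manifolds modelled on `V` and `V'`. -/
def IsSmoothSubmersion (V V' : Type*) [NormedAddCommGroup V] [NormedSpace ℝ V]
    [NormedAddCommGroup V'] [NormedSpace ℝ V']
    {X X' : Type*} [TopologicalSpace X] [ChartedSpace V X] [TopologicalSpace X']
    [ChartedSpace V' X'] (f : X → X') : Prop :=
  ContMDiff 𝓘(ℝ, V) 𝓘(ℝ, V') ∞ f ∧ ∀ x, Function.Surjective (tmap V V' f x)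

end

set_option linter.unusedSectionVars false

/-! Everything is read in charts induced by one adapted chart `(x, φ)` of `Q`, in which every map
involved is linear. A jet of a momentum has coordinates `(x; φ, p; A, B)`, with `A = ∂φ` and `B =
∂p`. The product rule gives `d⟨v, p⟩ = B ∧ v + p ∧ W` for a vertical field with value `v` and
derivative `W` (`wedge_fderiv`), so `Ψ` must send these coordinates to `(x; φ, A; (v, W) ↦ B ∧ v + p
∧ W)`. This is `momentumCoord`, whose last entry is `momentumMap`. Likewise `κ` is a mere
reshuffling of coordinates, because partial derivatives commute.

The algebraic core is that, in top degree, `momentumMap` is onto all maps from `(v, W)` to top forms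
(`momentumMap_surjective`). The reason is that contractions of a volume form with basis vectors are
dual to the coordinate one-forms under the wedge product. Surjectivity makes `Ψ` a surjective open
submersion, and it also gives the separation statement `momentumMap_separating`: no nonzero `(v, W)`
is killed by all momenta.

In the same coordinates `ω = δp ∧ δφ`, and its space-time differential pairs the momentum part of
one vector with the configuration part of the other through `momentumMap`, then antisymmetrizes.
Testing a vertical vector against pure momenta and then against pure configurations shows that it is
degenerate exactly when its configuration part vanishes and `momentumMap` kills its momentum part
(`antisymmetrize_jetPairing_degenerate`). These are the equations of the kernel of `momentumCoord`,
whence `ker_tmap_jetMomentum`. A curve tangent to the degeneracy distribution therefore has locally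
constant image under `Ψ`. Conversely, two points with the same image lie over the same point of `Q`,
and the straight segment between them in an induced chart stays in the fibre. So fibres are leaves,
the leaf space is homeomorphic to the target because `Ψ` is open and onto, and the smooth structure
is transported.

The canonical objects are defined at each point through a chosen chart. They are then shown to
satisfy the intrinsic property phrased with local sections. As all jets and vertical vectors have
representative sections (`JetBundle.exists_representatives`, `exists_pairing_representatives`) and
all pairs of vertical vectors are tangent to surfaces in the fibre (`exists_vertical_surface`),
these properties determine the objects. This yields both uniqueness and independence of the chart.
-/

noncomputable section

/-! ### Linear algebra of top-degree forms and of the momentum pairing -/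

section LinearAlgebra

variable {E F : Type*} [NormedAddCommGroup E] [NormedSpace ℝ E]
  [NormedAddCommGroup F] [NormedSpace ℝ F]

/-- The antisymmetrizeetrization `E* ⊗ Λᵏ E* → Λᵏ⁺¹ E*`. -/
def AltForm.wedge (E : Type*) [NormedAddCommGroup E] [NormedSpace ℝ E] (k : ℕ) :
    (E →L[ℝ] AltForm E k) →L[ℝ] AltForm E (k + 1) :=
  (AltForm.toAlt (E := E) (k := k + 1)).symm.toContinuousLinearEquiv.toContinuousLinearMap.comp
    ((ContinuousAlternatingMap.alternatizeUncurryFinCLM ℝ E ℝ).comp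
      (ContinuousLinearMap.compL ℝ E (AltForm E k) (E [⋀^Fin k]→L[ℝ] ℝ)
        (AltForm.toAlt (E := E) (k := k)).toContinuousLinearEquiv.toContinuousLinearMap))

theorem AltForm.wedge_apply {k : ℕ} (f : E →L[ℝ] AltForm E k) (v : Fin (k + 1) → E) :
    (AltForm.wedge E k f).toAlt v =
      ∑ i : Fin (k + 1), (-1) ^ (i : ℕ) • (f (v i)).toAlt (i.removeNth v) :=
  ContinuousAlternatingMap.alternatizeUncurryFin_apply
    ((AltForm.toAlt (E := E) (k := k)).toContinuousLinearEquiv.toContinuousLinearMap.comp f) v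

/-- The map sending the value `p` and the derivative `B` of a momentum to the covector
`(v, W) ↦ d⟨v, p⟩ = B ∧ v + p ∧ W` on jets of vertical vectors. -/
def momentumMap (E F : Type*) [NormedAddCommGroup E] [NormedSpace ℝ E]
    [NormedAddCommGroup F] [NormedSpace ℝ F] (m : ℕ) :
    ((F →L[ℝ] AltForm E m) × (E →L[ℝ] F →L[ℝ] AltForm E m)) →L[ℝ]
      (F × (E →L[ℝ] F)) →L[ℝ] AltForm E (m + 1) :=
  ContinuousLinearMap.coprod
    ((ContinuousLinearMap.compL ℝ _ _ _ (AltForm.wedge E m)).comp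
      (((ContinuousLinearMap.compL ℝ (F × (E →L[ℝ] F)) (E →L[ℝ] F) (E →L[ℝ] AltForm E m)).flip
          (ContinuousLinearMap.snd ℝ F (E →L[ℝ] F))).comp
        (ContinuousLinearMap.compL ℝ E F (AltForm E m))))
    ((ContinuousLinearMap.compL ℝ _ _ _ (AltForm.wedge E m)).comp
      (((ContinuousLinearMap.compL ℝ (F × (E →L[ℝ] F)) F (E →L[ℝ] AltForm E m)).flip
          (ContinuousLinearMap.fst ℝ F (E →L[ℝ] F))).comp
        (ContinuousLinearMap.flipₗᵢ ℝ E F (AltForm E m)).toContinuousLinearEquiv.toContinuousLinearMap))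

theorem momentumMap_apply {m : ℕ} (p : F →L[ℝ] AltForm E m) (B : E →L[ℝ] F →L[ℝ] AltForm E m)
    (v : F) (W : E →L[ℝ] F) :
    momentumMap E F m (p, B) (v, W) = AltForm.wedge E m (B.flip v + p.comp W) := by
  refine Eq.trans (add_comm _ _) (map_add (AltForm.wedge E m) _ _).symm

/-- A top-degree form contracted with a vector. -/
def AltForm.contract {k : ℕ} (f : AltForm E (k + 1)) : E →L[ℝ] AltForm E k :=
  (AltForm.toAlt (E := E) (k := k)).symm.toContinuousLinearEquiv.toContinuousLinearMap.comp
    f.toAlt.curryLeft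

/-- The form `l ∧ f` has degree `m + 2`, one more than the dimension, so it vanishes. Expanding it
with `X` in the first slot isolates the term `l X • f`; the remaining terms are minus the wedge of
`l` with the contraction of `f`. -/
theorem AltForm.wedge_smulRight_contract [FiniteDimensional ℝ E] {m : ℕ}
    (hn : Module.finrank ℝ E = m + 1) (l : E →L[ℝ] ℝ) (f : AltForm E (m + 1)) (X : E) :
    AltForm.wedge E m (l.smulRight (f.contract X)) = l X • f := by
  have h0 : AltForm.wedge E (m + 1) (l.smulRight f) = 0 := by
    ext v
    refine (AltForm.wedge E (m + 1) (l.smulRight f)).toAlt.toAlternatingMap.map_linearDependent v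
      fun hv => ?_
    have := hv.fintype_card_le_finrank
    simp [hn] at this
  ext v
  have h1 : (AltForm.wedge E (m + 1) (l.smulRight f)).toAlt (Matrix.vecCons X v) = 0 := by
    rw [h0]; rfl
  rw [AltForm.wedge_apply, Fin.sum_univ_succ] at h1
  rw [AltForm.wedge_apply]
  have h2 : ∀ i : Fin (m + 1), (Fin.removeNth i.succ (Matrix.vecCons X v) : Fin (m + 1) → E) =
      Matrix.vecCons X (i.removeNth v) := by
    intro i
    ext j
    refine Fin.cases ?_ (fun j => ?_) j <;> simp [Fin.removeNth]
  simp only [h2] at h1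
  have h3 : (Fin.removeNth 0 (Matrix.vecCons X v) : Fin (m + 1) → E) = v := by
    ext j; simp [Fin.removeNth]
  rw [h3] at h1
  simp only [Fin.val_zero, pow_zero, one_smul, Matrix.cons_val_zero, Fin.val_succ, pow_succ,
    mul_neg, mul_one, neg_smul, Finset.sum_neg_distrib, Matrix.cons_val_succ] at h1
  exact (sub_eq_zero.1 ((sub_eq_add_neg _ _).trans h1)).symm

/-- The determinant in a basis serves as volume form, and the coefficient of a top form is its value
on that basis. -/
theorem AltForm.exists_eq_smul [FiniteDimensional ℝ E] {m : ℕ}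
    (hn : Module.finrank ℝ E = m + 1) :
    ∃ vol : AltForm E (m + 1), vol ≠ 0 ∧ ∃ l : AltForm E (m + 1) →L[ℝ] ℝ, ∀ f, f = l f • vol := by
  let b := Module.finBasisOfFinrankEq ℝ E hn
  let vol : AltForm E (m + 1) := AltForm.toAlt.symm
    { b.det with
      cont := by
        change Continuous fun v => b.det v
        simp only [Module.Basis.det_apply]
        refine Continuous.matrix_det (continuous_pi fun i => continuous_pi fun j => ?_)
        exact ((b.coord i).continuous_of_finiteDimensional).comp (continuous_apply j) }
  have hvol : vol.toAlt b = 1 := b.det_self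
  refine ⟨vol, fun h => ?_, (ContinuousAlternatingMap.apply ℝ E ℝ b).comp
      AltForm.toAlt.toContinuousLinearEquiv.toContinuousLinearMap,
    fun f => ?_⟩
  · rw [h] at hvol
    exact zero_ne_one hvol
  · ext v
    have := DFunLike.congr_fun (f.toAlt.toAlternatingMap.eq_smul_basis_det b) v
    exact this

/-- With `ε i` the dual basis, `ε i ∧ (b j ⌟ vol) = δ_ij vol`. Hence a momentum with components `q
i` along `b i ⌟ vol` reproduces any functional of `W`, and a derivative `B` with prescribed
divergence reproduces any functional of `v`. -/
theorem momentumMap_surjective [FiniteDimensional ℝ E] [FiniteDimensional ℝ F] {m : ℕ}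
    (hn : Module.finrank ℝ E = m + 1) : Function.Surjective (momentumMap E F m) := by
  intro η
  obtain ⟨vol, -, l, hl⟩ := AltForm.exists_eq_smul hn
  let b := Module.finBasisOfFinrankEq ℝ E hn
  let ε (i) : E →L[ℝ] ℝ := (b.coord i).toContinuousLinearMap
  have hε : ∀ i j, ε i (b j) = if i = j then 1 else 0 := fun i j => by
    simp [ε, Finsupp.single_apply, eq_comm]
  -- The two functionals `l1` and `l2` are the coefficients, relative to `vol`, of `η` on values `v`
  -- and on derivatives `W`.
  let l1 : F →L[ℝ] ℝ := l.comp (η.comp (ContinuousLinearMap.inl ℝ _ _))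
  let l2 : (E →L[ℝ] F) →L[ℝ] ℝ := l.comp (η.comp (ContinuousLinearMap.inr ℝ _ _))
  let q (i) : F →L[ℝ] ℝ := l2.comp (ContinuousLinearMap.smulRightL ℝ E F (ε i))
  let p : F →L[ℝ] AltForm E m := ∑ i, (q i).smulRight (vol.contract (b i))
  -- Only the divergence of `B` matters, so it is concentrated in the single direction `0`, which
  -- exists because the dimension is `m + 1`.
  let B : E →L[ℝ] F →L[ℝ] AltForm E m := (ε 0).smulRight (l1.smulRight (vol.contract (b 0)))
  refine ⟨(p, B), ?_⟩
  refine ContinuousLinearMap.ext fun ⟨v, W⟩ => ?_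
  rw [momentumMap_apply, map_add]
  have h1 : B.flip v = (ε 0).smulRight (l1 v • vol.contract (b 0)) := rfl
  have h2 : p.comp W = ∑ i, ((q i).comp W).smulRight (vol.contract (b i)) := by
    ext1 e; simp [p]
  have h3 : W = ∑ i, ContinuousLinearMap.smulRight (ε i) (W (b i)) := by
    ext1 e
    conv_lhs => rw [← b.sum_repr e, map_sum]
    simp [ε]
  have h4 : l2 W = ∑ i, q i (W (b i)) := by
    conv_lhs => rw [h3]
    rw [map_sum]; rfl
  have h5 : (ε 0).smulRight (l1 v • vol.contract (b 0)) =
    l1 v • (ε 0).smulRight (vol.contract (b 0)) := by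
    ext1 e
    exact smul_comm (ε 0 e) (l1 v) (vol.contract (b 0))
  rw [h1, h2, h5, map_smul, map_sum, AltForm.wedge_smulRight_contract hn, hε]
  simp only [AltForm.wedge_smulRight_contract hn]
  rw [hl (η (v, W))]
  have h6 : l (η (v, W)) = l1 v + l2 W := by
    simp only [l1, l2, ContinuousLinearMap.comp_apply, ← map_add]
    simp
  rw [h6, h4, add_smul, Finset.sum_smul]
  simp

/-- A nonzero `u` is detected by some functional `g`, and `g` times a volume form is a value of
`momentumMap` by surjectivity. -/
theorem momentumMap_separating [FiniteDimensional ℝ E] [FiniteDimensional ℝ F] {m : ℕ}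
    (hn : Module.finrank ℝ E = m + 1) {u : F × (E →L[ℝ] F)}
    (hu : ∀ pB, momentumMap E F m pB u = 0) : u = 0 := by
  obtain ⟨vol, hvol, -⟩ := AltForm.exists_eq_smul hn
  by_contra h
  obtain ⟨g, hg⟩ := SeparatingDual.exists_eq_one (R := ℝ) h
  obtain ⟨pB, hpB⟩ := momentumMap_surjective (F := F) hn (g.smulRight vol)
  have := hu pB
  rw [hpB] at this
  simp [hg, hvol] at this

instance [FiniteDimensional ℝ E] (k : ℕ) : CompleteSpace (AltForm E k) :=
  inferInstanceAs (CompleteSpace (E [⋀^Fin k]→L[ℝ] ℝ))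

/-- The alternating form `(X, Y) ↦ b X Y - b Y X`. -/
def antisymmetrize {V W : Type*} [NormedAddCommGroup V] [NormedSpace ℝ V] [NormedAddCommGroup W]
    [NormedSpace ℝ W] (b : V →L[ℝ] V →L[ℝ] W) : V [⋀^Fin 2]→L[ℝ] W where
  toFun X := b (X 0) (X 1) - b (X 1) (X 0)
  map_update_add' X i Y Z := by fin_cases i <;> simp [Function.update] <;> abel
  map_update_smul' X i c Y := by fin_cases i <;> simp [Function.update, smul_sub]
  map_eq_zero_of_eq' X i j hX hij := by
    have : X 0 = X 1 := by fin_cases i <;> fin_cases j <;> simp_all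
    simp [this]
  cont := by fun_prop

theorem antisymmetrize_apply {V W : Type*} [NormedAddCommGroup V] [NormedSpace ℝ V]
    [NormedAddCommGroup W] [NormedSpace ℝ W] (b : V →L[ℝ] V →L[ℝ] W) (X : Fin 2 → V) :
    antisymmetrize b X = b (X 0) (X 1) - b (X 1) (X 0) := rfl

end LinearAlgebra

/-! ### Partial derivatives of one-parameter families -/

section SwapDerivatives

variable {E F : Type*} [NormedAddCommGroup E] [NormedSpace ℝ E]
  [NormedAddCommGroup F] [NormedSpace ℝ F]

theorem fderiv_partial_left {σ : ℝ × E → F} {t : ℝ} {u : E}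
    (h : DifferentiableAt ℝ σ (t, u)) :
    fderiv ℝ (fun t => σ (t, u)) t = (fderiv ℝ σ (t, u)).comp (ContinuousLinearMap.inl ℝ ℝ E) :=
  (h.hasFDerivAt.comp t (hasFDerivAt_prodMk_left t u)).fderiv

theorem fderiv_partial_right {σ : ℝ × E → F} {t : ℝ} {u : E}
    (h : DifferentiableAt ℝ σ (t, u)) :
    fderiv ℝ (fun u => σ (t, u)) u = (fderiv ℝ σ (t, u)).comp (ContinuousLinearMap.inr ℝ ℝ E) :=
  (h.hasFDerivAt.comp u (hasFDerivAt_prodMk_right t u)).fderiv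

theorem eventually_differentiableAt {σ : ℝ × E → F} {q : ℝ × E} (h : ContDiffAt ℝ ∞ σ q) :
    ∀ᶠ q' in 𝓝 q, DifferentiableAt ℝ σ q' := by
  have := (h.of_le (m := 1) ENat.LEInfty.out).eventually (by simp)
  filter_upwards [this] with q' hq' using hq'.differentiableAt (by simp)

theorem contDiffAt_fderiv_partial_right {σ : ℝ × E → F} {t : ℝ} {u : E}
    (h : ContDiffAt ℝ ∞ σ (t, u)) :
    ContDiffAt ℝ ∞ (fun t => fderiv ℝ (fun u => σ (t, u)) u) t := by
  have h1 : ContDiffAt ℝ ∞ (fun t => (fderiv ℝ σ (t, u)).comp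
      (ContinuousLinearMap.inr ℝ ℝ E)) t :=
    ContDiffAt.clm_comp ((h.fderiv_right (m := ∞) (by simp)).comp t
      (f := fun t => (t, u)) (by fun_prop)) contDiffAt_const
  refine h1.congr_of_eventuallyEq ?_
  have h2 : Tendsto (fun t => (t, u)) (𝓝 t) (𝓝 (t, u)) :=
    ((by fun_prop : Continuous fun t : ℝ => (t, u))).continuousAt
  filter_upwards [h2.eventually (eventually_differentiableAt h)] with t' ht'
  exact fderiv_partial_right ht'

theorem contDiffAt_fderiv_partial_left {σ : ℝ × E → F} {t : ℝ} {u : E}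
    (h : ContDiffAt ℝ ∞ σ (t, u)) :
    ContDiffAt ℝ ∞ (fun u => fderiv ℝ (fun t => σ (t, u)) t 1) u := by
  have h1 : ContDiffAt ℝ ∞ (fun u => fderiv ℝ σ (t, u) (1, 0)) u :=
    ContDiffAt.clm_apply ((h.fderiv_right (m := ∞) (by simp)).comp u
      (f := fun u => (t, u)) (by fun_prop)) contDiffAt_const
  refine h1.congr_of_eventuallyEq ?_
  have h2 : Tendsto (fun u => (t, u)) (𝓝 u) (𝓝 (t, u)) :=
    ((by fun_prop : Continuous fun u : E => (t, u))).continuousAt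
  filter_upwards [h2.eventually (eventually_differentiableAt h)] with u' hu'
  rw [fderiv_partial_left hu']
  rfl

/-- Partial derivatives commute. -/
theorem fderiv_partial_comm {σ : ℝ × E → F} {t : ℝ} {u : E} (h : ContDiffAt ℝ ∞ σ (t, u)) :
    fderiv ℝ (fun t => fderiv ℝ (fun u => σ (t, u)) u) t 1 =
      fderiv ℝ (fun u => fderiv ℝ (fun t => σ (t, u)) t 1) u := by
  have hD : DifferentiableAt ℝ (fderiv ℝ σ) (t, u) :=
    (h.fderiv_right (m := ∞) (by simp)).differentiableAt (by simp)
  have h2 : Tendsto (fun t => (t, u)) (𝓝 t) (𝓝 (t, u)) :=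
    ((by fun_prop : Continuous fun t : ℝ => (t, u))).continuousAt
  have h3 : Tendsto (fun u => (t, u)) (𝓝 u) (𝓝 (t, u)) :=
    ((by fun_prop : Continuous fun u : E => (t, u))).continuousAt
  have e1 : (fun t => fderiv ℝ (fun u => σ (t, u)) u) =ᶠ[𝓝 t]
      fun t => (fderiv ℝ σ (t, u)).comp (ContinuousLinearMap.inr ℝ ℝ E) := by
    filter_upwards [h2.eventually (eventually_differentiableAt h)] with t' ht'
    exact fderiv_partial_right ht'
  have e2 : (fun u => fderiv ℝ (fun t => σ (t, u)) t 1) =ᶠ[𝓝 u]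
      fun u => fderiv ℝ σ (t, u) (1, 0) := by
    filter_upwards [h3.eventually (eventually_differentiableAt h)] with u' hu'
    rw [fderiv_partial_left hu']
    rfl
  rw [e1.fderiv_eq, e2.fderiv_eq]
  have d1 : HasFDerivAt (fun t => fderiv ℝ σ (t, u))
      ((fderiv ℝ (fderiv ℝ σ) (t, u)).comp (ContinuousLinearMap.inl ℝ ℝ E)) t :=
    hD.hasFDerivAt.comp t (hasFDerivAt_prodMk_left t u)
  have d2 : HasFDerivAt (fun u => fderiv ℝ σ (t, u))
      ((fderiv ℝ (fderiv ℝ σ) (t, u)).comp (ContinuousLinearMap.inr ℝ ℝ E)) u :=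
    hD.hasFDerivAt.comp u (hasFDerivAt_prodMk_right t u)
  rw [(d1.clm_comp (hasFDerivAt_const _ _)).fderiv,
    (d2.clm_apply (hasFDerivAt_const _ _)).fderiv]
  have hs : IsSymmSndFDerivAt ℝ σ (t, u) := h.isSymmSndFDerivAt (by
    rw [minSmoothness_of_isRCLikeNormedField]; exact ENat.LEInfty.out)
  ext e
  simpa using hs.eq (1, 0) (0, e)

end SwapDerivatives

/-! ### Sections and jets in adapted charts -/

section ChartCalculus

variable {E F : Type*} [NormedAddCommGroup E] [NormedSpace ℝ E]
  [NormedAddCommGroup F] [NormedSpace ℝ F]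
  {M Y : Type*} [TopologicalSpace M] [ChartedSpace E M]
  [TopologicalSpace Y] [ChartedSpace (E × F) Y]
  {π : Y → M} [hπ : IsFibredManifold E F π]
  {W X : Type*} [NormedAddCommGroup W] [NormedSpace ℝ W] [TopologicalSpace X] [ChartedSpace W X]

namespace AdaptedChart

variable (a : AdaptedChart E F π)

theorem mdifferentiableAt_e {z : Y} (hz : z ∈ a.e.source) :
    MDifferentiableAt 𝓘(ℝ, E × F) 𝓘(ℝ, E × F) a.e z :=
  haveI := hπ.total_isManifold
  (contMDiffAt_of_mem_maximalAtlas a.e_mem hz).mdifferentiableAt (n := ∞) (by simp)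

theorem contMDiffAt_e_symm {q : E × F} (hq : q ∈ a.e.target) :
    ContMDiffAt 𝓘(ℝ, E × F) 𝓘(ℝ, E × F) ∞ a.e.symm q :=
  haveI := hπ.total_isManifold
  contMDiffAt_symm_of_mem_maximalAtlas a.e_mem hq

theorem contMDiffAt_e {z : Y} (hz : z ∈ a.e.source) :
    ContMDiffAt 𝓘(ℝ, E × F) 𝓘(ℝ, E × F) ∞ a.e z :=
  haveI := hπ.total_isManifold
  contMDiffAt_of_mem_maximalAtlas a.e_mem hz

theorem contMDiffAt_c {x : M} (hx : x ∈ a.c.source) :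
    ContMDiffAt 𝓘(ℝ, E) 𝓘(ℝ, E) ∞ a.c x :=
  haveI := hπ.base_isManifold
  contMDiffAt_of_mem_maximalAtlas a.c_mem hx

theorem contMDiffAt_c_symm {u : E} (hu : u ∈ a.c.target) :
    ContMDiffAt 𝓘(ℝ, E) 𝓘(ℝ, E) ∞ a.c.symm u :=
  haveI := hπ.base_isManifold
  contMDiffAt_symm_of_mem_maximalAtlas a.c_mem hu

theorem dE_apply {z : Y} (hz : z ∈ a.e.source) (v : E × F) :
    a.dE hz v = tmap (E × F) (E × F) a.e z v := rfl

theorem dC_apply {z : Y} (hz : z ∈ a.e.source) (v : E) :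
    a.dC hz v = tmap E E a.c (π z) v := rfl

theorem tmap_e_comp {f : X → Y} {p : X} (hf : MDifferentiableAt 𝓘(ℝ, W) 𝓘(ℝ, E × F) f p)
    (hp : f p ∈ a.e.source) :
    (tmap (E × F) (E × F) a.e (f p)).comp (tmap W (E × F) f p) =
      tmap W (E × F) (fun q => a.e (f q)) p :=
  (tmap_comp p (a.mdifferentiableAt_e hp) hf).symm

/-- A tangent vector is vertical iff its base component in an adapted chart vanishes. -/
theorem tmap_e_mem_vert {z : Y} (hz : z ∈ a.e.source) {v : E × F} :
    v ∈ vert E F π z ↔ (tmap (E × F) (E × F) a.e z v).1 = 0 := by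
  have h := a.dE_fst hz v
  rw [mem_vert]
  constructor
  · intro hv
    rw [hv, map_zero] at h
    exact h
  · intro hv
    exact (a.dC hz).injective (by rw [← h, map_zero]; exact hv)

theorem ext_tmap_e {z : Y} (hz : z ∈ a.e.source) {v v' : E × F}
    (h : tmap (E × F) (E × F) a.e z v = tmap (E × F) (E × F) a.e z v') : v = v' :=
  (a.dE hz).injective h

theorem apply_e {s : M → Y} {x : M} (hx : π (s x) = x) (hs : s x ∈ a.e.source) :
    a.e (s x) = (a.c x, (a.e (s x)).2) :=
  Prod.ext (by rw [a.fst_eq _ hs, hx]) rfl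

theorem mem_c_source {s : M → Y} {x : M} (hx : π (s x) = x) (hs : s x ∈ a.e.source) :
    x ∈ a.c.source := by
  have := a.map_source _ hs
  rwa [hx] at this

/-- The coordinate representation `u ↦ φ(u)` of a section of `π`. -/
def rep (s : M → Y) (u : E) : F := (a.e (s (a.c.symm u))).2

theorem rep_apply {s : M → Y} {x : M} (hx : x ∈ a.c.source) :
    a.rep s (a.c x) = (a.e (s x)).2 := by
  rw [rep, a.c.left_inv hx]

theorem apply_e_rep {s : M → Y} {x : M} (hx : π (s x) = x) (hs : s x ∈ a.e.source) :
    a.e (s x) = (a.c x, a.rep s (a.c x)) := by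
  rw [a.apply_e hx hs, a.rep_apply (a.mem_c_source hx hs)]

end AdaptedChart

theorem IsSectionAt.apply_eq {s : M → Y} {x : M} (h : IsSectionAt E F π s x) : π (s x) = x :=
  h.self_of_nhds.1

theorem IsSectionAt.contMDiffAt {s : M → Y} {x : M} (h : IsSectionAt E F π s x) :
    ContMDiffAt 𝓘(ℝ, E) 𝓘(ℝ, E × F) ∞ s x :=
  h.self_of_nhds.2

theorem IsSectionAt.congr {s s' : M → Y} {x : M} (h : IsSectionAt E F π s x) (hs : s =ᶠ[𝓝 x] s') :
    IsSectionAt E F π s' x := by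
  filter_upwards [h, hs.eventuallyEq_nhds] with y hy hy'
  exact ⟨by rw [← hy'.self_of_nhds]; exact hy.1, hy.2.congr_of_eventuallyEq hy'.symm⟩

theorem IsSectionAt.eventually_mem {s : M → Y} {x : M} (h : IsSectionAt E F π s x)
    {a : AdaptedChart E F π} (ha : s x ∈ a.e.source) : ∀ᶠ x' in 𝓝 x, s x' ∈ a.e.source :=
  h.contMDiffAt.continuousAt.eventually (a.e.open_source.mem_nhds ha)

theorem IsSectionAt.contDiffAt_rep {s : M → Y} {x : M} (h : IsSectionAt E F π s x)
    {a : AdaptedChart E F π} (ha : s x ∈ a.e.source) : ContDiffAt ℝ ∞ (a.rep s) (a.c x) := by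
  have hx := a.mem_c_source h.apply_eq ha
  rw [← contMDiffAt_iff_contDiffAt]
  have hs : ContMDiffAt 𝓘(ℝ, E) 𝓘(ℝ, E × F) ∞ s (a.c.symm (a.c x)) := by
    rw [a.c.left_inv hx]; exact h.contMDiffAt
  have he : ContMDiffAt 𝓘(ℝ, E × F) 𝓘(ℝ, E × F) ∞ a.e (s (a.c.symm (a.c x))) := by
    rw [a.c.left_inv hx]; exact a.contMDiffAt_e ha
  exact contDiff_snd.contMDiff.contMDiffAt.comp (a.c x)
    (he.comp (a.c x) (hs.comp (a.c x) (a.contMDiffAt_c_symm (a.c.map_source hx))))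

/-- In an adapted chart a section is the graph `u ↦ (u, a.rep s u)`, so its tangent map is the
identity paired with the derivative of the representative. -/
theorem IsSectionAt.tmap_e {s : M → Y} {x : M} (h : IsSectionAt E F π s x)
    {a : AdaptedChart E F π} (ha : s x ∈ a.e.source) (X : E) :
    tmap (E × F) (E × F) a.e (s x) (tmap E (E × F) s x X) =
      (tmap E E a.c x X, fderiv ℝ (a.rep s) (a.c x) (tmap E E a.c x X)) := by
  have hx := a.mem_c_source h.apply_eq ha
  have h1 := a.tmap_e_comp (h.contMDiffAt.mdifferentiableAt (by simp)) ha
  have h2 : (fun x' => a.e (s x')) =ᶠ[𝓝 x] (fun u => (u, a.rep s u)) ∘ a.c := by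
    filter_upwards [h, h.eventually_mem ha] with x' hx' hx''
    exact a.apply_e_rep hx'.1 hx''
  have hd : DifferentiableAt ℝ (a.rep s) (a.c x) :=
    (h.contDiffAt_rep ha).differentiableAt (by simp)
  have h3 : HasFDerivAt (fun u => (u, a.rep s u))
      ((ContinuousLinearMap.id ℝ E).prod (fderiv ℝ (a.rep s) (a.c x))) (a.c x) :=
    (hasFDerivAt_id _).prodMk hd.hasFDerivAt
  rw [tmap_congr h2, tmap_comp x h3.differentiableAt.mdifferentiableAt
    ((a.contMDiffAt_c hx).mdifferentiableAt (by simp))] at h1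
  have h4 : tmap E (E × F) (fun u => (u, a.rep s u)) (a.c x) =
      (ContinuousLinearMap.id ℝ E).prod (fderiv ℝ (a.rep s) (a.c x)) := by
    rw [tmap, mfderiv_eq_fderiv]; exact h3.fderiv
  rw [h4] at h1
  exact DFunLike.congr_fun h1 X

/-- Differentiating `π ∘ s = id` shows that the tangent map of a section is a right inverse of the
tangent map of `π`. -/
theorem IsSectionAt.exists_isJetAt {s : M → Y} {x : M} (h : IsSectionAt E F π s x) :
    ∃ ζ : JetBundle E F π, IsJetAt ζ s x := by
  refine ⟨⟨s x, tmap E (E × F) s x, ?_⟩, h, rfl, rfl⟩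
  rw [← tmap_comp x (IsFibredManifold.mdifferentiableAt E F π (s x))
    (h.contMDiffAt.mdifferentiableAt (by simp)),
    tmap_congr (f := π ∘ s) (g := id) (h.mono fun _ h => h.1)]
  exact mfderiv_id

theorem IsJetAt.congr {ζ : JetBundle E F π} {s s' : M → Y} {x : M} (h : IsJetAt ζ s x)
    (hs : s =ᶠ[𝓝 x] s') : IsJetAt ζ s' x :=
  ⟨h.1.congr hs, by rw [← hs.self_of_nhds]; exact h.2.1, by rw [← tmap_congr hs]; exact h.2.2⟩

theorem IsJetAt.eq {ζ ζ' : JetBundle E F π} {s : M → Y} {x : M} (h : IsJetAt ζ s x)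
    (h' : IsJetAt ζ' s x) : ζ = ζ' :=
  JetBundle.ext (h.2.1.trans h'.2.1.symm) (h.2.2.trans h'.2.2.symm)

/-! #### Induced adapted charts -/

/-- The chart of `VY` induced by an adapted chart. -/
def VertBundle.adapted (a : AdaptedChart E F π) :
    AdaptedChart E (F × F) (VertBundle.base E F π) := (VertBundle.liftData E F π).adapted a

/-- The chart of `J¹Y` induced by an adapted chart. -/
def JetBundle.adapted (a : AdaptedChart E F π) :
    AdaptedChart E (F × (E →L[ℝ] F)) (JetBundle.base E F π) := (JetBundle.liftData E F π).adapted a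

/-- The chart of `V*Y ⊗ ΛᵏM` induced by an adapted chart. -/
def CovBundle.adapted {k : ℕ} (a : AdaptedChart E F π) :
    AdaptedChart E (F × (F →L[ℝ] AltForm E k)) (CovBundle.base E F π k) :=
  (CovBundle.liftData E F π k).adapted a

theorem VertBundle.mem_adapted {a : AdaptedChart E F π} {z : VertBundle E F π} :
    z ∈ (VertBundle.adapted a).e.source ↔ z.pt ∈ a.e.source := Iff.rfl

theorem JetBundle.mem_adapted {a : AdaptedChart E F π} {z : JetBundle E F π} :
    z ∈ (JetBundle.adapted a).e.source ↔ z.pt ∈ a.e.source := Iff.rfl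

theorem CovBundle.mem_adapted {k : ℕ} {a : AdaptedChart E F π} {z : CovBundle E F π k} :
    z ∈ (CovBundle.adapted a).e.source ↔ z.pt ∈ a.e.source := Iff.rfl

theorem VertBundle.mem_adapted_target {a : AdaptedChart E F π} {q : E × (F × F)} :
    q ∈ (VertBundle.adapted a).e.target ↔ (q.1, q.2.1) ∈ a.e.target := Iff.rfl

theorem CovBundle.mem_adapted_target {k : ℕ} {a : AdaptedChart E F π}
    {q : E × (F × (F →L[ℝ] AltForm E k))} :
    q ∈ (CovBundle.adapted a).e.target ↔ (q.1, q.2.1) ∈ a.e.target := Iff.rfl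

theorem VertBundle.adapted_apply {a : AdaptedChart E F π} {z : VertBundle E F π}
    (hz : z.pt ∈ a.e.source) : (VertBundle.adapted a).e z =
      ((a.e z.pt).1, ((a.e z.pt).2, (tmap (E × F) (E × F) a.e z.pt z.vec).2)) :=
  (VertBundle.liftData E F π).chart_apply a hz

theorem JetBundle.adapted_apply {a : AdaptedChart E F π} {z : JetBundle E F π}
    (hz : z.pt ∈ a.e.source) : (JetBundle.adapted a).e z =
      ((a.e z.pt).1, ((a.e z.pt).2, ((ContinuousLinearMap.snd ℝ E F).comp
    (a.dE hz).toContinuousLinearMap).comp (z.lin.comp (a.dC hz).symm.toContinuousLinearMap))) :=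
  (JetBundle.liftData E F π).chart_apply a hz

theorem CovBundle.adapted_apply {k : ℕ} {a : AdaptedChart E F π} {z : CovBundle E F π k}
    (hz : z.pt ∈ a.e.source) : (CovBundle.adapted a).e z =
      ((a.e z.pt).1, ((a.e z.pt).2, (CovBundle.liftData E F π k).coord a z hz)) :=
  (CovBundle.liftData E F π k).chart_apply a hz

theorem VertBundle.pt_adapted_symm {a : AdaptedChart E F π} {q : E × (F × F)}
    (hq : (q.1, q.2.1) ∈ a.e.target) :
    ((VertBundle.adapted a).e.symm q).pt = a.e.symm (q.1, q.2.1) :=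
  (VertBundle.liftData E F π).pt_chart_symm a hq

theorem CovBundle.pt_adapted_symm {k : ℕ} {a : AdaptedChart E F π}
    {q : E × (F × (F →L[ℝ] AltForm E k))} (hq : (q.1, q.2.1) ∈ a.e.target) :
    ((CovBundle.adapted a).e.symm q).pt = a.e.symm (q.1, q.2.1) :=
  (CovBundle.liftData E F π k).pt_chart_symm a hq

/-- The coordinates of the jet of a section. -/
theorem IsJetAt.adapted_apply {ζ : JetBundle E F π} {s : M → Y} {x : M} (h : IsJetAt ζ s x)
    {a : AdaptedChart E F π} (ha : s x ∈ a.e.source) : (JetBundle.adapted a).e ζ =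
      (a.c x, (a.rep s (a.c x), fderiv ℝ (a.rep s) (a.c x))) := by
  obtain ⟨y, l, hl⟩ := ζ
  obtain ⟨h, rfl, rfl⟩ := h
  rw [JetBundle.adapted_apply ha, a.apply_e_rep h.apply_eq ha]
  refine Prod.ext rfl (Prod.ext rfl ?_)
  refine ContinuousLinearMap.ext fun e => ?_
  have h1 := h.tmap_e ha ((a.dC ha).symm e)
  have h2 : tmap E E a.c x ((a.dC ha).symm e) = e := by
    have h3 : ∀ v, tmap E E a.c x v = a.dC ha v := fun v => by
      rw [a.dC_apply, h.apply_eq]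
    rw [h3, ContinuousLinearEquiv.apply_symm_apply]
  rw [h2] at h1
  exact congrArg Prod.snd h1

end ChartCalculus

/-! ### Families of sections, their time derivatives, and representatives of vertical vectors -/

section Variations

variable {E F : Type*} [NormedAddCommGroup E] [NormedSpace ℝ E]
  [NormedAddCommGroup F] [NormedSpace ℝ F]
  {M Y : Type*} [TopologicalSpace M] [ChartedSpace E M]
  [TopologicalSpace Y] [ChartedSpace (E × F) Y]
  {π : Y → M} [hπ : IsFibredManifold E F π]

namespace IsVariationAt

variable {s : ℝ → M → Y} {x : M} (h : IsVariationAt E F π s x)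

include h

theorem apply_eq : π (s 0 x) = x := h.self_of_nhds.1

theorem contMDiffAt : ContMDiffAt (𝓘(ℝ, ℝ).prod 𝓘(ℝ, E)) 𝓘(ℝ, E × F) ∞
    (fun q : ℝ × M => s q.1 q.2) (0, x) := h.self_of_nhds.2

/-- The defining condition is imposed on a neighbourhood of `(0, x)`, hence is open in `x`. This
lets coordinate formulas for `∂ₜ s_t` be differentiated in the base point. -/
theorem eventually_isVariationAt : ∀ᶠ x' in 𝓝 x, IsVariationAt E F π s x' := by
  have h1 : Tendsto (fun x' : M => ((0 : ℝ), x')) (𝓝 x) (𝓝 (0, x)) :=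
    (by fun_prop : Continuous fun x' : M => ((0 : ℝ), x')).continuousAt
  exact h1.eventually h.eventually_nhds

theorem eventually_isSectionAt : ∀ᶠ t in 𝓝 (0 : ℝ), IsSectionAt E F π (s t) x := by
  have h1 : Tendsto (fun t : ℝ => (t, x)) (𝓝 0) (𝓝 (0, x)) :=
    (by fun_prop : Continuous fun t : ℝ => (t, x)).continuousAt
  filter_upwards [h1.eventually h.eventually_nhds] with t ht
  have h2 : Tendsto (fun x' : M => (t, x')) (𝓝 x) (𝓝 (t, x)) :=
    (by fun_prop : Continuous fun x' : M => (t, x')).continuousAt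
  filter_upwards [h2.eventually ht] with x' hx'
  refine ⟨hx'.1, ?_⟩
  exact hx'.2.comp x' (f := fun x' : M => (t, x')) (contMDiffAt_const.prodMk contMDiffAt_id)

theorem isSectionAt : IsSectionAt E F π (s 0) x := h.eventually_isSectionAt.self_of_nhds

variable {a : AdaptedChart E F π} (ha : s 0 x ∈ a.e.source)

include ha

theorem eventually_mem : ∀ᶠ q in 𝓝 ((0 : ℝ), x), s q.1 q.2 ∈ a.e.source :=
  h.contMDiffAt.continuousAt.eventually (a.e.open_source.mem_nhds ha)

theorem contDiffAt_rep :
    ContDiffAt ℝ ∞ (fun q : ℝ × E => a.rep (s q.1) q.2) (0, a.c x) := by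
  have hx := a.mem_c_source h.apply_eq ha
  rw [← contMDiffAt_iff_contDiffAt]
  have hf : ContMDiffAt 𝓘(ℝ, ℝ × E) (𝓘(ℝ, ℝ).prod 𝓘(ℝ, E)) ∞
      (fun q : ℝ × E => (q.1, a.c.symm q.2)) (0, a.c x) := by
    refine ContMDiffAt.prodMk contDiff_fst.contMDiff.contMDiffAt ?_
    exact (a.contMDiffAt_c_symm (a.c.map_source hx)).comp (0, a.c x)
      (f := fun q : ℝ × E => q.2) contDiff_snd.contMDiff.contMDiffAt
  have hs : ContMDiffAt (𝓘(ℝ, ℝ).prod 𝓘(ℝ, E)) 𝓘(ℝ, E × F) ∞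
      (fun q : ℝ × M => s q.1 q.2) (0, a.c.symm (a.c x)) := by
    rw [a.c.left_inv hx]; exact h.contMDiffAt
  have he : ContMDiffAt 𝓘(ℝ, E × F) 𝓘(ℝ, E × F) ∞ a.e (s 0 (a.c.symm (a.c x))) := by
    rw [a.c.left_inv hx]; exact a.contMDiffAt_e ha
  exact contDiff_snd.contMDiff.contMDiffAt.comp ((0 : ℝ), a.c x)
    (he.comp ((0 : ℝ), a.c x) (hs.comp ((0 : ℝ), a.c x) hf))

/-- The coordinates of the time derivative of a family of sections. -/
theorem tmap_e : tmap (E × F) (E × F) a.e (s 0 x) (tmap ℝ (E × F) (fun t => s t x) 0 1) =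
    (0, fderiv ℝ (fun t => a.rep (s t) (a.c x)) 0 1) := by
  have h1 : Tendsto (fun t : ℝ => (t, x)) (𝓝 0) (𝓝 (0, x)) :=
    (by fun_prop : Continuous fun t : ℝ => (t, x)).continuousAt
  have hs : ContMDiffAt 𝓘(ℝ, ℝ) 𝓘(ℝ, E × F) ∞ (fun t => s t x) 0 :=
    h.contMDiffAt.comp (0 : ℝ) (f := fun t : ℝ => (t, x)) (contMDiffAt_id.prodMk contMDiffAt_const)
  have h2 := a.tmap_e_comp (f := fun t => s t x) (hs.mdifferentiableAt (by simp)) ha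
  have h3 : (fun t => a.e (s t x)) =ᶠ[𝓝 0] fun t => (a.c x, a.rep (s t) (a.c x)) := by
    filter_upwards [h1.eventually h, h1.eventually (h.eventually_mem ha)] with t ht ht'
    exact a.apply_e_rep ht.1 ht'
  have h4 : DifferentiableAt ℝ (fun t => a.rep (s t) (a.c x)) 0 :=
    ((h.contDiffAt_rep ha).comp (0 : ℝ) (f := fun t : ℝ => (t, a.c x))
      (by fun_prop)).differentiableAt (by simp)
  have h5 : HasFDerivAt (fun t => (a.c x, a.rep (s t) (a.c x))) _ 0 :=
    (hasFDerivAt_const (a.c x) (0 : ℝ)).prodMk h4.hasFDerivAt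
  have h6 : tmap ℝ (E × F) (fun t => (a.c x, a.rep (s t) (a.c x))) 0 =
    fderiv ℝ (fun t => (a.c x, a.rep (s t) (a.c x))) 0 := mfderiv_eq_fderiv
  rw [tmap_congr h3, h6, h5.fderiv] at h2
  exact DFunLike.congr_fun h2 1

/-- The curve `γ` is only known to consist of the jets of `s t` for small `t`. Its differentiability
comes from that of its coordinates, where the jet component is a partial derivative of a smooth
function. -/
theorem mdifferentiableAt_jet {γ : ℝ → JetBundle E F π}
    (hγ : ∀ᶠ t in 𝓝 (0 : ℝ), IsJetAt (γ t) (s t) x) :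
    MDifferentiableAt 𝓘(ℝ, ℝ) 𝓘(ℝ, E × (F × (E →L[ℝ] F))) γ 0 ∧
    (fun t => (JetBundle.adapted a).e (γ t)) =ᶠ[𝓝 0] fun t =>
      (a.c x, (a.rep (s t) (a.c x), fderiv ℝ (a.rep (s t)) (a.c x))) := by
  have h1 : Tendsto (fun t : ℝ => (t, x)) (𝓝 0) (𝓝 (0, x)) :=
    (by fun_prop : Continuous fun t : ℝ => (t, x)).continuousAt
  have h2 : (fun t => (JetBundle.adapted a).e (γ t)) =ᶠ[𝓝 0] fun t =>
      (a.c x, (a.rep (s t) (a.c x), fderiv ℝ (a.rep (s t)) (a.c x))) := by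
    filter_upwards [hγ, h1.eventually (h.eventually_mem ha)] with t ht ht'
    exact ht.adapted_apply ht'
  refine ⟨?_, h2⟩
  have h3 : γ =ᶠ[𝓝 0] fun t => (JetBundle.adapted a).e.symm
      (a.c x, (a.rep (s t) (a.c x), fderiv ℝ (a.rep (s t)) (a.c x))) := by
    filter_upwards [h2, hγ, h1.eventually (h.eventually_mem ha)] with t ht ht' ht''
    rw [← ht]
    refine ((JetBundle.adapted a).e.left_inv ?_).symm
    rw [JetBundle.mem_adapted, ht'.2.1]
    exact ht''
  have h4 : ContDiffAt ℝ ∞ (fun t => (a.c x, (a.rep (s t) (a.c x),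
      fderiv ℝ (a.rep (s t)) (a.c x)))) 0 :=
    contDiffAt_const.prodMk (((h.contDiffAt_rep ha).comp (0 : ℝ) (f := fun t : ℝ => (t, a.c x))
      (by fun_prop)).prodMk (contDiffAt_fderiv_partial_right (h.contDiffAt_rep ha)))
  have h5 : (a.c x, (a.rep (s 0) (a.c x), fderiv ℝ (a.rep (s 0)) (a.c x))) ∈
      (JetBundle.adapted a).e.target := by
    have h6 := h2.self_of_nhds
    dsimp only at h6
    rw [← h6]
    apply (JetBundle.adapted a).e.map_source
    rw [JetBundle.mem_adapted, hγ.self_of_nhds.2.1]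
    exact ha
  refine MDifferentiableAt.congr_of_eventuallyEq ?_ h3
  refine ContMDiffAt.mdifferentiableAt (n := ∞) ?_ (by simp)
  exact ((JetBundle.adapted a).contMDiffAt_e_symm h5).comp (0 : ℝ) h4.contMDiffAt

/-- The coordinates of the time derivative of the jet of a family of sections. -/
theorem tmap_jet {γ : ℝ → JetBundle E F π} (hγ : ∀ᶠ t in 𝓝 (0 : ℝ), IsJetAt (γ t) (s t) x) :
    tmap (E × (F × (E →L[ℝ] F))) (E × (F × (E →L[ℝ] F))) (JetBundle.adapted a).e (γ 0)
      (tmap ℝ (E × (F × (E →L[ℝ] F))) γ 0 1) =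
    (0, (fderiv ℝ (fun t => a.rep (s t) (a.c x)) 0 1,
      fderiv ℝ (fun u => fderiv ℝ (fun t => a.rep (s t) u) 0 1) (a.c x))) := by
  obtain ⟨h1, h2⟩ := h.mdifferentiableAt_jet ha hγ
  have h3 : γ 0 ∈ (JetBundle.adapted a).e.source := by
    rw [JetBundle.mem_adapted, hγ.self_of_nhds.2.1]
    exact ha
  have h4 := (JetBundle.adapted a).tmap_e_comp h1 h3
  have h5 : DifferentiableAt ℝ (fun t => a.rep (s t) (a.c x)) 0 :=
    ((h.contDiffAt_rep ha).comp (0 : ℝ) (f := fun t : ℝ => (t, a.c x))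
      (by fun_prop)).differentiableAt (by simp)
  have h6 : DifferentiableAt ℝ (fun t => fderiv ℝ (a.rep (s t)) (a.c x)) 0 :=
    (contDiffAt_fderiv_partial_right (h.contDiffAt_rep ha)).differentiableAt (by simp)
  have h7 : HasFDerivAt (fun t => (a.c x, (a.rep (s t) (a.c x),
      fderiv ℝ (a.rep (s t)) (a.c x)))) _ 0 :=
    (hasFDerivAt_const (a.c x) (0 : ℝ)).prodMk (h5.hasFDerivAt.prodMk h6.hasFDerivAt)
  have h8 : tmap ℝ (E × (F × (E →L[ℝ] F))) (fun t => (a.c x, (a.rep (s t) (a.c x),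
      fderiv ℝ (a.rep (s t)) (a.c x)))) 0 = fderiv ℝ (fun t => (a.c x, (a.rep (s t) (a.c x),
      fderiv ℝ (a.rep (s t)) (a.c x)))) 0 := mfderiv_eq_fderiv
  rw [tmap_congr h2, h8, h7.fderiv] at h4
  refine (DFunLike.congr_fun h4 1).trans ?_
  -- The time derivative of the space derivative is exchanged for the space derivative of the time
  -- derivative; this exchange is the whole content of `κ`.
  exact Prod.ext rfl (Prod.ext rfl (fderiv_partial_comm (h.contDiffAt_rep ha)))

end IsVariationAt

/-- The coordinate expression of the interchange map `J¹VY → VJ¹Y`. -/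
def interchangeCoord (E F : Type*) [NormedAddCommGroup E] [NormedSpace ℝ E]
    [NormedAddCommGroup F] [NormedSpace ℝ F] :
    (E × ((F × F) × (E →L[ℝ] F × F))) ≃L[ℝ] E × ((F × (E →L[ℝ] F)) × (F × (E →L[ℝ] F))) where
  toFun q := (q.1, ((q.2.1.1, (ContinuousLinearMap.fst ℝ F F).comp q.2.2),
    (q.2.1.2, (ContinuousLinearMap.snd ℝ F F).comp q.2.2)))
  invFun q := (q.1, ((q.2.1.1, q.2.2.1), (ContinuousLinearMap.inl ℝ F F).comp q.2.1.2 +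
    (ContinuousLinearMap.inr ℝ F F).comp q.2.2.2))
  map_add' q q' := by simp [ContinuousLinearMap.comp_add]
  map_smul' c q := by simp
  left_inv q := by
    refine Prod.ext rfl (Prod.ext rfl ?_)
    ext1 e
    simp
  right_inv q := by
    refine Prod.ext rfl (Prod.ext (Prod.ext rfl ?_) (Prod.ext rfl ?_)) <;> ext1 e <;> simp
  continuous_toFun := by fun_prop
  continuous_invFun := by fun_prop

theorem interchangeCoord_apply (q : E × ((F × F) × (E →L[ℝ] F × F))) :
    interchangeCoord E F q = (q.1, ((q.2.1.1, (ContinuousLinearMap.fst ℝ F F).comp q.2.2),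
    (q.2.1.2, (ContinuousLinearMap.snd ℝ F F).comp q.2.2))) := rfl

section

variable {s : ℝ → M → Y} {x : M} {v : M → VertBundle E F π}

/-- The equality holds on a neighbourhood and not just at the point, so the derivative of the
representative of `v` can be computed from it. -/
theorem IsVariationAt.rep_vert (h : IsVariationAt E F π s x)
    {a : AdaptedChart E F π} (ha : s 0 x ∈ a.e.source)
    (hv : ∀ᶠ x' in 𝓝 x, (v x').pt = s 0 x' ∧
      (v x').vec = tmap ℝ (E × F) (fun t => s t x') 0 1) :
    (VertBundle.adapted a).rep v =ᶠ[𝓝 (a.c x)] fun u =>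
      (a.rep (s 0) u, fderiv ℝ (fun t => a.rep (s t) u) 0 1) := by
  have hx := a.mem_c_source h.apply_eq ha
  have h1 : Tendsto a.c.symm (𝓝 (a.c x)) (𝓝 x) := by
    have := a.c.symm.continuousAt (a.c.map_source hx)
    rwa [ContinuousAt, a.c.left_inv hx] at this
  filter_upwards [h1.eventually hv, h1.eventually h.eventually_isVariationAt,
    h1.eventually (h.isSectionAt.eventually_mem ha), a.c.open_target.mem_nhds (a.c.map_source hx)]
    with u hu hu' hu'' hu'''
  have h2 := hu'.tmap_e hu''
  rw [a.c.right_inv hu'''] at h2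
  have h3 : (v (a.c.symm u)).pt ∈ a.e.source := by rw [hu.1]; exact hu''
  change ((VertBundle.adapted a).e (v (a.c.symm u))).2 = _
  rw [VertBundle.adapted_apply h3, hu.1, hu.2, h2]
  rfl

theorem IsVariationAt.exists_isJetOfVertical (h : IsVariationAt E F π s x)
    (hv : ∀ᶠ x' in 𝓝 x, (v x').pt = s 0 x' ∧
      (v x').vec = tmap ℝ (E × F) (fun t => s t x') 0 1) :
    ∃ w, IsJetOfVertical v w x := by
  classical
  -- Away from small `t` the map `s t` need not be a section near `x`, and the jet of `s 0` is used
  -- as an arbitrary value.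
  let γ : ℝ → JetBundle E F π := fun t =>
    if ht : IsSectionAt E F π (s t) x then ht.exists_isJetAt.choose
    else h.isSectionAt.exists_isJetAt.choose
  have hγ : ∀ᶠ t in 𝓝 (0 : ℝ), IsJetAt (γ t) (s t) x := by
    filter_upwards [h.eventually_isSectionAt] with t ht
    simp only [γ, dif_pos ht]
    exact ht.exists_isJetAt.choose_spec
  have ha := AdaptedChart.mem_at (E := E) (F := F) (π := π) (s 0 x)
  refine ⟨⟨γ 0, tmap ℝ (E × (F × (E →L[ℝ] F))) γ 0 1, ?_⟩, s, h, hv, γ, hγ, rfl, rfl⟩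
  rw [(JetBundle.adapted (AdaptedChart.at E F π (s 0 x))).tmap_e_mem_vert (by
    rw [JetBundle.mem_adapted, hγ.self_of_nhds.2.1]; exact ha), h.tmap_jet ha hγ]

/-- The coordinates of the jet of a section of `VY → M`, considered as an element of `V J¹Y`. -/
theorem IsJetOfVertical.adapted_apply
    {w : VertBundle E (F × (E →L[ℝ] F)) (JetBundle.base E F π)} (h : IsJetOfVertical v w x)
    {a : AdaptedChart E F π} (ha : (v x).pt ∈ a.e.source) :
    ContDiffAt ℝ ∞ ((VertBundle.adapted a).rep v) (a.c x) ∧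
    w.pt.pt = (v x).pt ∧
    (VertBundle.adapted (JetBundle.adapted a)).e w = interchangeCoord E F
      (a.c x, ((VertBundle.adapted a).rep v (a.c x),
        fderiv ℝ ((VertBundle.adapted a).rep v) (a.c x))) := by
  obtain ⟨s, hs, hv, γ, hγ, hw, hw'⟩ := h
  have hv0 := hv.self_of_nhds.1
  have ha' := ha
  rw [hv0] at ha'
  have h1 := hs.rep_vert ha' hv
  have h2 := hs.contDiffAt_rep ha'
  have h3 : ContDiffAt ℝ ∞ (a.rep (s 0)) (a.c x) := hs.isSectionAt.contDiffAt_rep ha'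
  have h4 := contDiffAt_fderiv_partial_left h2
  have hpt : w.pt.pt = (v x).pt := by rw [hw, hγ.self_of_nhds.2.1, hv0]
  refine ⟨(h3.prodMk h4).congr_of_eventuallyEq h1, hpt, ?_⟩
  have h5 : w.pt ∈ (JetBundle.adapted a).e.source := by
    rw [JetBundle.mem_adapted, hpt]; exact ha
  rw [VertBundle.adapted_apply h5, hw, hw', hs.tmap_jet ha' hγ,
    hγ.self_of_nhds.adapted_apply ha', h1.fderiv_eq, h1.self_of_nhds,
    (((h3.differentiableAt (by simp)).hasFDerivAt).prodMk
      (h4.differentiableAt (by simp)).hasFDerivAt).fderiv, interchangeCoord_apply]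
  rfl

end

/-- A family of local sections with given coordinate representation. -/
def AdaptedChart.family (a : AdaptedChart E F π) (g : ℝ × E → F) (t : ℝ) (x : M) : Y :=
  a.e.symm (a.c x, g (t, a.c x))

section

variable (a : AdaptedChart E F π) {g : ℝ × E → F} (hg : ContDiff ℝ ∞ g) {x : M}
  (hx : x ∈ a.c.source) (hgx : (a.c x, g (0, a.c x)) ∈ a.e.target)

include hg hx hgx

theorem AdaptedChart.eventually_family_target :
    ∀ᶠ q in 𝓝 ((0 : ℝ), x), q.2 ∈ a.c.source ∧ (a.c q.2, g (q.1, a.c q.2)) ∈ a.e.target := by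
  have h1 : ContinuousAt (fun q : ℝ × M => a.c q.2) (0, x) :=
    (a.c.continuousAt hx).comp (f := fun q : ℝ × M => q.2) (by fun_prop)
  have h2 : ContinuousAt (fun q : ℝ × M => (a.c q.2, g (q.1, a.c q.2))) (0, x) :=
    h1.prodMk (hg.continuous.continuousAt.comp (f := fun q : ℝ × M => (q.1, a.c q.2))
      (continuousAt_fst.prodMk h1))
  exact (continuousAt_snd.eventually (a.c.open_source.mem_nhds hx)).and
    (h2.eventually (a.e.open_target.mem_nhds hgx))

theorem AdaptedChart.isVariationAt_family : IsVariationAt E F π (a.family g) x := by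
  filter_upwards [a.eventually_family_target hg hx hgx] with q hq
  constructor
  · have h := a.fst_eq _ (a.e.map_target hq.2)
    rw [a.e.right_inv hq.2] at h
    exact (a.c.injOn hq.1 (a.map_source _ (a.e.map_target hq.2)) h).symm
  · have h1 : ContMDiffAt (𝓘(ℝ, ℝ).prod 𝓘(ℝ, E)) 𝓘(ℝ, E) ∞ (fun q : ℝ × M => a.c q.2) q :=
      (a.contMDiffAt_c hq.1).comp q contMDiffAt_snd
    have h2 : ContMDiffAt (𝓘(ℝ, ℝ).prod 𝓘(ℝ, E)) 𝓘(ℝ, ℝ × E) ∞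
        (fun q : ℝ × M => (q.1, a.c q.2)) q :=
      contMDiffAt_fst.prodMk_space h1
    exact (a.contMDiffAt_e_symm hq.2).comp q
      (h1.prodMk_space (hg.contMDiff.contMDiffAt.comp q h2))

theorem AdaptedChart.family_mem_source : a.family g 0 x ∈ a.e.source := a.e.map_target hgx

theorem AdaptedChart.rep_family :
    ∀ᶠ q in 𝓝 ((0 : ℝ), a.c x), a.rep (a.family g q.1) q.2 = g q := by
  have h1 : Tendsto (fun q : ℝ × E => (q.1, a.c.symm q.2)) (𝓝 (0, a.c x)) (𝓝 (0, x)) := by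
    have h2 : ContinuousAt a.c.symm (a.c x) := a.c.symm.continuousAt (a.c.map_source hx)
    have h3 : ContinuousAt (fun q : ℝ × E => (q.1, a.c.symm q.2)) (0, a.c x) :=
      continuousAt_fst.prodMk (h2.comp (f := fun q : ℝ × E => q.2) (x := (0, a.c x))
        continuousAt_snd)
    rwa [ContinuousAt, a.c.left_inv hx] at h3
  filter_upwards [h1.eventually (a.eventually_family_target hg hx hgx),
    continuousAt_snd.eventually (a.c.open_target.mem_nhds (a.c.map_source hx))] with q hq hq'
  have h4 : a.c (a.c.symm q.2) = q.2 := a.c.right_inv hq'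
  simp only [h4] at hq
  simp only [rep, family, h4, a.e.right_inv hq.2]

end

/-- Every jet and every vertical vector at it can be represented by sections. -/
theorem JetBundle.exists_representatives (ζ : JetBundle E F π) :
    ∃ (x : M) (s : M → Y), IsJetAt ζ s x ∧
      ∀ w : VertBundle E (F × (E →L[ℝ] F)) (JetBundle.base E F π), w.pt = ζ →
        ∃ v : M → VertBundle E F π, IsSectionAt E (F × F) (VertBundle.base E F π) v x ∧
          (∀ᶠ x' in 𝓝 x, (v x').pt = s x') ∧ IsJetOfVertical v w x := by
  let a := AdaptedChart.at E F π ζ.pt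
  have ha : ζ.pt ∈ a.e.source := AdaptedChart.mem_at ζ.pt
  let x := π ζ.pt
  have hx : x ∈ a.c.source := a.map_source _ ha
  obtain ⟨f, A, hfA⟩ : ∃ f A, (JetBundle.adapted a).e ζ = (a.c x, (f, A)) :=
    ⟨_, _, Prod.ext ((JetBundle.adapted a).fst_eq ζ ha) rfl⟩
  have hf : a.e ζ.pt = (a.c x, f) := by
    have := JetBundle.adapted_apply ha
    rw [hfA] at this
    exact Prod.ext (congrArg (·.1) this).symm (congrArg (·.2.1) this).symm
  have htgt : (a.c x, f) ∈ a.e.target := by rw [← hf]; exact a.e.map_source ha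
  -- the families of sections
  let g (w : F × (E →L[ℝ] F)) (q : ℝ × E) : F :=
    f + A (q.2 - a.c x) + q.1 • (w.1 + w.2 (q.2 - a.c x))
  have hg : ∀ w, ContDiff ℝ ∞ (g w) := fun w => by fun_prop
  have hgx : ∀ w, (a.c x, g w (0, a.c x)) ∈ a.e.target := fun w => by simpa [g] using htgt
  have hs : ∀ w, IsVariationAt E F π (a.family (g w)) x := fun w =>
    a.isVariationAt_family (hg w) hx (hgx w)
  -- The parameter `w` enters only with the factor `t`, so all families start at the same section,
  -- which can thus be fixed before `w` is given.
  have hs0 : ∀ w, a.family (g w) 0 = a.family (g 0) 0 := fun w => by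
    funext x'; simp [AdaptedChart.family, g]
  have hsrc : ∀ w, a.family (g w) 0 x ∈ a.e.source := fun w => a.e.map_target (hgx w)
  have hrep : ∀ w, ∀ᶠ q in 𝓝 ((0 : ℝ), a.c x), a.rep (a.family (g w) q.1) q.2 = g w q := fun w =>
    a.rep_family (hg w) hx (hgx w)
  have hrep0 : a.rep (a.family (g 0) 0) =ᶠ[𝓝 (a.c x)] fun u => f + A (u - a.c x) := by
    have h1 : Tendsto (fun u : E => ((0 : ℝ), u)) (𝓝 (a.c x)) (𝓝 (0, a.c x)) :=
      (by fun_prop : Continuous fun u : E => ((0 : ℝ), u)).continuousAt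
    filter_upwards [h1.eventually (hrep 0)] with u hu
    rw [hu]; simp [g]
  have hD : HasFDerivAt (fun u => f + A (u - a.c x)) A (a.c x) :=
    (A.hasFDerivAt.comp (a.c x) ((hasFDerivAt_id _).sub_const _)).const_add f
  have hrep1 : a.rep (a.family (g 0) 0) (a.c x) = f := by simpa using hrep0.self_of_nhds
  refine ⟨x, a.family (g 0) 0, ?_, ?_⟩
  · obtain ⟨ζ', hζ'⟩ := (hs 0).isSectionAt.exists_isJetAt
    have h1 := hζ'.adapted_apply (hsrc 0)
    rw [hrep1, hrep0.fderiv_eq, hD.fderiv, ← hfA] at h1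
    have h2 : ζ' = ζ := by
      refine (JetBundle.adapted a).e.injOn ?_ ha h1
      rw [JetBundle.mem_adapted, hζ'.2.1]
      exact hsrc 0
    rwa [← h2]
  · rintro w hw
    have hwa : w.pt ∈ (JetBundle.adapted a).e.source := by rw [hw]; exact ha
    obtain ⟨k, hk⟩ : ∃ k, (VertBundle.adapted (JetBundle.adapted a)).e w =
        (a.c x, ((f, A), k)) := by
      refine ⟨((VertBundle.adapted (JetBundle.adapted a)).e w).2.2, ?_⟩
      rw [VertBundle.adapted_apply hwa, hw, hfA]
    -- The second component is the time derivative of `g k`. `G` does not depend on time; writing it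
    -- as a family allows the results on families to be reused for a single section of the vertical
    -- bundle.
    let G (q : ℝ × E) : F × F := (f + A (q.2 - a.c x), k.1 + k.2 (q.2 - a.c x))
    have hG : ContDiff ℝ ∞ G := by fun_prop
    have hGx : (a.c x, G (0, a.c x)) ∈ (VertBundle.adapted a).e.target := by
      rw [VertBundle.mem_adapted_target]; simpa [G] using htgt
    have hv := (VertBundle.adapted a).isVariationAt_family hG hx hGx
    let v := (VertBundle.adapted a).family G 0
    have hGt := (VertBundle.adapted a).eventually_family_target hG hx hGx
    have h1 : Tendsto (fun x' : M => ((0 : ℝ), x')) (𝓝 x) (𝓝 (0, x)) :=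
      (by fun_prop : Continuous fun x' : M => ((0 : ℝ), x')).continuousAt
    have hvpt : ∀ᶠ x' in 𝓝 x, (v x').pt = a.family (g k) 0 x' := by
      filter_upwards [h1.eventually hGt] with x' hx'
      have h3 : (v x').pt = a.e.symm (a.c x', (G (0, a.c x')).1) :=
        VertBundle.pt_adapted_symm (VertBundle.mem_adapted_target.1 hx'.2)
      rw [h3]
      simp [AdaptedChart.family, g, G]
    have hvs : ∀ᶠ x' in 𝓝 x, (v x').pt = a.family (g k) 0 x' ∧
        (v x').vec = tmap ℝ (E × F) (fun t => a.family (g k) t x') 0 1 := by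
      have h2 : Tendsto (fun x' : M => ((0 : ℝ), a.c x')) (𝓝 x) (𝓝 (0, a.c x)) :=
        continuousAt_const.prodMk (a.c.continuousAt hx)
      filter_upwards [hvpt, h1.eventually hGt, (hs k).eventually_isVariationAt,
        (hs k).isSectionAt.eventually_mem (hsrc k), h2.eventually (hrep k).eventually_nhds]
        with x' h3 h4 h5 h6 h7
      refine ⟨h3, ?_⟩
      have h6' : (v x').pt ∈ a.e.source := by rw [h3]; exact h6
      refine a.ext_tmap_e h6' ?_
      have h8 : (VertBundle.adapted a).e (v x') = (a.c x', G (0, a.c x')) :=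
        (VertBundle.adapted a).e.right_inv h4.2
      rw [VertBundle.adapted_apply h6'] at h8
      have h9 := h5.tmap_e h6
      have h10 : Tendsto (fun t : ℝ => (t, a.c x')) (𝓝 0) (𝓝 (0, a.c x')) :=
        (by fun_prop : Continuous fun t : ℝ => (t, a.c x')).continuousAt
      have h11 : (fun t => a.rep (a.family (g k) t) (a.c x')) =ᶠ[𝓝 0] fun t => g k (t, a.c x') :=
        h10.eventually h7
      have h12 : HasFDerivAt (fun t : ℝ => g k (t, a.c x'))
          ((ContinuousLinearMap.id ℝ ℝ).smulRight (k.1 + k.2 (a.c x' - a.c x))) 0 :=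
        ((hasFDerivAt_id (0 : ℝ)).smul_const (k.1 + k.2 (a.c x' - a.c x))).const_add
          (f + A (a.c x' - a.c x))
      rw [h11.fderiv_eq, h12.fderiv] at h9
      rw [h3] at h8 ⊢
      rw [h9]
      have h13 := (a.tmap_e_mem_vert h6').1 (v x').vec_mem
      rw [h3] at h13
      refine Prod.ext h13 ((congrArg (·.2.2) h8).trans ?_)
      simp [G]
    have hvsec := hv.isSectionAt
    refine ⟨v, hvsec, by simpa only [hs0] using hvpt, ?_⟩
    obtain ⟨w', hw'⟩ := (hs k).exists_isJetOfVertical hvs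
    have hvx : (v x).pt ∈ a.e.source := by rw [hvpt.self_of_nhds]; exact hsrc k
    obtain ⟨h2, h3, h4⟩ := hw'.adapted_apply hvx
    have h5 : (VertBundle.adapted a).rep v =ᶠ[𝓝 (a.c x)] fun u => G (0, u) := by
      have h1 : Tendsto (fun u : E => ((0 : ℝ), u)) (𝓝 (a.c x)) (𝓝 (0, a.c x)) :=
        (by fun_prop : Continuous fun u : E => ((0 : ℝ), u)).continuousAt
      exact h1.eventually ((VertBundle.adapted a).rep_family hG hx hGx)
    have h6 : HasFDerivAt (fun u => G (0, u)) (A.prod k.2) (a.c x) :=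
      hD.prodMk ((k.2.hasFDerivAt.comp (a.c x) ((hasFDerivAt_id _).sub_const _)).const_add _)
    -- The family produces some vertical vector `w'` that is the jet of `v`; equality of coordinates
    -- identifies it with the prescribed `w`.
    have h7 : w' = w := by
      refine (VertBundle.adapted (JetBundle.adapted a)).e.injOn ?_ hwa ?_
      · rw [VertBundle.mem_adapted, JetBundle.mem_adapted, h3]
        exact hvx
      · rw [h4, hk, h5.fderiv_eq, h6.fderiv, h5.self_of_nhds, interchangeCoord_apply]
        simp only [G, sub_self, map_zero, add_zero]
        rfl
    rwa [← h7]

end Variations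

/-! ### Maps that are linear in suitable charts -/

section ChartLinear

variable {V V' : Type*} [NormedAddCommGroup V] [NormedSpace ℝ V]
  [NormedAddCommGroup V'] [NormedSpace ℝ V']
  {X X' : Type*} [TopologicalSpace X] [ChartedSpace V X] [TopologicalSpace X']
  [ChartedSpace V' X'] [IsManifold 𝓘(ℝ, V) ∞ X] [IsManifold 𝓘(ℝ, V') ∞ X']
  {e : OpenPartialHomeomorph X V} (he : e ∈ IsManifold.maximalAtlas 𝓘(ℝ, V) ∞ X)
  {e' : OpenPartialHomeomorph X' V'} (he' : e' ∈ IsManifold.maximalAtlas 𝓘(ℝ, V') ∞ X')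
  {f : X → X'} {L : V →L[ℝ] V'} (hf : ∀ y ∈ e.source, f y ∈ e'.source ∧ e' (f y) = L (e y))
  {x : X} (hx : x ∈ e.source)

include hf hx

theorem eventuallyEq_of_chart_linear : f =ᶠ[𝓝 x] fun y => e'.symm (L (e y)) := by
  filter_upwards [e.open_source.mem_nhds hx] with y hy
  rw [← (hf y hy).2, e'.left_inv (hf y hy).1]

/-- Charts are local homeomorphisms, so openness of the linear expression passes to the map itself.
-/
theorem image_mem_nhds_of_chart_linear (hL : IsOpenMap L) {U : Set X} (hU : U ∈ 𝓝 x) :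
    f '' U ∈ 𝓝 (f x) := by
  have h1 : U ∩ e.source ∈ 𝓝 x := inter_mem hU (e.open_source.mem_nhds hx)
  have h2 : e '' (U ∩ e.source) ∈ 𝓝 (e x) := by
    rw [← e.map_nhds_eq hx]
    exact image_mem_map h1
  have h3 : L '' (e '' (U ∩ e.source)) ∈ 𝓝 (e' (f x)) := by
    rw [(hf x hx).2]
    exact hL.image_mem_nhds h2
  have h4 : ContinuousAt e' (f x) := e'.continuousAt (hf x hx).1
  filter_upwards [h4 h3, e'.open_source.mem_nhds (hf x hx).1] with z hz hz'
  obtain ⟨_, ⟨y, hy, rfl⟩, hyz⟩ := hz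
  refine ⟨y, hy.1, e'.injOn (hf y hy.2).1 hz' ?_⟩
  rw [(hf y hy.2).2, hyz]

include he he'

theorem contMDiffAt_of_chart_linear : ContMDiffAt 𝓘(ℝ, V) 𝓘(ℝ, V') ∞ f x := by
  refine ContMDiffAt.congr_of_eventuallyEq ?_ (eventuallyEq_of_chart_linear hf hx)
  have h1 : ContMDiffAt 𝓘(ℝ, V) 𝓘(ℝ, V') ∞ (fun y => L (e y)) x :=
    L.contDiff.contMDiff.contMDiffAt.comp x (contMDiffAt_of_mem_maximalAtlas he hx)
  have h2 : L (e x) ∈ e'.target := by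
    rw [← (hf x hx).2]; exact e'.map_source (hf x hx).1
  exact (contMDiffAt_symm_of_mem_maximalAtlas he' h2).comp x h1

theorem tmap_of_chart_linear (v : V) :
    tmap V' V' e' (f x) (tmap V V' f x v) = L (tmap V V e x v) := by
  have h1 := tmap_comp x
    ((contMDiffAt_of_mem_maximalAtlas he' (hf x hx).1).mdifferentiableAt (n := ∞) (by simp))
    ((contMDiffAt_of_chart_linear he he' hf hx).mdifferentiableAt (by simp))
  have h2 : e' ∘ f =ᶠ[𝓝 x] L ∘ e := by
    filter_upwards [e.open_source.mem_nhds hx] with y hy using (hf y hy).2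
  rw [tmap_congr h2, tmap_comp x L.differentiableAt.mdifferentiableAt
    ((contMDiffAt_of_mem_maximalAtlas he hx).mdifferentiableAt (n := ∞) (by simp))] at h1
  have h3 : tmap V V' L (e x) = L := by
    rw [tmap, mfderiv_eq_fderiv]; exact L.fderiv
  rw [h3] at h1
  exact (DFunLike.congr_fun h1 v).symm

end ChartLinear

/-! ### Chart independence of the exterior derivative -/

section ExteriorDerivative

variable {E : Type*} [NormedAddCommGroup E] [NormedSpace ℝ E] {M : Type*} [TopologicalSpace M]
  [ChartedSpace E M] [IsManifold 𝓘(ℝ, E) ∞ M]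

/-- The exterior derivative can be computed in any chart. -/
theorem extDerivAt_eq {k : ℕ} {c : OpenPartialHomeomorph M E}
    (hc : c ∈ IsManifold.maximalAtlas 𝓘(ℝ, E) ∞ M) {x : M} (hx : x ∈ c.source)
    {β : M → AltForm E k} {b : E → AltForm E k} (hb : DifferentiableAt ℝ b (c x))
    (hβ : ∀ᶠ x' in 𝓝 x, β x' = AltForm.pullback k (tmap E E c x') (b (c x'))) :
    extDerivAt β x =
      AltForm.pullback (k + 1) (tmap E E c x) (AltForm.wedge E k (fderiv ℝ b (c x))) := by
  set d := chartAt E x with hd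
  have hd1 : d ∈ IsManifold.maximalAtlas 𝓘(ℝ, E) ∞ M := IsManifold.chart_mem_maximalAtlas x
  have hdx : x ∈ d.source := mem_chart_source E x
  have hdu : d x ∈ d.target := d.map_source hdx
  -- This is the transition from the preferred chart to `c`. The two local expressions of `β` differ
  -- by pull-back along it, and `extDeriv` commutes with that pull-back.
  let f : E → E := c ∘ d.symm
  have hfx : f (d x) = c x := by simp [f, d.left_inv hdx]
  have hds : Tendsto d.symm (𝓝 (d x)) (𝓝 x) := by
    have := d.symm.continuousAt hdu
    rwa [ContinuousAt, d.left_inv hdx] at this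
  have hcs : ∀ {y}, y ∈ c.source → ContMDiffAt 𝓘(ℝ, E) 𝓘(ℝ, E) ∞ c y :=
    fun hy => contMDiffAt_of_mem_maximalAtlas hc hy
  have hf : ContDiffAt ℝ ∞ f (d x) := by
    rw [← contMDiffAt_iff_contDiffAt]
    refine ContMDiffAt.comp (d x) (hcs ?_) (contMDiffAt_symm_of_mem_maximalAtlas hd1 hdu)
    rwa [d.left_inv hdx]
  have h1 : ∀ᶠ u in 𝓝 (d x), (AltForm.pullback k (tmap E E d.symm u) (β (d.symm u))).toAlt =
      (b (f u)).toAlt.compContinuousLinearMap (fderiv ℝ f u) := by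
    filter_upwards [hds.eventually hβ, hds.eventually (c.open_source.mem_nhds hx),
      d.open_target.mem_nhds hdu] with u hu hu' hu''
    have h2 : fderiv ℝ f u = (tmap E E c (d.symm u)).comp (tmap E E d.symm u) := by
      rw [← tmap_comp u ((hcs hu').mdifferentiableAt (by simp))
        ((contMDiffAt_symm_of_mem_maximalAtlas hd1 hu'').mdifferentiableAt (n := ∞) (by simp))]
      exact mfderiv_eq_fderiv.symm
    rw [hu, h2, ← AltForm.pullback_comp_apply]
    rfl
  have hb' : DifferentiableAt ℝ (fun u => (b u).toAlt) (f (d x)) := by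
    rw [hfx]
    exact (AltForm.toAlt (E := E) (k := k)).toContinuousLinearEquiv.differentiableAt.comp (c x) hb
  have h3 : extDeriv (fun u : E => (AltForm.pullback k (tmap E E d.symm u)
      (β (d.symm u))).toAlt) (d x) =
      (extDeriv (fun u => (b u).toAlt) (c x)).compContinuousLinearMap (fderiv ℝ f (d x)) := by
    rw [Filter.EventuallyEq.extDeriv_eq h1, ← hfx]
    exact extDeriv_pullback hb' hf (by
      rw [minSmoothness_of_isRCLikeNormedField]; exact ENat.LEInfty.out)
  have h4 : extDeriv (fun u => (b u).toAlt) (c x) =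
      (AltForm.wedge E k (fderiv ℝ b (c x))).toAlt := by
    have h5 : fderiv ℝ (fun u => (b u).toAlt) (c x) =
        (AltForm.toAlt (E := E) (k := k)).toContinuousLinearEquiv.toContinuousLinearMap.comp
          (fderiv ℝ b (c x)) :=
      ((AltForm.toAlt (E := E) (k := k)).toContinuousLinearEquiv.hasFDerivAt.comp (c x)
        hb.hasFDerivAt).fderiv
    rw [extDeriv, h5]
    rfl
  have h6 : tmap E E c x = (fderiv ℝ f (d x)).comp (tmap E E d x) := by
    have h7 : c =ᶠ[𝓝 x] f ∘ d := by
      filter_upwards [d.open_source.mem_nhds hdx] with y hy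
      simp [f, d.left_inv hy]
    have h8 : fderiv ℝ f (d x) = tmap E E f (d x) := mfderiv_eq_fderiv.symm
    rw [tmap_congr h7, h8, tmap_comp x
      ((contMDiffAt_iff_contDiffAt.2 hf).mdifferentiableAt (by simp))
      ((contMDiffAt_of_mem_maximalAtlas hd1 hdx).mdifferentiableAt (n := ∞) (by simp))]
  rw [extDerivAt, ← hd, h3, h4, h6, AltForm.pullback_comp_apply]
  rfl

end ExteriorDerivative

/-! ### The interchange diffeomorphism `κ : J¹VY ≅ VJ¹Y` -/

section Interchange

variable {E F : Type*} [NormedAddCommGroup E] [NormedSpace ℝ E]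
  [NormedAddCommGroup F] [NormedSpace ℝ F]
  {M Y : Type*} [TopologicalSpace M] [ChartedSpace E M]
  [TopologicalSpace Y] [ChartedSpace (E × F) Y]
  {π : Y → M} [hπ : IsFibredManifold E F π]

instance : IsManifold 𝓘(ℝ, E × (F × F)) ∞ (VertBundle E F π) :=
  (VertBundle.liftData E F π).isManifold

instance : IsManifold 𝓘(ℝ, E × (F × (E →L[ℝ] F))) ∞ (JetBundle E F π) :=
  (JetBundle.liftData E F π).isManifold

instance {k : ℕ} : IsManifold 𝓘(ℝ, E × (F × (F →L[ℝ] AltForm E k))) ∞ (CovBundle E F π k) :=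
  (CovBundle.liftData E F π k).isManifold

/-- Both sides depend only on the value and the derivative of the coordinate representation of `v`.
So `κ` is forced to be `interchangeCoord` in every adapted chart. -/
theorem IsJetOfVertical.adapted_eq {v : M → VertBundle E F π} {x : M}
    {ξ : JetBundle E (F × F) (VertBundle.base E F π)}
    {w : VertBundle E (F × (E →L[ℝ] F)) (JetBundle.base E F π)} (hw : IsJetOfVertical v w x)
    (hξ : IsJetAt ξ v x) {a : AdaptedChart E F π} (ha : (v x).pt ∈ a.e.source) :
    (VertBundle.adapted (JetBundle.adapted a)).e w =
      interchangeCoord E F ((JetBundle.adapted (VertBundle.adapted a)).e ξ) := by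
  rw [(hw.adapted_apply ha).2.2, hξ.adapted_apply (VertBundle.mem_adapted.2 ha)]
  rfl

variable (E F π) in
/-- The canonical map `κ : J¹VY → VJ¹Y`. -/
def interchange (ξ : JetBundle E (F × F) (VertBundle.base E F π)) :
    VertBundle E (F × (E →L[ℝ] F)) (JetBundle.base E F π) :=
  (VertBundle.adapted (JetBundle.adapted (AdaptedChart.at E F π ξ.pt.pt))).e.symm
    (interchangeCoord E F
      ((JetBundle.adapted (VertBundle.adapted (AdaptedChart.at E F π ξ.pt.pt))).e ξ))

/-- Targets of induced charts restrict only the coordinates `(x, φ)` of the point of `Y`, and these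
are left alone by the reshuffling. -/
theorem interchangeCoord_mem_target {a : AdaptedChart E F π}
    {q : E × ((F × F) × (E →L[ℝ] F × F))} :
    interchangeCoord E F q ∈ (VertBundle.adapted (JetBundle.adapted a)).e.target ↔
      q ∈ (JetBundle.adapted (VertBundle.adapted a)).e.target := Iff.rfl

/-- One starts from the image: the vertical vector `interchange E F π ξ` is represented by a section
`v`, and injectivity of `interchangeCoord` identifies the jet of `v` with `ξ`. The conclusion
mentions no chart, so chart independence and uniqueness follow from it. -/
theorem interchange_representatives (ξ : JetBundle E (F × F) (VertBundle.base E F π)) :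
    ∃ (x : M) (v : M → VertBundle E F π), IsJetAt ξ v x ∧
      IsJetOfVertical v (interchange E F π ξ) x := by
  let a := AdaptedChart.at E F π ξ.pt.pt
  have ha : ξ.pt.pt ∈ a.e.source := AdaptedChart.mem_at ξ.pt.pt
  have hξ : ξ ∈ (JetBundle.adapted (VertBundle.adapted a)).e.source := ha
  have htgt : interchangeCoord E F ((JetBundle.adapted (VertBundle.adapted a)).e ξ) ∈
      (VertBundle.adapted (JetBundle.adapted a)).e.target :=
    interchangeCoord_mem_target.2 ((JetBundle.adapted (VertBundle.adapted a)).e.map_source hξ)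
  have h1 : interchange E F π ξ ∈ (VertBundle.adapted (JetBundle.adapted a)).e.source :=
    (VertBundle.adapted (JetBundle.adapted a)).e.map_target htgt
  have h2 : (VertBundle.adapted (JetBundle.adapted a)).e (interchange E F π ξ) =
      interchangeCoord E F ((JetBundle.adapted (VertBundle.adapted a)).e ξ) :=
    (VertBundle.adapted (JetBundle.adapted a)).e.right_inv htgt
  obtain ⟨x, s, -, hw⟩ := (interchange E F π ξ).pt.exists_representatives
  obtain ⟨v, hv, -, hvw⟩ := hw _ rfl
  obtain ⟨ξ', hξ'⟩ := hv.exists_isJetAt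
  have hpt := (hvw.adapted_apply (AdaptedChart.mem_at (E := E) (F := F) (π := π) (v x).pt)).2.1
  have h3 : (v x).pt ∈ a.e.source := by rw [← hpt]; exact h1
  have h4 := hvw.adapted_eq hξ' h3
  rw [h2] at h4
  have h5 : ξ = ξ' := by
    refine (JetBundle.adapted (VertBundle.adapted a)).e.injOn hξ ?_
      ((interchangeCoord E F).injective h4)
    rw [JetBundle.mem_adapted, hξ'.2.1]
    exact h3
  exact ⟨x, v, h5 ▸ hξ', hvw⟩

theorem pt_interchange (ξ : JetBundle E (F × F) (VertBundle.base E F π)) :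
    (interchange E F π ξ).pt.pt = ξ.pt.pt := by
  obtain ⟨x, v, hv, hw⟩ := interchange_representatives ξ
  rw [(hw.adapted_apply (AdaptedChart.mem_at (E := E) (F := F) (π := π) (v x).pt)).2.1, hv.2.1]

/-- The chart `a` is arbitrary here, whereas the definition uses one chosen at the point; the
passage is through representatives. -/
theorem adapted_interchange {a : AdaptedChart E F π}
    {ξ : JetBundle E (F × F) (VertBundle.base E F π)} (hξ : ξ.pt.pt ∈ a.e.source) :
    (VertBundle.adapted (JetBundle.adapted a)).e (interchange E F π ξ) =
      interchangeCoord E F ((JetBundle.adapted (VertBundle.adapted a)).e ξ) := by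
  obtain ⟨x, v, hv, hw⟩ := interchange_representatives ξ
  exact hw.adapted_eq hv (by rw [← hv.2.1]; exact hξ)

variable (E F π) in
theorem isInterchange_interchange : IsInterchange (interchange E F π) := by
  intro x v ξ w hξ hw
  have ha := AdaptedChart.mem_at (E := E) (F := F) (π := π) (v x).pt
  have hpt := (hw.adapted_apply ha).2.1
  have hξpt : ξ.pt.pt ∈ (AdaptedChart.at E F π (v x).pt).e.source := by rw [hξ.2.1]; exact ha
  refine (VertBundle.adapted (JetBundle.adapted (AdaptedChart.at E F π (v x).pt))).e.injOn
    ?_ ?_ ?_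
  · rw [VertBundle.mem_adapted, JetBundle.mem_adapted, pt_interchange]; exact hξpt
  · rw [VertBundle.mem_adapted, JetBundle.mem_adapted, hpt]; exact ha
  · rw [adapted_interchange hξpt, hw.adapted_eq hξ ha]

theorem IsInterchange.eq_interchange {κ : JetBundle E (F × F) (VertBundle.base E F π) →
    VertBundle E (F × (E →L[ℝ] F)) (JetBundle.base E F π)} (hκ : IsInterchange κ) :
    κ = interchange E F π := by
  funext ξ
  obtain ⟨x, v, hv, hw⟩ := interchange_representatives ξ
  exact hκ x v ξ _ hv hw

variable (E F π) in
/-- The inverse of the canonical map `κ : J¹VY → VJ¹Y`. -/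
def interchangeInv (w : VertBundle E (F × (E →L[ℝ] F)) (JetBundle.base E F π)) :
    JetBundle E (F × F) (VertBundle.base E F π) :=
  (JetBundle.adapted (VertBundle.adapted (AdaptedChart.at E F π w.pt.pt))).e.symm
    ((interchangeCoord E F).symm
      ((VertBundle.adapted (JetBundle.adapted (AdaptedChart.at E F π w.pt.pt))).e w))

theorem interchange_interchangeInv
    (w : VertBundle E (F × (E →L[ℝ] F)) (JetBundle.base E F π)) :
    interchange E F π (interchangeInv E F π w) = w := by
  let a := AdaptedChart.at E F π w.pt.pt
  have hw : w ∈ (VertBundle.adapted (JetBundle.adapted a)).e.source :=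
    AdaptedChart.mem_at (E := E) (F := F) (π := π) w.pt.pt
  have htgt : (interchangeCoord E F).symm ((VertBundle.adapted (JetBundle.adapted a)).e w) ∈
      (JetBundle.adapted (VertBundle.adapted a)).e.target := by
    rw [← interchangeCoord_mem_target, ContinuousLinearEquiv.apply_symm_apply]
    exact (VertBundle.adapted (JetBundle.adapted a)).e.map_source hw
  have h1 : interchangeInv E F π w ∈ (JetBundle.adapted (VertBundle.adapted a)).e.source :=
    (JetBundle.adapted (VertBundle.adapted a)).e.map_target htgt
  have h2 := adapted_interchange (a := a) h1
  have h3 : (JetBundle.adapted (VertBundle.adapted a)).e (interchangeInv E F π w) =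
      (interchangeCoord E F).symm ((VertBundle.adapted (JetBundle.adapted a)).e w) :=
    (JetBundle.adapted (VertBundle.adapted a)).e.right_inv htgt
  rw [h3, ContinuousLinearEquiv.apply_symm_apply] at h2
  refine (VertBundle.adapted (JetBundle.adapted a)).e.injOn ?_ hw h2
  rw [VertBundle.mem_adapted, JetBundle.mem_adapted, pt_interchange]; exact h1

theorem interchange_injective : Function.Injective (interchange E F π) := by
  intro ξ ξ' h
  have hpt : ξ'.pt.pt = ξ.pt.pt := by rw [← pt_interchange, ← h, pt_interchange]
  have ha := AdaptedChart.mem_at (E := E) (F := F) (π := π) ξ.pt.pt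
  have ha' : ξ'.pt.pt ∈ (AdaptedChart.at E F π ξ.pt.pt).e.source := by rw [hpt]; exact ha
  refine (JetBundle.adapted (VertBundle.adapted (AdaptedChart.at E F π ξ.pt.pt))).e.injOn ha ha' ?_
  apply (interchangeCoord E F).injective
  rw [← adapted_interchange ha, ← adapted_interchange ha', h]

variable (E F π) in
/-- The canonical diffeomorphism `κ : J¹VY ≅ VJ¹Y`. -/
def interchangeDiffeo : Diffeomorph 𝓘(ℝ, E × ((F × F) × (E →L[ℝ] F × F)))
    𝓘(ℝ, E × ((F × (E →L[ℝ] F)) × (F × (E →L[ℝ] F))))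
    (JetBundle E (F × F) (VertBundle.base E F π))
    (VertBundle E (F × (E →L[ℝ] F)) (JetBundle.base E F π)) ∞ where
  toFun := interchange E F π
  invFun := interchangeInv E F π
  left_inv ξ := interchange_injective (interchange_interchangeInv _)
  right_inv := interchange_interchangeInv
  contMDiff_toFun ξ := by
    let a := AdaptedChart.at E F π ξ.pt.pt
    refine contMDiffAt_of_chart_linear (JetBundle.adapted (VertBundle.adapted a)).e_mem
      (VertBundle.adapted (JetBundle.adapted a)).e_mem
      (L := (interchangeCoord E F).toContinuousLinearMap) (fun ξ' hξ' => ⟨?_, ?_⟩)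
      (AdaptedChart.mem_at (E := E) (F := F) (π := π) ξ.pt.pt)
    · change (interchange E F π ξ').pt.pt ∈ a.e.source
      rw [pt_interchange]; exact hξ'
    · exact adapted_interchange hξ'
  contMDiff_invFun w := by
    let a := AdaptedChart.at E F π w.pt.pt
    refine contMDiffAt_of_chart_linear (VertBundle.adapted (JetBundle.adapted a)).e_mem
      (JetBundle.adapted (VertBundle.adapted a)).e_mem
      (L := (interchangeCoord E F).symm.toContinuousLinearMap) (fun w' hw' => ?_)
      (AdaptedChart.mem_at (E := E) (F := F) (π := π) w.pt.pt)
    have h1 : (interchangeInv E F π w').pt.pt ∈ a.e.source := by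
      rw [← pt_interchange, interchange_interchangeInv]; exact hw'
    refine ⟨h1, ?_⟩
    have h2 := adapted_interchange h1
    rw [interchange_interchangeInv] at h2
    rw [h2]
    exact ((interchangeCoord E F).symm_apply_apply _).symm

end Interchange

/-! ### Vertical forms and covectors in coordinates -/

section VertForms

variable {E F : Type*} [NormedAddCommGroup E] [NormedSpace ℝ E]
  [NormedAddCommGroup F] [NormedSpace ℝ F]
  {M Y : Type*} [TopologicalSpace M] [ChartedSpace E M]
  [TopologicalSpace Y] [ChartedSpace (E × F) Y]
  {π : Y → M} [hπ : IsFibredManifold E F π] {r k : ℕ}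

theorem VertForm.app_of_mem {α : VertForm E F π r k} {y : Y} {X : Fin r → E × F}
    (h : ∀ i, X i ∈ vert E F π y) : α.app y X = α y fun i => ⟨X i, h i⟩ := dif_pos h

theorem VertForm.ext_app {α β : VertForm E F π r k}
    (h : ∀ y (X : Fin r → E × F), (∀ i, X i ∈ vert E F π y) → α.app y X = β.app y X) : α = β := by
  funext y
  ext1 X
  have h1 : ∀ i, (X i : E × F) ∈ vert E F π y := fun i => (X i).2
  have h2 := h y (fun i => X i) h1
  rwa [VertForm.app_of_mem h1, VertForm.app_of_mem h1] at h2

/-- The vertical form with a given coordinate expression at a point. -/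
def AdaptedChart.vertForm (a : AdaptedChart E F π) {y : Y} (hy : y ∈ a.e.source)
    (c : F [⋀^Fin r]→L[ℝ] AltForm E k) : (vert E F π y) [⋀^Fin r]→L[ℝ] AltForm E k :=
  (AltForm.pullback k (tmap E E a.c (π y))).compContinuousAlternatingMap
    (c.compContinuousLinearMap (a.vertIso hy).toContinuousLinearMap)

theorem CovBundle.app_of_mem {η : CovBundle E F π k} {X : E × F} (h : X ∈ vert E F π η.pt) :
    η.app X = η.cov ⟨X, h⟩ := dif_pos h

/-- The fibre coordinate of a covector was formed by conjugating with the charts of the vertical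
space and of the base. Undoing both gives the formula, with a pull-back along the base chart
remaining. -/
theorem CovBundle.app_eq {η : CovBundle E F π k} {a : AdaptedChart E F π}
    (ha : η.pt ∈ a.e.source) {X : E × F} (hX : X ∈ vert E F π η.pt) :
    η.app X = AltForm.pullback k (tmap E E a.c (π η.pt))
      (((CovBundle.adapted a).e η).2.2 (tmap (E × F) (E × F) a.e η.pt X).2) := by
  have h1 : tmap E E a.c (π η.pt) = (a.dC ha).toContinuousLinearMap := rfl
  have h2 : (tmap (E × F) (E × F) a.e η.pt X).2 = a.vertIso ha ⟨X, hX⟩ := rfl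
  have h3 : (CovBundle.liftData E F π k).coord a η ha =
    (AltForm.pullback k (a.dC ha).symm.toContinuousLinearMap).comp
      (η.cov.comp (a.vertIso ha).symm.toContinuousLinearMap) := rfl
  rw [CovBundle.app_of_mem hX, CovBundle.adapted_apply ha, h1, h2, h3]
  simp only [ContinuousLinearMap.comp_apply, ContinuousLinearEquiv.coe_coe,
    ContinuousLinearEquiv.symm_apply_apply]
  exact (AltForm.pullback_apply_symm _ _).symm

theorem CovBundle.ext_app {η η' : CovBundle E F π k} (hpt : η.pt = η'.pt)
    (h : ∀ X ∈ vert E F π η.pt, η.app X = η'.app X) : η = η' := by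
  obtain ⟨y, c⟩ := η
  obtain ⟨y', c'⟩ := η'
  obtain rfl : y = y' := hpt
  have hc : c = c' := ContinuousLinearMap.ext fun X => by
    have h1 := h X.1 X.2
    rw [CovBundle.app_of_mem (η := ⟨y, c⟩) X.2, CovBundle.app_of_mem (η := ⟨y, c'⟩) X.2] at h1
    exact h1
  rw [hc]

/-- The coordinate expression of `V*Y ⊗ ΛᵏM → Y`. -/
def ptCoord (E F G : Type*) [NormedAddCommGroup E] [NormedSpace ℝ E]
    [NormedAddCommGroup F] [NormedSpace ℝ F] [NormedAddCommGroup G] [NormedSpace ℝ G] :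
    (E × (F × G)) →L[ℝ] E × F :=
  (ContinuousLinearMap.fst ℝ E (F × G)).prod
    ((ContinuousLinearMap.fst ℝ F G).comp (ContinuousLinearMap.snd ℝ E (F × G)))

theorem CovBundle.tmap_pt {η : CovBundle E F π k} {a : AdaptedChart E F π}
    (ha : η.pt ∈ a.e.source) (X : E × (F × (F →L[ℝ] AltForm E k))) :
    tmap (E × F) (E × F) a.e η.pt
      (tmap (E × (F × (F →L[ℝ] AltForm E k))) (E × F) (CovBundle.pt : CovBundle E F π k → Y) η X) =
      ptCoord E F _ (tmap (E × (F × (F →L[ℝ] AltForm E k)))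
        (E × (F × (F →L[ℝ] AltForm E k))) (CovBundle.adapted a).e η X) := by
  have := hπ.total_isManifold
  exact tmap_of_chart_linear (CovBundle.adapted a).e_mem a.e_mem
    (f := (CovBundle.pt : CovBundle E F π k → Y)) (L := ptCoord E F _)
    (fun y hy => ⟨hy, by rw [CovBundle.adapted_apply hy]; rfl⟩) ha X

/-- This is the coordinate expression `θ = p δφ`. -/
theorem canonicalForm_app {p : PhaseBundle E F π k} {a : AdaptedChart E F π}
    (ha : p.pt ∈ a.e.source) {X : E × CovFibre E F k}
    (hX : X ∈ vert E (CovFibre E F k) (CovBundle.base E F π k) p) :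
    (canonicalForm E F π k).app p ![X] =
      AltForm.pullback k (tmap E E a.c (CovBundle.base E F π k p))
        (((CovBundle.adapted a).e p).2.2 (tmap (E × CovFibre E F k) (E × CovFibre E F k)
          (CovBundle.adapted a).e p X).2.1) := by
  have h1 : ∀ i, (![X] : Fin 1 → _) i ∈ vert E (CovFibre E F k) (CovBundle.base E F π k) p := by
    intro i; fin_cases i; exact hX
  rw [VertForm.app_of_mem h1]
  have h2 : tmap (E × CovFibre E F k) (E × F) (CovBundle.pt : PhaseBundle E F π k → Y) p X ∈
      vert E F π p.pt := (PhaseBundle.vertProj p ⟨X, hX⟩).2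
  have h3 := CovBundle.app_eq ha h2
  rw [CovBundle.tmap_pt ha] at h3
  rw [CovBundle.app_of_mem h2] at h3
  exact h3

end VertForms

/-! ### The vertical differential `ω = δθ` -/

section VerticalDifferential

variable {E F : Type*} [NormedAddCommGroup E] [NormedSpace ℝ E]
  [NormedAddCommGroup F] [NormedSpace ℝ F]

/-- The canonical symplectic form `δp ∧ δφ` on `F × Hom(F, Λ)`. -/
def pairForm (F Λ : Type*) [NormedAddCommGroup F] [NormedSpace ℝ F]
    [NormedAddCommGroup Λ] [NormedSpace ℝ Λ] : (F × (F →L[ℝ] Λ)) [⋀^Fin 2]→L[ℝ] Λ :=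
  antisymmetrize (((ContinuousLinearMap.compL ℝ (F × (F →L[ℝ] Λ)) F Λ).flip
    (ContinuousLinearMap.fst ℝ F (F →L[ℝ] Λ))).comp (ContinuousLinearMap.snd ℝ F (F →L[ℝ] Λ)))

theorem pairForm_apply {Λ : Type*} [NormedAddCommGroup Λ] [NormedSpace ℝ Λ]
    (X : Fin 2 → F × (F →L[ℝ] Λ)) :
    pairForm F Λ X = (X 0).2 (X 1).1 - (X 1).2 (X 0).1 := rfl

/-- This is `d(p dφ) = dp ∧ dφ` pulled back to a surface: the terms with second derivatives of `g`
cancel by symmetry. -/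
theorem pairForm_fderiv {Λ : Type*} [NormedAddCommGroup Λ] [NormedSpace ℝ Λ]
    {g : ℝ × ℝ → F × (F →L[ℝ] Λ)} {q : ℝ × ℝ} (hg : ContDiffAt ℝ ∞ g q) :
    fderiv ℝ (fun q => (g q).2 (fderiv ℝ g q (0, 1)).1) q (1, 0) -
      fderiv ℝ (fun q => (g q).2 (fderiv ℝ g q (1, 0)).1) q (0, 1) =
    pairForm F Λ ![fderiv ℝ g q (1, 0), fderiv ℝ g q (0, 1)] := by
  have h1 : HasFDerivAt g (fderiv ℝ g q) q := (hg.differentiableAt (by simp)).hasFDerivAt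
  have h2 : HasFDerivAt (fderiv ℝ g) (fderiv ℝ (fderiv ℝ g) q) q :=
    ((hg.fderiv_right (m := ∞) (by simp)).differentiableAt (by simp)).hasFDerivAt
  have h3 : ∀ e, HasFDerivAt (fun q => (fderiv ℝ g q e).1) _ q := fun e =>
    (h2.clm_apply (hasFDerivAt_const e q)).fst
  have h4 : ∀ e, HasFDerivAt (fun q => (g q).2 (fderiv ℝ g q e).1) _ q := fun e =>
    h1.snd.clm_apply (h3 e)
  rw [(h4 _).fderiv, (h4 _).fderiv, pairForm_apply]
  have hs : IsSymmSndFDerivAt ℝ g q := hg.isSymmSndFDerivAt (by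
    rw [minSmoothness_of_isRCLikeNormedField]; exact ENat.LEInfty.out)
  have hs' := hs.eq (1, 0) (0, 1)
  simp [hs']

variable {M Q : Type*} [TopologicalSpace M] [ChartedSpace E M]
  [TopologicalSpace Q] [ChartedSpace (E × F) Q]
  {π : Q → M} [hπ : IsFibredManifold E F π] {m : ℕ}

/-- Along a surface inside a fibre the base coordinate is constant. The pull-back along the base
chart is therefore a fixed linear map that commutes with differentiation, and what remains is
`pairForm_fderiv`. -/
theorem canonicalForm_differential {σ : ℝ × ℝ → PhaseBundle E F π m}
    (hσ : ∀ᶠ q in 𝓝 (0 : ℝ × ℝ), CovBundle.base E F π m (σ q) = CovBundle.base E F π m (σ 0) ∧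
      ContMDiffAt 𝓘(ℝ, ℝ × ℝ) 𝓘(ℝ, E × CovFibre E F m) ∞ σ q)
    {a : AdaptedChart E F π} (ha : (σ 0).pt ∈ a.e.source) :
    fderiv ℝ (fun q => (canonicalForm E F π m).app (σ q)
        ![tmap (ℝ × ℝ) (E × CovFibre E F m) σ q (0, 1)]) 0 (1, 0) -
      fderiv ℝ (fun q => (canonicalForm E F π m).app (σ q)
        ![tmap (ℝ × ℝ) (E × CovFibre E F m) σ q (1, 0)]) 0 (0, 1) =
    AltForm.pullback m (tmap E E a.c (CovBundle.base E F π m (σ 0)))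
      (pairForm F (AltForm E m) fun i => (tmap (E × CovFibre E F m) (E × CovFibre E F m)
        (CovBundle.adapted a).e (σ 0)
        (![tmap (ℝ × ℝ) (E × CovFibre E F m) σ 0 (1, 0),
          tmap (ℝ × ℝ) (E × CovFibre E F m) σ 0 (0, 1)] i)).2) := by
  let b : AdaptedChart E (CovFibre E F m) (CovBundle.base E F π m) := CovBundle.adapted a
  let g : ℝ × ℝ → CovFibre E F m := fun q => (b.e (σ q)).2
  have h0 : ContMDiffAt 𝓘(ℝ, ℝ × ℝ) 𝓘(ℝ, E × CovFibre E F m) ∞ σ 0 := hσ.self_of_nhds.2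
  have hmem : ∀ᶠ q in 𝓝 (0 : ℝ × ℝ), σ q ∈ b.e.source :=
    h0.continuousAt.eventually (b.e.open_source.mem_nhds ha)
  have hsm : ∀ q, ContMDiffAt 𝓘(ℝ, ℝ × ℝ) 𝓘(ℝ, E × CovFibre E F m) ∞ σ q → σ q ∈ b.e.source →
      ContDiffAt ℝ ∞ g q := fun q hq hq' =>
    (contMDiffAt_iff_contDiffAt.1 ((b.contMDiffAt_e hq').comp q hq)).snd
  have hD : ∀ᶠ q in 𝓝 (0 : ℝ × ℝ), ∀ e, tmap (E × CovFibre E F m)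
      (E × CovFibre E F m) b.e (σ q)
      (tmap (ℝ × ℝ) (E × CovFibre E F m) σ q e) = (0, fderiv ℝ g q e) := by
    filter_upwards [hσ.eventually_nhds, hmem.eventually_nhds] with q hq hq' e
    have h1 := b.tmap_e_comp (hq.self_of_nhds.2.mdifferentiableAt (by simp)) hq'.self_of_nhds
    have h2 : (fun q => b.e (σ q)) =ᶠ[𝓝 q]
        fun q => (b.c (CovBundle.base E F π m (σ 0)), g q) := by
      filter_upwards [hq, hq'] with q' h3 h4
      exact Prod.ext (by rw [b.fst_eq _ h4, h3.1]) rfl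
    have h3 : HasFDerivAt (fun q => (b.c (CovBundle.base E F π m (σ 0)), g q)) _ q :=
      (hasFDerivAt_const _ _).prodMk
        ((hsm q hq.self_of_nhds.2 hq'.self_of_nhds).differentiableAt (by simp)).hasFDerivAt
    have h4 : tmap (ℝ × ℝ) (E × CovFibre E F m)
        (fun q => (b.c (CovBundle.base E F π m (σ 0)), g q)) q =
        fderiv ℝ (fun q => (b.c (CovBundle.base E F π m (σ 0)), g q)) q := mfderiv_eq_fderiv
    rw [tmap_congr h2, h4, h3.fderiv] at h1
    exact DFunLike.congr_fun h1 e
  let P := AltForm.pullback m (tmap E E a.c (CovBundle.base E F π m (σ 0)))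
  have hθ : ∀ e, (fun q => (canonicalForm E F π m).app (σ q)
      ![tmap (ℝ × ℝ) (E × CovFibre E F m) σ q e]) =ᶠ[𝓝 0]
      fun q => P ((g q).2 (fderiv ℝ g q e).1) := by
    intro e
    filter_upwards [hσ, hmem, hD] with q h1 h2 h3
    rw [canonicalForm_app h2 ((b.tmap_e_mem_vert h2).2 (by rw [h3])), h1.1]
    have h4 := h3 e
    simp only [b] at h4
    rw [h4]
  have hg : ContDiffAt ℝ ∞ g 0 := hsm 0 h0 ha
  have hd : ∀ e, DifferentiableAt ℝ (fun q => (g q).2 (fderiv ℝ g q e).1) 0 := by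
    intro e
    have h1 : ContDiffAt ℝ ∞ (fderiv ℝ g) 0 := hg.fderiv_right (by simp)
    exact (hg.snd.clm_apply (h1.clm_apply contDiffAt_const).fst).differentiableAt (by simp)
  have hP : ∀ e, fderiv ℝ (fun q => P ((g q).2 (fderiv ℝ g q e).1)) 0 =
      P.comp (fderiv ℝ (fun q => (g q).2 (fderiv ℝ g q e).1) 0) := fun e =>
    (P.hasFDerivAt.comp 0 (hd e).hasFDerivAt).fderiv
  rw [(hθ _).fderiv_eq, (hθ _).fderiv_eq, hP, hP, ContinuousLinearMap.comp_apply,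
    ContinuousLinearMap.comp_apply, ← map_sub, pairForm_fderiv hg]
  have h5 : ∀ e, tmap (E × CovFibre E F m) (E × CovFibre E F m)
        (CovBundle.adapted a).e (σ 0)
      (tmap (ℝ × ℝ) (E × CovFibre E F m) σ 0 e) = (0, fderiv ℝ g 0 e) := hD.self_of_nhds
  simp only [pairForm_apply, Matrix.cons_val_zero, Matrix.cons_val_one, h5]
  rfl

/-- Any two vertical vectors are tangent to a surface in the fibre. -/
theorem exists_vertical_surface (b : AdaptedChart E F π) {y : Q} (hy : y ∈ b.e.source)
    {X X' : E × F} (hX : X ∈ vert E F π y) (hX' : X' ∈ vert E F π y) :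
    ∃ σ : ℝ × ℝ → Q, (∀ᶠ q in 𝓝 (0 : ℝ × ℝ), π (σ q) = π (σ 0) ∧
      ContMDiffAt 𝓘(ℝ, ℝ × ℝ) 𝓘(ℝ, E × F) ∞ σ q) ∧ σ 0 = y ∧
      tmap (ℝ × ℝ) (E × F) σ 0 (1, 0) = X ∧ tmap (ℝ × ℝ) (E × F) σ 0 (0, 1) = X' := by
  -- The surface is the affine plane in the chart spanned by the coordinates of the two vectors;
  -- verticality makes its base component constant.
  let L : ℝ × ℝ →L[ℝ] E × F :=
    (ContinuousLinearMap.fst ℝ ℝ ℝ).smulRight (tmap (E × F) (E × F) b.e y X) +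
    (ContinuousLinearMap.snd ℝ ℝ ℝ).smulRight (tmap (E × F) (E × F) b.e y X')
  have hL : ∀ q, (L q).1 = 0 := fun q => by
    have h1 := (b.tmap_e_mem_vert hy).1 hX
    have h2 := (b.tmap_e_mem_vert hy).1 hX'
    simp [L, h1, h2]
  let g : ℝ × ℝ → E × F := fun q => b.e y + L q
  have hg : ContDiff ℝ ∞ g := by fun_prop
  have hg0 : g 0 = b.e y := by simp [g]
  have hgt : ∀ᶠ q in 𝓝 (0 : ℝ × ℝ), g q ∈ b.e.target := by
    refine hg.continuous.continuousAt.eventually (b.e.open_target.mem_nhds ?_)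
    rw [hg0]; exact b.e.map_source hy
  let σ : ℝ × ℝ → Q := fun q => b.e.symm (g q)
  have hσ0 : σ 0 = y := by simp only [σ, hg0, b.e.left_inv hy]
  have hs : ∀ᶠ q in 𝓝 (0 : ℝ × ℝ), ContMDiffAt 𝓘(ℝ, ℝ × ℝ) 𝓘(ℝ, E × F) ∞ σ q := by
    filter_upwards [hgt] with q hq
    exact (b.contMDiffAt_e_symm hq).comp q hg.contMDiff.contMDiffAt
  have hD : ∀ e, tmap (ℝ × ℝ) (E × F) σ 0 e = (b.dE hy).symm (L e) := by
    intro e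
    rw [ContinuousLinearEquiv.eq_symm_apply]
    have hy' : σ 0 ∈ b.e.source := by rw [hσ0]; exact hy
    have h1 := b.tmap_e_comp (hs.self_of_nhds.mdifferentiableAt (by simp)) hy'
    have h2 : (fun q => b.e (σ q)) =ᶠ[𝓝 0] g := by
      filter_upwards [hgt] with q hq using b.e.right_inv hq
    have h3 : tmap (ℝ × ℝ) (E × F) g 0 = L :=
      mfderiv_eq_fderiv.trans (L.hasFDerivAt.const_add (b.e y)).fderiv
    rw [tmap_congr h2, h3] at h1
    rw [b.dE_apply, ← DFunLike.congr_fun h1 e, hσ0]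
    rfl
  refine ⟨σ, ?_, hσ0, ?_, ?_⟩
  · filter_upwards [hgt, hs] with q hq hq'
    refine ⟨?_, hq'⟩
    have h1 : σ q ∈ b.e.source := b.e.map_target hq
    refine b.c.injOn (b.map_source _ h1) (b.map_source _ (by rw [hσ0]; exact hy)) ?_
    rw [← b.fst_eq _ h1, hσ0, ← b.fst_eq _ hy, b.e.right_inv hq]
    simp [g, hL]
  · rw [hD, ContinuousLinearEquiv.symm_apply_eq, b.dE_apply]
    simp [L]
  · rw [hD, ContinuousLinearEquiv.symm_apply_eq, b.dE_apply]
    simp [L]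

variable (E F π m) in
/-- The vertical two-form `ω = δθ` on the phase bundle. -/
def canonicalTwoForm : VertForm E (CovFibre E F m) (CovBundle.base E F π m) 2 m := fun p =>
  (CovBundle.adapted (AdaptedChart.at E F π p.pt)).vertForm
    (CovBundle.mem_adapted.2 (AdaptedChart.mem_at p.pt)) (pairForm F (AltForm E m))

variable (E F π m) in
theorem isVerticalDifferential_canonicalTwoForm :
    IsVerticalDifferential (canonicalForm E F π m) (canonicalTwoForm E F π m) := by
  intro σ hσ
  have ha := AdaptedChart.mem_at (E := E) (F := F) (π := π) (σ 0).pt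
  rw [canonicalForm_differential hσ ha]
  -- Verticality has to be checked because `VertForm.app` takes a default value on other vectors. It
  -- holds since the base point is constant along `σ`.
  have hv : ∀ e, tmap (ℝ × ℝ) (E × CovFibre E F m) σ 0 e ∈
      vert E (CovFibre E F m) (CovBundle.base E F π m) (σ 0) := by
    intro e
    rw [mem_vert, ← ContinuousLinearMap.comp_apply,
      ← tmap_comp 0 (IsFibredManifold.mdifferentiableAt E _ (CovBundle.base E F π m) (σ 0))
        (hσ.self_of_nhds.2.mdifferentiableAt (by simp)),
      tmap_congr (f := CovBundle.base E F π m ∘ σ)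
        (g := fun _ => CovBundle.base E F π m (σ 0)) (hσ.mono fun q hq => hq.1)]
    have : tmap (ℝ × ℝ) E (fun _ : ℝ × ℝ => CovBundle.base E F π m (σ 0)) 0 = 0 := mfderiv_const
    rw [this]; rfl
  rw [VertForm.app_of_mem (fun i => by fin_cases i <;> exact hv _)]
  rfl

/-- Every pair of vertical vectors is tangent to a surface in the fibre, so the defining property
fixes the value. The formula holds in every chart, which gives uniqueness and frees
`canonicalTwoForm` from its chosen chart. -/
theorem IsVerticalDifferential.app_eq
    {Ω : VertForm E (CovFibre E F m) (CovBundle.base E F π m) 2 m}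
    (hΩ : IsVerticalDifferential (canonicalForm E F π m) Ω) {a : AdaptedChart E F π}
    {p : PhaseBundle E F π m} (ha : p.pt ∈ a.e.source) {X : Fin 2 → E × CovFibre E F m}
    (hX : ∀ i, X i ∈ vert E (CovFibre E F m) (CovBundle.base E F π m) p) :
    Ω.app p X = AltForm.pullback m (tmap E E a.c (CovBundle.base E F π m p))
      (pairForm F (AltForm E m) fun i => (tmap (E × CovFibre E F m) (E × CovFibre E F m)
        (CovBundle.adapted a).e p (X i)).2) := by
  obtain ⟨σ, hσ, rfl, h1, h2⟩ :=
    exists_vertical_surface (CovBundle.adapted a) (CovBundle.mem_adapted.2 ha) (hX 0) (hX 1)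
  have h3 : X = ![tmap (ℝ × ℝ) (E × CovFibre E F m) σ 0 (1, 0),
      tmap (ℝ × ℝ) (E × CovFibre E F m) σ 0 (0, 1)] := by
    rw [h1, h2]
    funext i
    fin_cases i <;> rfl
  rw [h3, hΩ σ hσ, canonicalForm_differential hσ ha]

theorem IsVerticalDifferential.eq_canonicalTwoForm
    {Ω : VertForm E (CovFibre E F m) (CovBundle.base E F π m) 2 m}
    (hΩ : IsVerticalDifferential (canonicalForm E F π m) Ω) : Ω = canonicalTwoForm E F π m := by
  refine VertForm.ext_app fun p X hX => ?_
  have ha := AdaptedChart.mem_at (E := E) (F := F) (π := π) p.pt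
  rw [hΩ.app_eq ha hX, (isVerticalDifferential_canonicalTwoForm E F π m).app_eq ha hX]

end VerticalDifferential

/-! ### The coordinate expression of the pre-symplectic form -/

section JetPairForm

variable {E F : Type*} [NormedAddCommGroup E] [NormedSpace ℝ E]
  [NormedAddCommGroup F] [NormedSpace ℝ F]

/-- The first component of a jet of a pair. -/
def fstJet (E A B : Type*) [NormedAddCommGroup E] [NormedSpace ℝ E] [NormedAddCommGroup A]
    [NormedSpace ℝ A] [NormedAddCommGroup B] [NormedSpace ℝ B] :
    ((A × B) × (E →L[ℝ] A × B)) →L[ℝ] A × (E →L[ℝ] A) :=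
  ContinuousLinearMap.prodMap (ContinuousLinearMap.fst ℝ A B)
    (ContinuousLinearMap.compL ℝ E (A × B) A (ContinuousLinearMap.fst ℝ A B))

/-- The second component of a jet of a pair. -/
def sndJet (E A B : Type*) [NormedAddCommGroup E] [NormedSpace ℝ E] [NormedAddCommGroup A]
    [NormedSpace ℝ A] [NormedAddCommGroup B] [NormedSpace ℝ B] :
    ((A × B) × (E →L[ℝ] A × B)) →L[ℝ] B × (E →L[ℝ] B) :=
  ContinuousLinearMap.prodMap (ContinuousLinearMap.snd ℝ A B)
    (ContinuousLinearMap.compL ℝ E (A × B) B (ContinuousLinearMap.snd ℝ A B))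

theorem fstJet_apply {A B : Type*} [NormedAddCommGroup A]
    [NormedSpace ℝ A] [NormedAddCommGroup B] [NormedSpace ℝ B]
    (z : (A × B) × (E →L[ℝ] A × B)) :
    fstJet E A B z = (z.1.1, (ContinuousLinearMap.fst ℝ A B).comp z.2) := rfl

/-- The bilinear form `(W₁, W₂) ↦ d⟨δφ₂, δp₁⟩` on vertical vectors of the jet bundle. -/
def jetPairing (E F : Type*) [NormedAddCommGroup E] [NormedSpace ℝ E]
    [NormedAddCommGroup F] [NormedSpace ℝ F] (m : ℕ) :
    JetFibre E (CovFibre E F m) →L[ℝ] JetFibre E (CovFibre E F m) →L[ℝ] AltForm E (m + 1) :=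
  ((ContinuousLinearMap.compL ℝ (JetFibre E (CovFibre E F m)) (JetFibre E F)
    (AltForm E (m + 1))).flip (fstJet E F (F →L[ℝ] AltForm E m))).comp
      ((momentumMap E F m).comp (sndJet E F (F →L[ℝ] AltForm E m)))

theorem jetPairing_apply {m : ℕ} (z z' : JetFibre E (CovFibre E F m)) :
    jetPairing E F m z z' = momentumMap E F m (sndJet E F _ z) (fstJet E F _ z') := rfl

/-- Product rule for `⟨v, p⟩`, antisymmetrized. It is the source of both the formula for `Ψ` and
that for `dω`. -/
theorem wedge_fderiv {m : ℕ} {p : E → F →L[ℝ] AltForm E m} {v : E → F} {u : E}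
    (hp : DifferentiableAt ℝ p u) (hv : DifferentiableAt ℝ v u) :
    AltForm.wedge E m (fderiv ℝ (fun u => p u (v u)) u) =
      momentumMap E F m (p u, fderiv ℝ p u) (v u, fderiv ℝ v u) := by
  rw [(hp.hasFDerivAt.clm_apply hv.hasFDerivAt).fderiv, momentumMap_apply]
  exact congrArg _ (add_comm _ _)

theorem wedge_fderiv_pairForm {m : ℕ} {z z' : E → CovFibre E F m} {u : E}
    (hz : DifferentiableAt ℝ z u) (hz' : DifferentiableAt ℝ z' u) :
    AltForm.wedge E m (fderiv ℝ (fun u => (z u).2 (z' u).1 - (z' u).2 (z u).1) u) =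
      jetPairing E F m (z u, fderiv ℝ z u) (z' u, fderiv ℝ z' u) -
      jetPairing E F m (z' u, fderiv ℝ z' u) (z u, fderiv ℝ z u) := by
  have h1 := hz.hasFDerivAt.fst
  have h2 := hz.hasFDerivAt.snd
  have h1' := hz'.hasFDerivAt.fst
  have h2' := hz'.hasFDerivAt.snd
  rw [fderiv_fun_sub (h2.differentiableAt.clm_apply h1'.differentiableAt)
    (h2'.differentiableAt.clm_apply h1.differentiableAt), map_sub,
    wedge_fderiv h2.differentiableAt h1'.differentiableAt,
    wedge_fderiv h2'.differentiableAt h1.differentiableAt, h1.fderiv, h2.fderiv, h1'.fderiv,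
    h2'.fderiv]
  rfl

end JetPairForm

/-! ### The space-time differential `dω` on `J¹P` -/

section SpacetimeDifferential

variable {E F : Type*} [NormedAddCommGroup E] [NormedSpace ℝ E]
  [NormedAddCommGroup F] [NormedSpace ℝ F]
  {M Q : Type*} [TopologicalSpace M] [ChartedSpace E M]
  [TopologicalSpace Q] [ChartedSpace (E × F) Q]
  {π : Q → M} [hπ : IsFibredManifold E F π] {m : ℕ}

theorem IsJetOfVertical.pt_eq {s : M → Q} {v : M → VertBundle E F π} {x : M}
    {w : VertBundle E (F × (E →L[ℝ] F)) (JetBundle.base E F π)} (hw : IsJetOfVertical v w x)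
    {ζ : JetBundle E F π} (hζ : IsJetAt ζ s x) (hv : ∀ᶠ x' in 𝓝 x, (v x').pt = s x') :
    w.pt = ζ := by
  obtain ⟨σ, hσ, hvσ, γ, hγ, hw, -⟩ := hw
  rw [hw]
  refine hγ.self_of_nhds.eq (hζ.congr ?_)
  filter_upwards [hv, hvσ] with x' h1 h2
  rw [← h1, h2.1]

theorem VertBundle.rep_apply_snd {v : M → VertBundle E F π} {x : M} {a : AdaptedChart E F π}
    (hx : x ∈ a.c.source) (ha : (v x).pt ∈ a.e.source) :
    (VertBundle.adapted a).rep v (a.c x) =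
      ((a.e (v x).pt).2, (tmap (E × F) (E × F) a.e (v x).pt (v x).vec).2) := by
  have h1 : (VertBundle.adapted a).rep v (a.c x) = ((VertBundle.adapted a).e (v x)).2 :=
    (VertBundle.adapted a).rep_apply hx
  rw [h1, VertBundle.adapted_apply ha]

/-- In the chart, `ω(v₀, v₁)` is the function `p₀ φ₁ - p₁ φ₀` of the representatives, and the
exterior derivative of such an expression is `wedge_fderiv_pairForm`. The result involves the
sections only through the vectors `w i`, so `dω` is well defined. -/
theorem canonicalTwoForm_differential {x : M} {s : M → PhaseBundle E F π m}
    {ζ : JetPhaseBundle E F π m}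
    {v : Fin 2 → M → VertBundle E (CovFibre E F m) (CovBundle.base E F π m)}
    {w : Fin 2 → VertBundle E (JetFibre E (CovFibre E F m))
      (JetBundle.base E (CovFibre E F m) (CovBundle.base E F π m))}
    (hζ : IsJetAt ζ s x) (hv : ∀ i, ∀ᶠ x' in 𝓝 x, (v i x').pt = s x')
    (hw : ∀ i, IsJetOfVertical (v i) (w i) x) {a : AdaptedChart E F π}
    (ha : (s x).pt ∈ a.e.source) :
    extDerivAt (fun x' => (canonicalTwoForm E F π m).app (s x') fun i => (v i x').vec) x =
      AltForm.pullback (m + 1) (tmap E E a.c x)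
        (antisymmetrize (jetPairing E F m) fun i =>
          (tmap (E × JetFibre E (CovFibre E F m)) (E × JetFibre E (CovFibre E F m))
            (JetBundle.adapted (CovBundle.adapted a)).e ζ (w i).vec).2) := by
  have := hπ.base_isManifold
  let b : AdaptedChart E (CovFibre E F m) (CovBundle.base E F π m) := CovBundle.adapted a
  have hvx : ∀ i, (v i x).pt ∈ b.e.source := fun i => by
    rw [(hv i).self_of_nhds]; exact ha
  have hx : x ∈ b.c.source := b.mem_c_source hζ.1.apply_eq ha
  let z : Fin 2 → E → CovFibre E F m := fun i u => ((VertBundle.adapted b).rep (v i) u).2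
  have hz : ∀ i, HasFDerivAt (z i) ((ContinuousLinearMap.snd ℝ _ _).comp
      (fderiv ℝ ((VertBundle.adapted b).rep (v i)) (a.c x))) (a.c x) := fun i =>
    ((((hw i).adapted_apply (hvx i)).1).differentiableAt (by simp)).hasFDerivAt.snd
  have hwz : ∀ i, (tmap (E × JetFibre E (CovFibre E F m)) (E × JetFibre E (CovFibre E F m))
      (JetBundle.adapted b).e ζ (w i).vec).2 = (z i (a.c x), fderiv ℝ (z i) (a.c x)) := by
    intro i
    have h1 := ((hw i).adapted_apply (hvx i)).2.2
    have hpt := (hw i).pt_eq hζ (hv i)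
    have hmem : (w i).pt ∈ (JetBundle.adapted b).e.source := by
      rw [hpt, JetBundle.mem_adapted, hζ.2.1]; exact ha
    rw [VertBundle.adapted_apply hmem, hpt, interchangeCoord_apply] at h1
    rw [(hz i).fderiv]
    exact congrArg (fun q => q.2.2) h1
  have hΩ : ∀ᶠ x' in 𝓝 x, (canonicalTwoForm E F π m).app (s x') (fun i => (v i x').vec) =
      AltForm.pullback m (tmap E E a.c x')
        ((z 0 (a.c x')).2 (z 1 (a.c x')).1 - (z 1 (a.c x')).2 (z 0 (a.c x')).1) := by
    have hv' : ∀ᶠ x' in 𝓝 x, ∀ i, (v i x').pt = s x' := eventually_all.2 hv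
    filter_upwards [hζ.1, hζ.1.eventually_mem (a := b) ha, hv', b.c.open_source.mem_nhds hx]
      with x' h1 h2 h3 h4
    have h5 : ∀ i, (v i x').vec ∈
        vert E (CovFibre E F m) (CovBundle.base E F π m) (s x') := fun i => by
      rw [← h3 i]; exact (v i x').vec_mem
    have h6 : ∀ i, (tmap (E × CovFibre E F m) (E × CovFibre E F m) (CovBundle.adapted a).e (s x')
        (v i x').vec).2 = z i (a.c x') := fun i => by
      have h7 := VertBundle.rep_apply_snd (v := v i) h4 (by rw [h3]; exact h2)
      rw [h3 i] at h7
      exact (congrArg Prod.snd h7).symm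
    -- The definition of `canonicalTwoForm` uses a chart that varies with the point; here it is
    -- replaced by the single chart `a`, as is needed before differentiating.
    rw [(isVerticalDifferential_canonicalTwoForm E F π m).app_eq h2 h5, h1.1, pairForm_apply]
    simp only [h6]
  have hd : DifferentiableAt ℝ (fun u => (z 0 u).2 (z 1 u).1 - (z 1 u).2 (z 0 u).1) (a.c x) :=
    ((hz 0).differentiableAt.snd.clm_apply (hz 1).differentiableAt.fst).sub
      ((hz 1).differentiableAt.snd.clm_apply (hz 0).differentiableAt.fst)
  rw [extDerivAt_eq a.c_mem hx hd hΩ,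
    wedge_fderiv_pairForm (hz 0).differentiableAt (hz 1).differentiableAt, antisymmetrize_apply,
    hwz, hwz]

variable (E F π m) in
/-- The pre-symplectic form `dω` on `J¹P`. -/
def jetTwoForm : VertForm E (JetFibre E (CovFibre E F m))
    (JetBundle.base E (CovFibre E F m) (CovBundle.base E F π m)) 2 (m + 1) := fun ζ =>
  (JetBundle.adapted (CovBundle.adapted (AdaptedChart.at E F π ζ.pt.pt))).vertForm
    (JetBundle.mem_adapted.2 (CovBundle.mem_adapted.2 (AdaptedChart.mem_at ζ.pt.pt)))
    (antisymmetrize (jetPairing E F m))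

theorem jetTwoForm_app {ζ : JetPhaseBundle E F π m}
    {X : Fin 2 → E × JetFibre E (CovFibre E F m)}
    (hX : ∀ i, X i ∈ vert E (JetFibre E (CovFibre E F m))
      (JetBundle.base E (CovFibre E F m) (CovBundle.base E F π m)) ζ) :
    (jetTwoForm E F π m).app ζ X =
      AltForm.pullback (m + 1) (tmap E E (AdaptedChart.at E F π ζ.pt.pt).c (π ζ.pt.pt))
        (antisymmetrize (jetPairing E F m) fun i =>
          (tmap (E × JetFibre E (CovFibre E F m)) (E × JetFibre E (CovFibre E F m))
            (JetBundle.adapted (CovBundle.adapted (AdaptedChart.at E F π ζ.pt.pt))).e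
              ζ (X i)).2) := by
  rw [VertForm.app_of_mem hX]
  rfl

variable (E F π m) in
theorem isSpacetimeDifferential_jetTwoForm :
    IsSpacetimeDifferential (canonicalTwoForm E F π m) (jetTwoForm E F π m) := by
  intro x s ζ v w hζ _ hv hw
  have hX : ∀ i, (w i).vec ∈ vert E (JetFibre E (CovFibre E F m))
      (JetBundle.base E (CovFibre E F m) (CovBundle.base E F π m)) ζ := fun i => by
    rw [← (hw i).pt_eq hζ (hv i)]; exact (w i).vec_mem
  have ha : (s x).pt ∈ (AdaptedChart.at E F π ζ.pt.pt).e.source := by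
    rw [← hζ.2.1]; exact AdaptedChart.mem_at ζ.pt.pt
  have hx : π ζ.pt.pt = x := by rw [hζ.2.1]; exact hζ.1.apply_eq
  rw [canonicalTwoForm_differential hζ hv hw ha, jetTwoForm_app hX, hx]

/-- All vertical vectors at a jet are represented by vertical sections along one common section, so
the defining property prescribes every value. -/
theorem IsSpacetimeDifferential.unique {r k : ℕ} {α : VertForm E F π r k}
    {β β' : VertForm E (F × (E →L[ℝ] F)) (JetBundle.base E F π) r (k + 1)}
    (hβ : IsSpacetimeDifferential α β) (hβ' : IsSpacetimeDifferential α β') : β = β' := by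
  refine VertForm.ext_app fun ζ X hX => ?_
  obtain ⟨x, s, hζ, hs⟩ := ζ.exists_representatives
  choose v h1 h2 h3 using fun i => hs ⟨ζ, X i, hX i⟩ rfl
  exact (hβ x s ζ v _ hζ h1 h2 h3).trans (hβ' x s ζ v _ hζ h1 h2 h3).symm

end SpacetimeDifferential

/-! ### Affine sections with a prescribed jet -/

section AffineSections

variable {E F : Type*} [NormedAddCommGroup E] [NormedSpace ℝ E]
  [NormedAddCommGroup F] [NormedSpace ℝ F]
  {M Y : Type*} [TopologicalSpace M] [ChartedSpace E M]
  [TopologicalSpace Y] [ChartedSpace (E × F) Y]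
  {π : Y → M} [hπ : IsFibredManifold E F π]

/-- The local section which is affine in an adapted chart, with a given jet. -/
def AdaptedChart.affine (a : AdaptedChart E F π) (ζ : JetBundle E F π) : M → Y :=
  a.family (fun q => ((JetBundle.adapted a).e ζ).2.1 +
    ((JetBundle.adapted a).e ζ).2.2 (q.2 - a.c (π ζ.pt))) 0

/-- The explicit form of the representative matters: sections of two bundles over `Q` with matching
jets can then be compared pointwise. The second conjunct ensures that the affine expression gives
the actual coordinates of the section near the point. -/
theorem AdaptedChart.affine_spec (a : AdaptedChart E F π) {ζ : JetBundle E F π}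
    (ha : ζ.pt ∈ a.e.source) :
    IsJetAt ζ (a.affine ζ) (π ζ.pt) ∧ ∀ᶠ x' in 𝓝 (π ζ.pt),
      (a.c x', ((JetBundle.adapted a).e ζ).2.1 +
        ((JetBundle.adapted a).e ζ).2.2 (a.c x' - a.c (π ζ.pt))) ∈ a.e.target := by
  set x := π ζ.pt
  have hx : x ∈ a.c.source := a.map_source _ ha
  set f := ((JetBundle.adapted a).e ζ).2.1 with hf
  set A := ((JetBundle.adapted a).e ζ).2.2 with hA
  let g : ℝ × E → F := fun q => f + A (q.2 - a.c x)
  have hg : ContDiff ℝ ∞ g := by fun_prop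
  have hgx : (a.c x, g (0, a.c x)) ∈ a.e.target := by
    have h1 : g (0, a.c x) = (a.e ζ.pt).2 := by
      simp only [g, sub_self, map_zero, add_zero, hf]
      rw [JetBundle.adapted_apply ha]
    rw [h1, ← a.fst_eq _ ha]
    exact a.e.map_source ha
  have h1 : Tendsto (fun x' : M => ((0 : ℝ), x')) (𝓝 x) (𝓝 (0, x)) :=
    (by fun_prop : Continuous fun x' : M => ((0 : ℝ), x')).continuousAt
  refine ⟨?_, (h1.eventually (a.eventually_family_target hg hx hgx)).mono fun x' h => h.2⟩
  have hs := (a.isVariationAt_family hg hx hgx).isSectionAt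
  have hmem := a.family_mem_source hg hx hgx
  obtain ⟨ζ', hζ'⟩ := hs.exists_isJetAt
  have h2 : a.rep (a.family g 0) =ᶠ[𝓝 (a.c x)] fun u => f + A (u - a.c x) := by
    have h1 : Tendsto (fun u : E => ((0 : ℝ), u)) (𝓝 (a.c x)) (𝓝 (0, a.c x)) :=
      (by fun_prop : Continuous fun u : E => ((0 : ℝ), u)).continuousAt
    exact h1.eventually (a.rep_family hg hx hgx)
  have h3 : HasFDerivAt (fun u => f + A (u - a.c x)) A (a.c x) :=
    (A.hasFDerivAt.comp (a.c x) ((hasFDerivAt_id _).sub_const _)).const_add f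
  have h4 := hζ'.adapted_apply hmem
  have h5 : a.rep (a.family g 0) (a.c x) = f := by simpa using h2.self_of_nhds
  rw [h5, h2.fderiv_eq, h3.fderiv] at h4
  have h6 : ζ' = ζ := by
    refine (JetBundle.adapted a).e.injOn ?_ (JetBundle.mem_adapted.2 ha) ?_
    · rw [JetBundle.mem_adapted, hζ'.2.1]; exact hmem
    · rw [h4]
      exact Prod.ext ((JetBundle.adapted a).fst_eq ζ ha).symm rfl
  rw [h6] at hζ'
  exact hζ'

end AffineSections

/-! ### The canonical map `Ψ` and its intrinsic characterization -/

section Pairing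

variable {E F : Type*} [NormedAddCommGroup E] [NormedSpace ℝ E]
  [NormedAddCommGroup F] [NormedSpace ℝ F]
  {M Q : Type*} [TopologicalSpace M] [ChartedSpace E M]
  [TopologicalSpace Q] [ChartedSpace (E × F) Q]
  {π : Q → M} [hπ : IsFibredManifold E F π] {m : ℕ}

theorem CovBundle.rep_pt {p : M → PhaseBundle E F π m} {a : AdaptedChart E F π} {x : M}
    (hp : IsSectionAt E (CovFibre E F m) (CovBundle.base E F π m) p x) (ha : (p x).pt ∈ a.e.source) :
    a.rep (fun x' => (p x').pt) =ᶠ[𝓝 (a.c x)] fun u => ((CovBundle.adapted a).rep p u).1 := by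
  have hx : x ∈ a.c.source := (CovBundle.adapted a).mem_c_source hp.apply_eq ha
  have h1 : Tendsto a.c.symm (𝓝 (a.c x)) (𝓝 x) := by
    have := a.c.symm.continuousAt (a.c.map_source hx)
    rwa [ContinuousAt, a.c.left_inv hx] at this
  filter_upwards [h1.eventually (hp.eventually_mem (a := CovBundle.adapted a) ha)] with u hu
  change (a.e (p (a.c.symm u)).pt).2 = ((CovBundle.adapted a).e (p (a.c.symm u))).2.1
  rw [CovBundle.adapted_apply hu]

theorem VertBundle.rep_pt {v : M → VertBundle E F π} {a : AdaptedChart E F π} {x : M}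
    (hv : IsSectionAt E (F × F) (VertBundle.base E F π) v x) (ha : (v x).pt ∈ a.e.source) :
    a.rep (fun x' => (v x').pt) =ᶠ[𝓝 (a.c x)] fun u => ((VertBundle.adapted a).rep v u).1 := by
  have hx : x ∈ a.c.source := (VertBundle.adapted a).mem_c_source hv.apply_eq ha
  have h1 : Tendsto a.c.symm (𝓝 (a.c x)) (𝓝 x) := by
    have := a.c.symm.continuousAt (a.c.map_source hx)
    rwa [ContinuousAt, a.c.left_inv hx] at this
  filter_upwards [h1.eventually (hv.eventually_mem (a := VertBundle.adapted a) ha)] with u hu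
  change (a.e (v (a.c.symm u)).pt).2 = ((VertBundle.adapted a).e (v (a.c.symm u))).2.1
  rw [VertBundle.adapted_apply hu]

theorem IsJetAt.jetProj {ζ : JetPhaseBundle E F π m} {p : M → PhaseBundle E F π m} {x : M}
    (h : IsJetAt ζ p x) : IsJetAt (jetProj E F π m ζ) (fun x' => (p x').pt) x := by
  obtain ⟨h1, h2, h3⟩ := h
  have hpt := (CovBundle.liftData E F π m).contMDiff_pt
  refine ⟨?_, congrArg CovBundle.pt h2, ?_⟩
  · filter_upwards [h1] with x' hx'
    exact ⟨hx'.1, (hpt _).comp x' hx'.2⟩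
  · change (tmap (E × CovFibre E F m) (E × F)
      (CovBundle.pt : PhaseBundle E F π m → Q) ζ.pt).comp ζ.lin = _
    rw [h3, h2]
    exact (tmap_comp x (PhaseBundle.mdifferentiableAt_pt (p x))
      (h1.contMDiffAt.mdifferentiableAt (by simp))).symm

/-- The coordinates of `J¹Π`. -/
theorem adapted_jetProj {ζ : JetPhaseBundle E F π m} {a : AdaptedChart E F π}
    (ha : ζ.pt.pt ∈ a.e.source) :
    (JetBundle.adapted a).e (jetProj E F π m ζ) =
      (((JetBundle.adapted (CovBundle.adapted a)).e ζ).1,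
        fstJet E F _ ((JetBundle.adapted (CovBundle.adapted a)).e ζ).2) := by
  obtain ⟨h, -⟩ := (CovBundle.adapted a).affine_spec (CovBundle.mem_adapted.2 ha)
  set x := CovBundle.base E F π m ζ.pt
  set p := (CovBundle.adapted a).affine ζ
  have hpx : p x ∈ (CovBundle.adapted a).e.source := by rw [← h.2.1]; exact ha
  rw [h.jetProj.adapted_apply hpx, h.adapted_apply hpx]
  have h1 := CovBundle.rep_pt h.1 hpx
  have h2 : HasFDerivAt ((CovBundle.adapted a).rep p) _ ((CovBundle.adapted a).c x) :=
    ((h.1.contDiffAt_rep hpx).differentiableAt (by simp)).hasFDerivAt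
  rw [h1.fderiv_eq, h1.self_of_nhds]
  exact Prod.ext rfl (Prod.ext rfl h2.fst.fderiv)

/-- The coordinate expression of the projection `J¹VQ → J¹Q`. -/
theorem adapted_pt_interchange {ξ : JetBundle E (F × F) (VertBundle.base E F π)}
    {a : AdaptedChart E F π} (ha : ξ.pt.pt ∈ a.e.source) :
    (JetBundle.adapted a).e (interchange E F π ξ).pt =
      (((JetBundle.adapted (VertBundle.adapted a)).e ξ).1,
        fstJet E F F ((JetBundle.adapted (VertBundle.adapted a)).e ξ).2) := by
  have h1 := adapted_interchange ha
  have h2 : (interchange E F π ξ).pt ∈ (JetBundle.adapted a).e.source := by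
    rw [JetBundle.mem_adapted, pt_interchange]; exact ha
  rw [VertBundle.adapted_apply h2, interchangeCoord_apply] at h1
  exact Prod.ext (congrArg (·.1) h1) (congrArg (·.2.1) h1)

/-- The point of `J¹Q` under `κ(j¹v)` has as coordinates the value and derivative of the first
component of the representative of `v`, which represents the underlying section of `Q`. -/
theorem IsJetAt.pt_interchange_eq {ξ : JetBundle E (F × F) (VertBundle.base E F π)}
    {v : M → VertBundle E F π} {x : M} (h : IsJetAt ξ v x) {s : M → Q}
    {ζ : JetBundle E F π} (hζ : IsJetAt ζ s x) (hs : ∀ᶠ x' in 𝓝 x, (v x').pt = s x') :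
    (interchange E F π ξ).pt = ζ := by
  have ha := AdaptedChart.mem_at (E := E) (F := F) (π := π) (v x).pt
  have ha' : ξ.pt.pt ∈ (AdaptedChart.at E F π (v x).pt).e.source := by rw [h.2.1]; exact ha
  have hs' := hζ.congr (hs.mono fun x' h => h.symm)
  refine (JetBundle.adapted (AdaptedChart.at E F π (v x).pt)).e.injOn ?_ ?_ ?_
  · rw [JetBundle.mem_adapted, pt_interchange]; exact ha'
  · rw [JetBundle.mem_adapted, hs'.2.1]; exact ha
  · rw [adapted_pt_interchange ha', hs'.adapted_apply ha,
      h.adapted_apply (VertBundle.mem_adapted.2 ha)]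
    have h1 := VertBundle.rep_pt h.1 ha
    have h2 : HasFDerivAt ((VertBundle.adapted (AdaptedChart.at E F π (v x).pt)).rep v) _
        ((AdaptedChart.at E F π (v x).pt).c x) :=
      ((h.1.contDiffAt_rep (a := VertBundle.adapted _) ha).differentiableAt (by simp)).hasFDerivAt
    rw [h1.fderiv_eq, h1.self_of_nhds]
    exact Prod.ext rfl (Prod.ext rfl h2.fst.fderiv.symm)

/-- Take the sections that are affine in charts induced by one and the same chart of `Q`. Their
projections to `Q` are affine with the same value and slope by `h`, so they coincide near the point.
-/
theorem exists_pairing_representatives {ζ : JetPhaseBundle E F π m}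
    {ξ : JetBundle E (F × F) (VertBundle.base E F π)}
    (h : (interchange E F π ξ).pt = jetProj E F π m ζ) :
    ∃ (x : M) (p : M → PhaseBundle E F π m) (v : M → VertBundle E F π),
      IsJetAt ζ p x ∧ IsJetAt ξ v x ∧ ∀ᶠ x' in 𝓝 x, (v x').pt = (p x').pt := by
  let a := AdaptedChart.at E F π ζ.pt.pt
  have ha : ζ.pt.pt ∈ a.e.source := AdaptedChart.mem_at ζ.pt.pt
  have hpt : ξ.pt.pt = ζ.pt.pt := by rw [← pt_interchange, h]; rfl
  have ha' : ξ.pt.pt ∈ a.e.source := by rw [hpt]; exact ha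
  obtain ⟨h1, h2⟩ := (CovBundle.adapted a).affine_spec (CovBundle.mem_adapted.2 ha)
  obtain ⟨h3, h4⟩ := (VertBundle.adapted a).affine_spec (VertBundle.mem_adapted.2 ha')
  have hx : VertBundle.base E F π ξ.pt = CovBundle.base E F π m ζ.pt := congrArg π hpt
  rw [hx] at h3 h4
  refine ⟨_, _, _, h1, h3, ?_⟩
  have h5 := adapted_pt_interchange ha'
  rw [h, adapted_jetProj ha] at h5
  have h6 := congrArg (·.2.1) h5
  have h7 := congrArg (·.2.2) h5
  simp only [fstJet_apply] at h6 h7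
  filter_upwards [h2, h4] with x' h8 h9
  have h10 := CovBundle.pt_adapted_symm (CovBundle.mem_adapted_target.1 h8)
  have h11 := VertBundle.pt_adapted_symm (VertBundle.mem_adapted_target.1 h9)
  rw [← hx] at h11
  refine h11.trans (Eq.trans ?_ h10.symm)
  rw [hx]
  refine congrArg a.e.symm (Prod.ext rfl ?_)
  change _ + _ = _ + _
  rw [← h6]
  exact congrArg _ (DFunLike.congr_fun h7 _).symm

/-- The differential of the pairing of a momentum with a vertical vector, in coordinates. -/
theorem extDerivAt_pairing {x : M} {p : M → PhaseBundle E F π m} {v : M → VertBundle E F π}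
    {ζ : JetPhaseBundle E F π m} {ξ : JetBundle E (F × F) (VertBundle.base E F π)}
    (hζ : IsJetAt ζ p x) (hξ : IsJetAt ξ v x) (hpv : ∀ᶠ x' in 𝓝 x, (v x').pt = (p x').pt)
    {a : AdaptedChart E F π} (ha : (p x).pt ∈ a.e.source) :
    extDerivAt (fun x' => (p x').app (v x').vec) x =
      AltForm.pullback (m + 1) (tmap E E a.c x) (momentumMap E F m
        (sndJet E F _ ((JetBundle.adapted (CovBundle.adapted a)).e ζ).2)
        (sndJet E F F ((JetBundle.adapted (VertBundle.adapted a)).e ξ).2)) := by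
  have := hπ.base_isManifold
  have hav : (v x).pt ∈ a.e.source := by rw [hpv.self_of_nhds]; exact ha
  have hx : x ∈ a.c.source := (CovBundle.adapted a).mem_c_source hζ.1.apply_eq ha
  have hP : HasFDerivAt ((CovBundle.adapted a).rep p) _ (a.c x) :=
    ((hζ.1.contDiffAt_rep (a := CovBundle.adapted a) ha).differentiableAt (by simp)).hasFDerivAt
  have hV : HasFDerivAt ((VertBundle.adapted a).rep v) _ (a.c x) :=
    ((hξ.1.contDiffAt_rep (a := VertBundle.adapted a) hav).differentiableAt (by simp)).hasFDerivAt
  have h1 : ∀ᶠ x' in 𝓝 x, (p x').app (v x').vec = AltForm.pullback m (tmap E E a.c x')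
      (((CovBundle.adapted a).rep p (a.c x')).2 ((VertBundle.adapted a).rep v (a.c x')).2) := by
    filter_upwards [hζ.1, hζ.1.eventually_mem (a := CovBundle.adapted a) ha, hpv,
      a.c.open_source.mem_nhds hx] with x' h2 h3 h4 h5
    have h6 : (v x').vec ∈ vert E F π (p x').pt := by rw [← h4]; exact (v x').vec_mem
    have h7 : (v x').pt ∈ a.e.source := by rw [h4]; exact h3
    have h8 : (CovBundle.adapted a).rep p (a.c x') = ((CovBundle.adapted a).e (p x')).2 :=
      (CovBundle.adapted a).rep_apply h5
    have h9 : π (p x').pt = x' := h2.1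
    rw [CovBundle.app_eq h3 h6, VertBundle.rep_apply_snd h5 h7, h8, h4, h9]
  rw [extDerivAt_eq a.c_mem hx (hP.snd.differentiableAt.clm_apply hV.snd.differentiableAt) h1,
    wedge_fderiv hP.snd.differentiableAt hV.snd.differentiableAt, hP.snd.fderiv, hV.snd.fderiv,
    hζ.adapted_apply (CovBundle.mem_adapted.2 ha), hξ.adapted_apply (VertBundle.mem_adapted.2 hav)]
  rfl

/-- The coordinate expression of `Ψ`. -/
def momentumCoord (E F : Type*) [NormedAddCommGroup E] [NormedSpace ℝ E]
    [NormedAddCommGroup F] [NormedSpace ℝ F] (m : ℕ) :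
    (E × JetFibre E (CovFibre E F m)) →L[ℝ] E × CovFibre E (JetFibre E F) (m + 1) :=
  ContinuousLinearMap.prodMap (ContinuousLinearMap.id ℝ E)
    ((fstJet E F (F →L[ℝ] AltForm E m)).prod
      ((momentumMap E F m).comp (sndJet E F (F →L[ℝ] AltForm E m))))

theorem momentumCoord_apply (q : E × JetFibre E (CovFibre E F m)) :
    momentumCoord E F m q = (q.1, (fstJet E F _ q.2, momentumMap E F m (sndJet E F _ q.2))) := rfl

variable (E F π m) in
/-- The canonical map `Ψ : J¹P → V*Q^I ⊗ Λⁿ M`. -/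
def jetMomentum (ζ : JetPhaseBundle E F π m) : InfCovBundle E F π (m + 1) :=
  (CovBundle.adapted (JetBundle.adapted (AdaptedChart.at E F π ζ.pt.pt))).e.symm
    (momentumCoord E F m
      ((JetBundle.adapted (CovBundle.adapted (AdaptedChart.at E F π ζ.pt.pt))).e ζ))

/-- Both targets constrain only `(x, φ)`, which `momentumCoord` preserves; the remaining fibre
coordinates are unrestricted. -/
theorem momentumCoord_mem_target {a : AdaptedChart E F π}
    {q : E × JetFibre E (CovFibre E F m)} :
    momentumCoord E F m q ∈ (CovBundle.adapted (k := m + 1) (JetBundle.adapted a)).e.target ↔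
      q ∈ (JetBundle.adapted (CovBundle.adapted (k := m) a)).e.target := Iff.rfl

theorem app_interchange {η : InfCovBundle E F π (m + 1)}
    {ξ : JetBundle E (F × F) (VertBundle.base E F π)} {a : AdaptedChart E F π}
    (ha : ξ.pt.pt ∈ a.e.source) (hη : (interchange E F π ξ).pt = η.pt) :
    η.app (interchange E F π ξ).vec =
      AltForm.pullback (m + 1) (tmap E E a.c (π ξ.pt.pt))
        (((CovBundle.adapted (JetBundle.adapted a)).e η).2.2
          (sndJet E F F ((JetBundle.adapted (VertBundle.adapted a)).e ξ).2)) := by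
  have h1 := adapted_interchange ha
  have h2 : (interchange E F π ξ).pt ∈ (JetBundle.adapted a).e.source := by
    rw [JetBundle.mem_adapted, pt_interchange]; exact ha
  rw [VertBundle.adapted_apply h2, interchangeCoord_apply] at h1
  have h3 := congrArg (·.2.2) h1
  simp only at h3
  have h4 : (interchange E F π ξ).vec ∈
      vert E (JetFibre E F) (JetBundle.base E F π) η.pt := by
    rw [← hη]; exact (interchange E F π ξ).vec_mem
  have h5 : η.pt ∈ (JetBundle.adapted a).e.source := by rw [← hη]; exact h2
  rw [CovBundle.app_eq h5 h4, ← hη, h3]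
  have h6 : JetBundle.base E F π (interchange E F π ξ).pt = π ξ.pt.pt :=
    congrArg π (pt_interchange ξ)
  rw [h6]
  rfl

/-- The defining property of the value `η = Ψ(ζ)`. -/
def IsMomentumOf (ζ : JetPhaseBundle E F π m) (η : InfCovBundle E F π (m + 1)) : Prop :=
  η.pt = jetProj E F π m ζ ∧ ∀ (x : M) (p : M → PhaseBundle E F π m) (v : M → VertBundle E F π)
    (ξ : JetBundle E (F × F) (VertBundle.base E F π)),
    IsJetAt ζ p x → IsJetAt ξ v x → (∀ᶠ x' in 𝓝 x, (v x').pt = (p x').pt) →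
    η.app (interchange E F π ξ).vec = extDerivAt (fun x' => (p x').app (v x').vec) x

/-- Since `κ` is onto, every vertical vector at `η.pt` is `κ(ξ)` for some `ξ`, and `ζ`, `ξ` have
representatives over a common section of `Q`. -/
theorem IsMomentumOf.unique {ζ : JetPhaseBundle E F π m} {η η' : InfCovBundle E F π (m + 1)}
    (h : IsMomentumOf ζ η) (h' : IsMomentumOf ζ η') : η = η' := by
  refine CovBundle.ext_app (h.1.trans h'.1.symm) fun X hX => ?_
  let w : VertBundle E (JetFibre E F) (JetBundle.base E F π) := ⟨η.pt, X, hX⟩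
  have hw : interchange E F π (interchangeInv E F π w) = w := interchange_interchangeInv w
  obtain ⟨x, p, v, h1, h2, h3⟩ := exists_pairing_representatives (ζ := ζ)
    (ξ := interchangeInv E F π w) (by rw [hw]; exact h.1)
  have h4 := h.2 x p v _ h1 h2 h3
  have h5 := h'.2 x p v _ h1 h2 h3
  rw [hw] at h4 h5
  exact h4.trans h5.symm

/-- The coordinate formula in a single chart already implies the chart-free property. Combined with
uniqueness, this gives the formula in every chart. -/
theorem isMomentumOf_of_adapted {ζ : JetPhaseBundle E F π m} {η : InfCovBundle E F π (m + 1)}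
    {a : AdaptedChart E F π} (ha : ζ.pt.pt ∈ a.e.source) (hη : η.pt.pt ∈ a.e.source)
    (h : (CovBundle.adapted (JetBundle.adapted a)).e η =
      momentumCoord E F m ((JetBundle.adapted (CovBundle.adapted a)).e ζ)) :
    IsMomentumOf ζ η := by
  have hpt : η.pt = jetProj E F π m ζ := by
    refine (JetBundle.adapted a).e.injOn hη ha ?_
    rw [adapted_jetProj ha]
    rw [CovBundle.adapted_apply (JetBundle.mem_adapted.2 hη), momentumCoord_apply] at h
    exact Prod.ext (congrArg (·.1) h) (congrArg (·.2.1) h)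
  refine ⟨hpt, fun x p v ξ h1 h2 h3 => ?_⟩
  have h4 := h2.pt_interchange_eq h1.jetProj h3
  have h5 : ξ.pt.pt ∈ a.e.source := by
    rw [← pt_interchange, h4]; exact ha
  have h6 : (p x).pt ∈ a.e.source := by rw [← h1.2.1]; exact ha
  have h7 : π ξ.pt.pt = x := by rw [h2.2.1]; exact h2.1.apply_eq
  rw [app_interchange h5 (h4.trans hpt.symm), extDerivAt_pairing h1 h2 h3 h6, h7, h]
  rfl

theorem isMomentumOf_jetMomentum (ζ : JetPhaseBundle E F π m) :
    IsMomentumOf ζ (jetMomentum E F π m ζ) := by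
  let a := AdaptedChart.at E F π ζ.pt.pt
  have ha : ζ.pt.pt ∈ a.e.source := AdaptedChart.mem_at ζ.pt.pt
  have htgt : momentumCoord E F m ((JetBundle.adapted (CovBundle.adapted a)).e ζ) ∈
      (CovBundle.adapted (JetBundle.adapted a)).e.target :=
    momentumCoord_mem_target.2 ((JetBundle.adapted (CovBundle.adapted a)).e.map_source ha)
  exact isMomentumOf_of_adapted ha
    ((CovBundle.adapted (JetBundle.adapted a)).e.map_target htgt)
    ((CovBundle.adapted (JetBundle.adapted a)).e.right_inv htgt)

/-- The map `Ψ` in any adapted chart. -/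
theorem adapted_jetMomentum {ζ : JetPhaseBundle E F π m} {a : AdaptedChart E F π}
    (ha : ζ.pt.pt ∈ a.e.source) :
    (CovBundle.adapted (JetBundle.adapted a)).e (jetMomentum E F π m ζ) =
      momentumCoord E F m ((JetBundle.adapted (CovBundle.adapted a)).e ζ) := by
  have htgt : momentumCoord E F m ((JetBundle.adapted (CovBundle.adapted a)).e ζ) ∈
      (CovBundle.adapted (JetBundle.adapted a)).e.target :=
    momentumCoord_mem_target.2 ((JetBundle.adapted (CovBundle.adapted a)).e.map_source ha)
  have h1 := (CovBundle.adapted (JetBundle.adapted a)).e.right_inv htgt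
  have h2 : IsMomentumOf ζ ((CovBundle.adapted (JetBundle.adapted a)).e.symm
      (momentumCoord E F m ((JetBundle.adapted (CovBundle.adapted a)).e ζ))) :=
    isMomentumOf_of_adapted ha ((CovBundle.adapted (JetBundle.adapted a)).e.map_target htgt) h1
  rw [(isMomentumOf_jetMomentum ζ).unique h2, h1]

theorem pt_jetMomentum (ζ : JetPhaseBundle E F π m) :
    (jetMomentum E F π m ζ).pt = jetProj E F π m ζ := (isMomentumOf_jetMomentum ζ).1

variable (E F π m) in
theorem isJetPairing_jetMomentum :
    IsJetPairing (interchange E F π) (jetMomentum E F π m) where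
  pt_eq := pt_jetMomentum
  app_eq x p v ζ ξ := (isMomentumOf_jetMomentum ζ).2 x p v ξ

theorem IsJetPairing.eq_jetMomentum {Ψ : JetPhaseBundle E F π m → InfCovBundle E F π (m + 1)}
    (hΨ : IsJetPairing (interchange E F π) Ψ) : Ψ = jetMomentum E F π m := by
  funext ζ
  exact IsMomentumOf.unique ⟨hΨ.pt_eq ζ, fun x p v ξ => hΨ.app_eq x p v ζ ξ⟩
    (isMomentumOf_jetMomentum ζ)

end Pairing

/-! ### Transport of smooth structures along homeomorphisms -/

section Transport

variable {V : Type*} [NormedAddCommGroup V] [NormedSpace ℝ V]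
  {X Z : Type*} [TopologicalSpace X] [ChartedSpace V X] [TopologicalSpace Z]

/-- The manifold structure transported along a homeomorphism. -/
abbrev Homeomorph.pullbackChartedSpace (Φ : Z ≃ₜ X) : ChartedSpace V Z where
  atlas := (fun e => Φ.toOpenPartialHomeomorph.trans e) '' atlas V X
  chartAt z := Φ.toOpenPartialHomeomorph.trans (chartAt V (Φ z))
  mem_chart_source z := by simp
  chart_mem_atlas z := mem_image_of_mem _ (chart_mem_atlas V (Φ z))

variable [IsManifold 𝓘(ℝ, V) ∞ X]

theorem Homeomorph.isManifold_pullback (Φ : Z ≃ₜ X) :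
    letI := Φ.pullbackChartedSpace (V := V)
    IsManifold 𝓘(ℝ, V) ∞ Z := by
  let := Φ.pullbackChartedSpace (V := V)
  apply isManifold_of_contDiffOn
  rintro _ _ ⟨e, he, rfl⟩ ⟨e', he', rfl⟩
  have h := contDiffOn_trans (IsManifold.subset_maximalAtlas (I := 𝓘(ℝ, V)) (n := ∞) he)
    (IsManifold.subset_maximalAtlas (I := 𝓘(ℝ, V)) (n := ∞) he')
  refine (h.mono fun q hq => ?_).congr fun q hq => ?_
  · simpa using hq
  · simp

/-- The transported structure makes the homeomorphism a diffeomorphism. -/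
def Homeomorph.pullbackDiffeomorph (Φ : Z ≃ₜ X) :
    letI := Φ.pullbackChartedSpace (V := V)
    Diffeomorph 𝓘(ℝ, V) 𝓘(ℝ, V) Z X ∞ :=
  letI := Φ.pullbackChartedSpace (V := V)
  haveI := Φ.isManifold_pullback (V := V)
  { Φ.toEquiv with
    contMDiff_toFun := fun z =>
      contMDiffAt_of_chart_linear (IsManifold.chart_mem_maximalAtlas z)
        (IsManifold.chart_mem_maximalAtlas (Φ z)) (L := ContinuousLinearMap.id ℝ V)
        (fun y hy => by
          have h : y ∈ (Φ.toOpenPartialHomeomorph.trans (chartAt V (Φ z))).source := hy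
          exact ⟨by simpa using h, rfl⟩) (mem_chart_source V z)
    contMDiff_invFun := fun η =>
      contMDiffAt_of_chart_linear (IsManifold.chart_mem_maximalAtlas η)
        (IsManifold.chart_mem_maximalAtlas (Φ.symm η)) (L := ContinuousLinearMap.id ℝ V)
        (fun y hy => by
          constructor
          · change Φ.symm y ∈ (Φ.toOpenPartialHomeomorph.trans (chartAt V (Φ (Φ.symm η)))).source
            simpa using hy
          · change chartAt V (Φ (Φ.symm η)) (Φ (Φ.symm y)) = chartAt V η y
            simp) (mem_chart_source V η) }

end Transport

/-! ### Submersion, kernel, leaves and linearity of `Ψ` -/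

section MomentumProperties

/-- Jets of pairs are pairs of jets, so configuration and momentum parts can be prescribed
independently. -/
theorem exists_jet_pair {E A B : Type*} [NormedAddCommGroup E] [NormedSpace ℝ E]
    [NormedAddCommGroup A] [NormedSpace ℝ A] [NormedAddCommGroup B] [NormedSpace ℝ B]
    (u : A × (E →L[ℝ] A)) (q : B × (E →L[ℝ] B)) :
    ∃ z, fstJet E A B z = u ∧ sndJet E A B z = q := by
  refine ⟨((u.1, q.1), u.2.prod q.2), ?_, ?_⟩
  · rfl
  · rfl

variable {E F : Type*} [NormedAddCommGroup E] [NormedSpace ℝ E]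
  [NormedAddCommGroup F] [NormedSpace ℝ F]
  {M Q : Type*} [TopologicalSpace M] [ChartedSpace E M]
  [TopologicalSpace Q] [ChartedSpace (E × F) Q]
  {π : Q → M} [hπ : IsFibredManifold E F π] {m : ℕ}

theorem jetMomentum_mem_source {a : AdaptedChart E F π} :
    ∀ ζ ∈ (JetBundle.adapted (CovBundle.adapted (k := m) a)).e.source,
      jetMomentum E F π m ζ ∈ (CovBundle.adapted (k := m + 1) (JetBundle.adapted a)).e.source ∧
      (CovBundle.adapted (k := m + 1) (JetBundle.adapted a)).e (jetMomentum E F π m ζ) =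
        momentumCoord E F m ((JetBundle.adapted (CovBundle.adapted a)).e ζ) := fun ζ hζ =>
  ⟨by rw [CovBundle.mem_adapted, pt_jetMomentum]; exact hζ, adapted_jetMomentum hζ⟩

theorem contMDiff_jetMomentum : ContMDiff 𝓘(ℝ, E × JetFibre E (CovFibre E F m))
    𝓘(ℝ, E × CovFibre E (JetFibre E F) (m + 1)) ∞ (jetMomentum E F π m) := fun ζ =>
  contMDiffAt_of_chart_linear (AdaptedChart.e_mem _) (AdaptedChart.e_mem _)
    jetMomentum_mem_source (AdaptedChart.mem_at (E := E) (F := F) (π := π) ζ.pt.pt)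

theorem tmap_jetMomentum {ζ : JetPhaseBundle E F π m} {a : AdaptedChart E F π}
    (ha : ζ.pt.pt ∈ a.e.source) (X : E × JetFibre E (CovFibre E F m)) :
    tmap (E × CovFibre E (JetFibre E F) (m + 1)) (E × CovFibre E (JetFibre E F) (m + 1))
      (CovBundle.adapted (JetBundle.adapted a)).e (jetMomentum E F π m ζ)
      (tmap (E × JetFibre E (CovFibre E F m)) (E × CovFibre E (JetFibre E F) (m + 1))
        (jetMomentum E F π m) ζ X) =
    momentumCoord E F m
      (tmap (E × JetFibre E (CovFibre E F m)) (E × JetFibre E (CovFibre E F m))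
        (JetBundle.adapted (CovBundle.adapted a)).e ζ X) :=
  tmap_of_chart_linear (AdaptedChart.e_mem _) (AdaptedChart.e_mem _)
    jetMomentum_mem_source ha X

section FiniteDimensional

variable [FiniteDimensional ℝ E] [FiniteDimensional ℝ F]

theorem momentumCoord_surjective (hn : Module.finrank ℝ E = m + 1) :
    Function.Surjective (momentumCoord E F m) := by
  rintro ⟨x, u, η⟩
  obtain ⟨pB, rfl⟩ := momentumMap_surjective (F := F) hn η
  obtain ⟨z, rfl, rfl⟩ := exists_jet_pair u pB
  exact ⟨(x, z), rfl⟩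

theorem jetMomentum_surjective (hn : Module.finrank ℝ E = m + 1) :
    Function.Surjective (jetMomentum E F π m) := by
  intro η
  let a := AdaptedChart.at E F π η.pt.pt
  have ha : η ∈ (CovBundle.adapted (k := m + 1) (JetBundle.adapted a)).e.source :=
    AdaptedChart.mem_at (E := E) (F := F) (π := π) η.pt.pt
  obtain ⟨q, hq⟩ := momentumCoord_surjective (F := F) hn
    ((CovBundle.adapted (JetBundle.adapted a)).e η)
  have hqt : q ∈ (JetBundle.adapted (CovBundle.adapted (k := m) a)).e.target := by
    rw [← momentumCoord_mem_target, hq]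
    exact (CovBundle.adapted (JetBundle.adapted a)).e.map_source ha
  let ζ := (JetBundle.adapted (CovBundle.adapted (k := m) a)).e.symm q
  have h := jetMomentum_mem_source ζ
    ((JetBundle.adapted (CovBundle.adapted (k := m) a)).e.map_target hqt)
  refine ⟨ζ, (CovBundle.adapted (JetBundle.adapted a)).e.injOn h.1 ha ?_⟩
  rw [h.2, (JetBundle.adapted (CovBundle.adapted (k := m) a)).e.right_inv hqt, hq]

theorem isSmoothSubmersion_jetMomentum (hn : Module.finrank ℝ E = m + 1) :
    IsSmoothSubmersion (E × JetFibre E (CovFibre E F m))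
      (E × CovFibre E (JetFibre E F) (m + 1)) (jetMomentum E F π m) := by
  refine ⟨contMDiff_jetMomentum, fun ζ X => ?_⟩
  let a := AdaptedChart.at E F π ζ.pt.pt
  have ha : ζ ∈ (JetBundle.adapted (CovBundle.adapted (k := m) a)).e.source :=
    AdaptedChart.mem_at (E := E) (F := F) (π := π) ζ.pt.pt
  obtain ⟨q, hq⟩ := momentumCoord_surjective (F := F) hn
    (tmap (E × CovFibre E (JetFibre E F) (m + 1)) (E × CovFibre E (JetFibre E F) (m + 1))
      (CovBundle.adapted (JetBundle.adapted a)).e (jetMomentum E F π m ζ) X)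
  refine ⟨((JetBundle.adapted (CovBundle.adapted a)).dE ha).symm q, ?_⟩
  refine (CovBundle.adapted (JetBundle.adapted a)).ext_tmap_e (jetMomentum_mem_source ζ ha).1 ?_
  rw [tmap_jetMomentum ha, ← AdaptedChart.dE_apply _ ha,
    ContinuousLinearEquiv.apply_symm_apply, hq]

/-- By the open mapping theorem the surjective linear coordinate expression is open, and openness is
local. -/
theorem isOpenMap_jetMomentum (hn : Module.finrank ℝ E = m + 1) :
    IsOpenMap (jetMomentum E F π m) := by
  rw [isOpenMap_iff_nhds_le]
  intro ζ U hU
  have hL : IsOpenMap (momentumCoord E F m) :=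
    (momentumCoord E F m).isOpenMap (momentumCoord_surjective hn)
  let a := AdaptedChart.at E F π ζ.pt.pt
  have ha : ζ ∈ (JetBundle.adapted (CovBundle.adapted (k := m) a)).e.source :=
    AdaptedChart.mem_at (E := E) (F := F) (π := π) ζ.pt.pt
  have h := image_mem_nhds_of_chart_linear jetMomentum_mem_source ha hL (mem_map.1 hU)
  exact mem_of_superset h (image_preimage_subset _ _)

/-- Testing against vectors `z'` with zero configuration part and arbitrary momentum part forces the
configuration part of `z` to vanish, by `momentumMap_separating`. Testing then against arbitrary
configuration parts leaves `momentumMap` of the momentum part of `z`. -/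
theorem antisymmetrize_jetPairing_degenerate (hn : Module.finrank ℝ E = m + 1)
    {z : JetFibre E (CovFibre E F m)} :
    (∀ z', jetPairing E F m z z' - jetPairing E F m z' z = 0) ↔
      fstJet E F _ z = 0 ∧ momentumMap E F m (sndJet E F _ z) = 0 := by
  simp only [jetPairing_apply]
  constructor
  · intro h
    have h1 : fstJet E F _ z = 0 := by
      refine momentumMap_separating hn fun pB => ?_
      obtain ⟨z', h1, h2⟩ := exists_jet_pair (E := E) (0 : F × (E →L[ℝ] F)) pB
      have h3 := h z'
      rw [h1, h2, map_zero, zero_sub, neg_eq_zero] at h3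
      exact h3
    refine ⟨h1, ContinuousLinearMap.ext fun u => ?_⟩
    obtain ⟨z', h2, -⟩ := exists_jet_pair (E := E) u
      (0 : (F →L[ℝ] AltForm E m) × (E →L[ℝ] F →L[ℝ] AltForm E m))
    have h3 := h z'
    rw [h1, h2, map_zero, sub_zero] at h3
    exact h3
  · rintro ⟨h1, h2⟩ z'
    rw [h1, h2, map_zero, sub_zero]
    rfl

/-- In the chart the kernel of `momentumCoord` consists of the vectors with zero base component that
satisfy the two conditions of `antisymmetrize_jetPairing_degenerate`. The base chart contributes
only an invertible pull-back of forms. -/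
theorem ker_tmap_jetMomentum (hn : Module.finrank ℝ E = m + 1) (ζ : JetPhaseBundle E F π m) :
    {X | tmap (E × JetFibre E (CovFibre E F m)) (E × CovFibre E (JetFibre E F) (m + 1))
      (jetMomentum E F π m) ζ X = 0} = (jetTwoForm E F π m).degeneracy ζ := by
  let a := AdaptedChart.at E F π ζ.pt.pt
  have ha : ζ ∈ (JetBundle.adapted (CovBundle.adapted (k := m) a)).e.source :=
    AdaptedChart.mem_at (E := E) (F := F) (π := π) ζ.pt.pt
  let T : (E × JetFibre E (CovFibre E F m)) ≃L[ℝ] (E × JetFibre E (CovFibre E F m)) :=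
    (JetBundle.adapted (CovBundle.adapted a)).dE ha
  have hT : ∀ X, X ∈ vert E (JetFibre E (CovFibre E F m))
      (JetBundle.base E (CovFibre E F m) (CovBundle.base E F π m)) ζ ↔ (T X).1 = 0 := fun X =>
    (JetBundle.adapted (CovBundle.adapted a)).tmap_e_mem_vert ha
  have hker : ∀ X, tmap (E × JetFibre E (CovFibre E F m))
      (E × CovFibre E (JetFibre E F) (m + 1)) (jetMomentum E F π m) ζ X = 0 ↔
      momentumCoord E F m (T X) = 0 := by
    intro X
    have h1 : momentumCoord E F m (T X) = _ := (tmap_jetMomentum ha X).symm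
    rw [h1]
    constructor
    · intro h; rw [h, map_zero]
    · intro h
      refine (CovBundle.adapted (JetBundle.adapted a)).ext_tmap_e
        (jetMomentum_mem_source ζ ha).1 ?_
      rw [h, map_zero]
  have happ : ∀ X ∈ vert E (JetFibre E (CovFibre E F m))
      (JetBundle.base E (CovFibre E F m) (CovBundle.base E F π m)) ζ, ∀ X' ∈ vert E
      (JetFibre E (CovFibre E F m))
      (JetBundle.base E (CovFibre E F m) (CovBundle.base E F π m)) ζ,
      ((jetTwoForm E F π m).app ζ ![X, X'] = 0 ↔
        jetPairing E F m (T X).2 (T X').2 - jetPairing E F m (T X').2 (T X).2 = 0) := by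
    intro X hX X' hX'
    rw [jetTwoForm_app (fun i => by fin_cases i <;> assumption), antisymmetrize_apply]
    have h1 : ∀ f : AltForm E (m + 1), AltForm.pullback (m + 1)
        (tmap E E (AdaptedChart.at E F π ζ.pt.pt).c (π ζ.pt.pt)) f = 0 ↔ f = 0 := by
      intro f
      have h2 := AltForm.pullback_symm_apply ((AdaptedChart.at E F π ζ.pt.pt).dC ha) f
      constructor
      · intro h
        rw [← h2]
        exact (congrArg _ h).trans (map_zero _)
      · rintro rfl; exact map_zero _
    rw [h1]
    rfl
  ext X
  rw [mem_ofPred_eq, hker, momentumCoord_apply]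
  have hiff := antisymmetrize_jetPairing_degenerate (F := F) hn (z := (T X).2)
  constructor
  · intro h
    have hX := (hT X).2 (congrArg (·.1) h)
    refine ⟨hX, fun X' hX' => (happ X hX X' hX').2 ?_⟩
    exact hiff.2 ⟨congrArg (·.2.1) h, congrArg (·.2.2) h⟩ _
  · rintro ⟨hX, h⟩
    -- Every coordinate vector `z'` comes from a vertical vector, so degeneracy supplies all the
    -- test vectors that are needed.
    have h1 := hiff.1 fun z' => by
      have hX' : T.symm (0, z') ∈ vert E (JetFibre E (CovFibre E F m))
          (JetBundle.base E (CovFibre E F m) (CovBundle.base E F π m)) ζ := by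
        rw [hT, ContinuousLinearEquiv.apply_symm_apply]
      have h2 := (happ X hX _ hX').1 (h _ hX')
      rwa [ContinuousLinearEquiv.apply_symm_apply] at h2
    exact Prod.ext ((hT X).1 hX) (Prod.ext h1.1 h1.2)

/-- Tangency to the kernel makes the derivative of `Ψ ∘ γ` zero. In charts of the target this gives
local constancy, hence constancy because the real line is connected. -/
theorem joined_imp_jetMomentum_eq (hn : Module.finrank ℝ E = m + 1)
    {ζ ζ' : JetPhaseBundle E F π m} (h : (jetTwoForm E F π m).Joined ζ ζ') :
    jetMomentum E F π m ζ = jetMomentum E F π m ζ' := by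
  obtain ⟨γ, hγ, rfl, rfl, hD⟩ := h
  have hc : ContMDiff 𝓘(ℝ, ℝ) 𝓘(ℝ, E × CovFibre E (JetFibre E F) (m + 1)) ∞
      (fun t => jetMomentum E F π m (γ t)) := contMDiff_jetMomentum.comp hγ
  have hD0 : ∀ t, tmap ℝ (E × CovFibre E (JetFibre E F) (m + 1))
      (fun t => jetMomentum E F π m (γ t)) t = 0 := by
    intro t
    have h1 := tmap_comp t ((contMDiff_jetMomentum (E := E) (F := F) (π := π) (m := m)
      (γ t)).mdifferentiableAt (by simp)) ((hγ t).mdifferentiableAt (by simp))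
    have h2 := hD t
    rw [← ker_tmap_jetMomentum hn] at h2
    refine h1.trans (ContinuousLinearMap.ext_ring ?_)
    exact h2
  have hloc : IsLocallyConstant fun t => jetMomentum E F π m (γ t) := by
    rw [IsLocallyConstant.iff_eventually_eq]
    intro t
    let b := AdaptedChart.at E (CovFibre E (JetFibre E F) (m + 1))
      (CovBundle.base E (JetFibre E F) (JetBundle.base E F π) (m + 1))
      (jetMomentum E F π m (γ t))
    have hb : jetMomentum E F π m (γ t) ∈ b.e.source := AdaptedChart.mem_at _
    have h1 : ∀ᶠ t' in 𝓝 t, jetMomentum E F π m (γ t') ∈ b.e.source :=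
      hc.continuous.continuousAt.eventually (b.e.open_source.mem_nhds hb)
    obtain ⟨ε, hε, h2⟩ := Metric.eventually_nhds_iff_ball.1 h1
    have hdiff : ∀ t' ∈ Metric.ball t ε, HasFDerivAt
        (fun t => b.e (jetMomentum E F π m (γ t))) (0 : ℝ →L[ℝ] _) t' := by
      intro t' ht'
      have h3 : DifferentiableAt ℝ (fun t => b.e (jetMomentum E F π m (γ t))) t' :=
        ((b.contMDiffAt_e (h2 t' ht')).comp t' (hc t')).contDiffAt.differentiableAt (by simp)
      have h4 := b.tmap_e_comp ((hc t').mdifferentiableAt (by simp)) (h2 t' ht')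
      rw [hD0, ContinuousLinearMap.comp_zero] at h4
      have h5 := h3.hasFDerivAt
      have h6 : fderiv ℝ (fun t => b.e (jetMomentum E F π m (γ t))) t' = 0 :=
        mfderiv_eq_fderiv.symm.trans h4.symm
      rwa [h6] at h5
    filter_upwards [Metric.ball_mem_nhds t hε] with t' ht'
    refine b.e.injOn (h2 t' ht') hb ?_
    exact Metric.isOpen_ball.is_const_of_fderiv_eq_zero
      (f := fun t => b.e (jetMomentum E F π m (γ t)))
      (convex_ball t ε).isPreconnected
      (fun s hs => (hdiff s hs).differentiableAt.differentiableWithinAt)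
      (fun s hs => (hdiff s hs).fderiv) ht' (Metric.mem_ball_self hε)
  exact hloc.apply_eq_of_preconnectedSpace 0 1

/-- Equal images force equal points of `Q`, so one induced chart contains both jets. There `Ψ` is
linear, hence constant on the line through them; a single curve is enough and no chain is needed. -/
theorem joined_of_jetMomentum_eq (hn : Module.finrank ℝ E = m + 1)
    {ζ ζ' : JetPhaseBundle E F π m} (h : jetMomentum E F π m ζ = jetMomentum E F π m ζ') :
    (jetTwoForm E F π m).Joined ζ ζ' := by
  let a := AdaptedChart.at E F π ζ.pt.pt
  let b := JetBundle.adapted (CovBundle.adapted (k := m) a)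
  have ha : ζ ∈ b.e.source := AdaptedChart.mem_at (E := E) (F := F) (π := π) ζ.pt.pt
  have hpt : ζ'.pt.pt = ζ.pt.pt := by
    have h1 := congrArg (fun η => η.pt.pt) h
    simp only [pt_jetMomentum] at h1
    exact h1.symm
  have ha' : ζ' ∈ b.e.source := by
    change ζ'.pt.pt ∈ a.e.source
    rw [hpt]; exact ha
  have hL : momentumCoord E F m (b.e ζ') = momentumCoord E F m (b.e ζ) := by
    rw [← (jetMomentum_mem_source ζ ha).2, ← (jetMomentum_mem_source ζ' ha').2, h]
  let g : ℝ → E × JetFibre E (CovFibre E F m) := fun t => b.e ζ + t • (b.e ζ' - b.e ζ)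
  have hgL : ∀ t, momentumCoord E F m (g t) = momentumCoord E F m (b.e ζ) := by
    intro t
    simp only [g]
    rw [map_add, map_smul, map_sub, hL, sub_self, smul_zero, add_zero]
  -- Membership in the target is determined by the value of `momentumCoord`, which is constant on
  -- the line, so the curve is defined and smooth for all real `t`.
  have hgt : ∀ t, g t ∈ b.e.target := by
    intro t
    rw [← momentumCoord_mem_target, hgL, momentumCoord_mem_target]
    exact b.e.map_source ha
  have hg : ContDiff ℝ ∞ g := by fun_prop
  have hγ : ContMDiff 𝓘(ℝ, ℝ) 𝓘(ℝ, E × JetFibre E (CovFibre E F m)) ∞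
      (fun t => b.e.symm (g t)) := fun t =>
    (b.contMDiffAt_e_symm (hgt t)).comp t hg.contMDiff.contMDiffAt
  refine ⟨fun t => b.e.symm (g t), hγ, ?_, ?_, fun t => ?_⟩
  · simp only [g, zero_smul, add_zero, b.e.left_inv ha]
  · simp only [g, one_smul, add_sub_cancel, b.e.left_inv ha']
  · rw [← ker_tmap_jetMomentum hn]
    have h1 := tmap_comp t ((contMDiff_jetMomentum (E := E) (F := F) (π := π) (m := m)
      (b.e.symm (g t))).mdifferentiableAt (by simp)) ((hγ t).mdifferentiableAt (by simp))
    have h2 : (jetMomentum E F π m ∘ fun t => b.e.symm (g t)) =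
        fun _ => jetMomentum E F π m ζ := by
      funext t
      have h3 := jetMomentum_mem_source _ (b.e.map_target (hgt t))
      refine (CovBundle.adapted (JetBundle.adapted a)).e.injOn h3.1
        (jetMomentum_mem_source ζ ha).1 ?_
      rw [(jetMomentum_mem_source ζ ha).2]
      exact h3.2.trans ((congrArg _ (b.e.right_inv (hgt t))).trans (hgL t))
    rw [h2] at h1
    have h3 : tmap ℝ (E × CovFibre E (JetFibre E F) (m + 1))
      (fun _ : ℝ => jetMomentum E F π m ζ) t = 0 := mfderiv_const
    rw [h3] at h1
    exact (DFunLike.congr_fun h1 1).symm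

theorem leafSetoid_iff (hn : Module.finrank ℝ E = m + 1) {ζ ζ' : JetPhaseBundle E F π m} :
    (jetTwoForm E F π m).leafSetoid ζ ζ' ↔ jetMomentum E F π m ζ = jetMomentum E F π m ζ' := by
  constructor
  · intro h
    induction h with
    | rel _ _ h => exact joined_imp_jetMomentum_eq hn h
    | refl _ => rfl
    | symm _ _ _ ih => exact ih.symm
    | trans _ _ _ _ _ ih ih' => exact ih.trans ih'
  · intro h
    exact Relation.EqvGen.rel _ _ (joined_of_jetMomentum_eq hn h)

theorem leaf_eq_preimage (hn : Module.finrank ℝ E = m + 1) (ζ : JetPhaseBundle E F π m) :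
    (jetTwoForm E F π m).leaf ζ = jetMomentum E F π m ⁻¹' {jetMomentum E F π m ζ} := by
  ext ζ'
  exact (leafSetoid_iff hn).trans eq_comm

variable (E F π m) in
/-- The identification of the leaf space with the bundle of covectors. -/
def leafSpaceHomeomorph (hn : Module.finrank ℝ E = m + 1) :
    (jetTwoForm E F π m).LeafSpace ≃ₜ InfCovBundle E F π (m + 1) :=
  (Equiv.ofBijective (Quotient.lift (jetMomentum E F π m) fun _ _ h => (leafSetoid_iff hn).1 h)
    ⟨by
      rintro ⟨ζ⟩ ⟨ζ'⟩ h
      exact Quotient.sound ((leafSetoid_iff hn).2 h), fun η => by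
      obtain ⟨ζ, rfl⟩ := jetMomentum_surjective (π := π) hn η
      exact ⟨Quotient.mk _ ζ, rfl⟩⟩).toHomeomorphOfContinuousOpen
    (contMDiff_jetMomentum.continuous.quotient_lift _)
    (fun U hU => by
      -- The image of `U` under the induced map equals the image under `Ψ` of the preimage of `U`,
      -- and that preimage is open.
      have h := isOpenMap_jetMomentum hn _ (hU.preimage continuous_quot_mk)
      rw [← image_preimage_eq U Quotient.mk_surjective, ← image_comp]
      exact h)

end FiniteDimensional

/-- Linear combinations of momenta over one section have as fibre coordinates the same combinations,
and so do their derivatives. The covector part of `Ψ` is `momentumMap`, which is linear in exactly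
these data. -/
theorem isFibrewiseLinear_jetMomentum : IsFibrewiseLinear (jetMomentum E F π m) := by
  intro x p p' p'' ζ ζ' ζ'' c d hζ hζ' hζ'' hp X
  have e1 : (jetMomentum E F π m ζ').pt = (jetMomentum E F π m ζ).pt := by
    rw [pt_jetMomentum, pt_jetMomentum]
    exact hζ'.jetProj.eq (hζ.jetProj.congr (hp.mono fun x' h => h.1.symm))
  have e2 : (jetMomentum E F π m ζ'').pt = (jetMomentum E F π m ζ).pt := by
    rw [pt_jetMomentum, pt_jetMomentum]
    exact hζ''.jetProj.eq (hζ.jetProj.congr (hp.mono fun x' h => h.2.1.symm))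
  by_cases hX : X ∈ vert E (JetFibre E F) (JetBundle.base E F π) (jetMomentum E F π m ζ).pt
  swap
  -- The three covectors sit over the same point of `J¹Q`, so off the vertical space all three
  -- evaluations take the default value zero.
  · have hX' : X ∉ vert E (JetFibre E F) (JetBundle.base E F π) (jetMomentum E F π m ζ').pt := by
      rwa [e1]
    have hX'' : X ∉ vert E (JetFibre E F) (JetBundle.base E F π) (jetMomentum E F π m ζ'').pt := by
      rwa [e2]
    rw [CovBundle.app, CovBundle.app, CovBundle.app, dif_neg hX, dif_neg hX', dif_neg hX'']
    simp
  let a := AdaptedChart.at E F π (p x).pt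
  have ha : (p x).pt ∈ a.e.source := AdaptedChart.mem_at _
  have ha' : (p' x).pt ∈ a.e.source := by rw [hp.self_of_nhds.1]; exact ha
  have ha'' : (p'' x).pt ∈ a.e.source := by rw [hp.self_of_nhds.2.1]; exact ha
  let b : AdaptedChart E (CovFibre E F m) (CovBundle.base E F π m) := CovBundle.adapted a
  have hx : x ∈ a.c.source := b.mem_c_source hζ.1.apply_eq ha
  have hcs : Tendsto a.c.symm (𝓝 (a.c x)) (𝓝 x) := by
    have := a.c.symm.continuousAt (a.c.map_source hx)
    rwa [ContinuousAt, a.c.left_inv hx] at this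
  have hrep : (fun u => (b.rep p'' u).2) =ᶠ[𝓝 (a.c x)]
      fun u => c • (b.rep p u).2 + d • (b.rep p' u).2 := by
    filter_upwards [hcs.eventually hp, hcs.eventually (hζ.1.eventually_mem (a := b) ha)]
      with u h1 h2
    obtain ⟨h3, h4, h5⟩ := h1
    have h2' : (p' (a.c.symm u)).pt ∈ a.e.source := by rw [h3]; exact h2
    have h2'' : (p'' (a.c.symm u)).pt ∈ a.e.source := by rw [h4]; exact h2
    refine ContinuousLinearMap.ext fun f => ?_
    have hXf := a.dE_symm_mem_vert h2 f
    have h6 := h5 ((a.dE h2).symm (0, f))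
    rw [CovBundle.app_eq h2 hXf, CovBundle.app_eq h2' (by rw [h3]; exact hXf),
      CovBundle.app_eq h2'' (by rw [h4]; exact hXf), h3, h4, ← a.dE_apply h2,
      ContinuousLinearEquiv.apply_symm_apply] at h6
    -- The hypothesis compares forms on the base after pull-back by the differential of the base
    -- chart, which is invertible and can be cancelled.
    have h7 : AltForm.pullback m (a.dC h2).toContinuousLinearMap ((b.rep p'' u).2 f) =
        AltForm.pullback m (a.dC h2).toContinuousLinearMap
          (c • (b.rep p u).2 f + d • (b.rep p' u).2 f) := by
      rw [map_add, map_smul, map_smul]; exact h6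
    have h8 := AltForm.pullback_symm_apply (k := m) (a.dC h2)
    exact (h8 _).symm.trans ((congrArg _ h7).trans (h8 _))
  have hD := (hζ.1.contDiffAt_rep (a := b) ha).differentiableAt (by simp)
  have hD' := (hζ'.1.contDiffAt_rep (a := b) ha').differentiableAt (by simp)
  have hD'' := (hζ''.1.contDiffAt_rep (a := b) ha'').differentiableAt (by simp)
  have hs : sndJet E F _ ((JetBundle.adapted b).e ζ'').2 =
      c • sndJet E F _ ((JetBundle.adapted b).e ζ).2 +
      d • sndJet E F _ ((JetBundle.adapted b).e ζ').2 := by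
    rw [hζ.adapted_apply (a := b) ha, hζ'.adapted_apply (a := b) ha',
      hζ''.adapted_apply (a := b) ha'']
    refine Prod.ext hrep.self_of_nhds ?_
    have h1 := hD''.hasFDerivAt.snd.fderiv
    have h2 := ((hD.hasFDerivAt.snd.const_smul c).add (hD'.hasFDerivAt.snd.const_smul d)).fderiv
    exact h1.symm.trans (hrep.fderiv_eq.trans h2)
  have hb : ζ.pt.pt ∈ a.e.source := by rw [hζ.2.1]; exact ha
  have hb' : ζ'.pt.pt ∈ a.e.source := by rw [hζ'.2.1]; exact ha'
  have hb'' : ζ''.pt.pt ∈ a.e.source := by rw [hζ''.2.1]; exact ha''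
  have h9 : momentumMap E F m (sndJet E F _ ((JetBundle.adapted b).e ζ'').2) =
      c • momentumMap E F m (sndJet E F _ ((JetBundle.adapted b).e ζ).2) +
      d • momentumMap E F m (sndJet E F _ ((JetBundle.adapted b).e ζ').2) := by
    rw [hs, map_add, map_smul, map_smul]
  rw [CovBundle.app_eq (a := JetBundle.adapted a) (jetMomentum_mem_source ζ hb).1 hX,
    CovBundle.app_eq (a := JetBundle.adapted a) (jetMomentum_mem_source ζ' hb').1
      (by rw [e1]; exact hX),
    CovBundle.app_eq (a := JetBundle.adapted a) (jetMomentum_mem_source ζ'' hb'').1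
      (by rw [e2]; exact hX), e1, e2,
    (jetMomentum_mem_source ζ hb).2, (jetMomentum_mem_source ζ' hb').2,
    (jetMomentum_mem_source ζ'' hb'').2]
  refine (congrArg _ (DFunLike.congr_fun h9 _)).trans ?_
  refine (map_add _ _ _).trans ?_
  exact congrArg₂ (· + ·) (map_smul _ c _) (map_smul _ d _)

end MomentumProperties

/-! ### The quotient map to the leaf space and the main theorem -/

theorem IsSmoothSubmersion.of_diffeomorph_comp {V W : Type*} [NormedAddCommGroup V]
    [NormedSpace ℝ V] [NormedAddCommGroup W] [NormedSpace ℝ W] {X Y Z : Type*}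
    [TopologicalSpace X] [ChartedSpace V X] [TopologicalSpace Y] [ChartedSpace W Y]
    [TopologicalSpace Z] [ChartedSpace W Z] (Φ : Diffeomorph 𝓘(ℝ, W) 𝓘(ℝ, W) Z Y ∞)
    {f : X → Y} {g : X → Z} (h : ∀ x, Φ (g x) = f x) (hf : IsSmoothSubmersion V W f) :
    IsSmoothSubmersion V W g := by
  have hg : g = Φ.symm ∘ f := funext fun x => by simp [← h x]
  have hs : ContMDiff 𝓘(ℝ, W) 𝓘(ℝ, W) ∞ Φ.symm := Φ.symm.contMDiff
  refine ⟨hg ▸ hs.comp hf.1, fun x v => ?_⟩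
  obtain ⟨X, hX⟩ := hf.2 x (tmap W W Φ (g x) v)
  refine ⟨X, ?_⟩
  have h1 : tmap V W g x = (tmap W W Φ.symm (f x)).comp (tmap V W f x) := by
    rw [hg]
    exact tmap_comp x ((hs _).mdifferentiableAt (by simp)) ((hf.1 x).mdifferentiableAt (by simp))
  have h2 : (tmap W W Φ.symm (f x)).comp (tmap W W Φ (g x)) = ContinuousLinearMap.id ℝ W := by
    have h3 := tmap_comp (f := Φ) (g := Φ.symm) (g x) ((hs _).mdifferentiableAt (by simp))
      ((Φ.contMDiff _).mdifferentiableAt (by simp))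
    rw [h x] at h3
    rw [← h3]
    have h4 : Φ.symm ∘ Φ = id := funext fun z => Φ.symm_apply_apply z
    rw [h4]
    exact mfderiv_id
  rw [h1]
  exact (congrArg _ hX).trans (DFunLike.congr_fun h2 v)

theorem isSmoothSubmersion_leafSpace_mk {E F : Type*} [NormedAddCommGroup E] [NormedSpace ℝ E]
    [FiniteDimensional ℝ E] [NormedAddCommGroup F] [NormedSpace ℝ F] [FiniteDimensional ℝ F]
    {M Q : Type*} [TopologicalSpace M] [ChartedSpace E M]
    [TopologicalSpace Q] [ChartedSpace (E × F) Q]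
    {π : Q → M} [IsFibredManifold E F π]
    {m : ℕ} (hn : Module.finrank ℝ E = m + 1) :
    letI := (leafSpaceHomeomorph E F π m hn).pullbackChartedSpace
      (V := E × CovFibre E (JetFibre E F) (m + 1))
    IsSmoothSubmersion (E × JetFibre E (CovFibre E F m))
      (E × CovFibre E (JetFibre E F) (m + 1))
      (fun ζ => (Quotient.mk _ ζ : (jetTwoForm E F π m).LeafSpace)) :=
  letI := (leafSpaceHomeomorph E F π m hn).pullbackChartedSpace
    (V := E × CovFibre E (JetFibre E F) (m + 1))
  IsSmoothSubmersion.of_diffeomorph_comp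
    ((leafSpaceHomeomorph E F π m hn).pullbackDiffeomorph
      (V := E × CovFibre E (JetFibre E F) (m + 1)))
    (fun _ => rfl) (isSmoothSubmersion_jetMomentum hn)

end

theorem mainTheorem2 {E F : Type*} [NormedAddCommGroup E] [NormedSpace ℝ E]
    [FiniteDimensional ℝ E] [NormedAddCommGroup F] [NormedSpace ℝ F] [FiniteDimensional ℝ F]
    {M Q : Type*} [TopologicalSpace M] [ChartedSpace E M]
    [TopologicalSpace Q] [ChartedSpace (E × F) Q]
    (π : Q → M) [IsFibredManifold E F π]
    (m : ℕ) (hn : Module.finrank ℝ E = m + 1) :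
    -- the canonical diffeomorphism `J¹VQ ≅ VJ¹Q`
    ∃ κ : Diffeomorph 𝓘(ℝ, E × JetFibre E (F × F))
        𝓘(ℝ, E × (JetFibre E F × JetFibre E F))
        (JetBundle E (F × F) (VertBundle.base E F π))
        (VertBundle E (JetFibre E F) (JetBundle.base E F π)) ∞,
      (IsInterchange κ ∧ ∀ κ', IsInterchange κ' → κ' = κ) ∧
    -- the vertical differential of the canonical one-form of `P`
    ∃ Ω : VertForm E (CovFibre E F m) (CovBundle.base E F π m) 2 m,
      (IsVerticalDifferential (canonicalForm E F π m) Ω ∧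
        ∀ Ω', IsVerticalDifferential (canonicalForm E F π m) Ω' → Ω' = Ω) ∧
    -- the pre-symplectic form on `J¹P`, i.e. the space-time differential of the former
    ∃ ΩI : VertForm E (JetFibre E (CovFibre E F m))
        (JetBundle.base E (CovFibre E F m) (CovBundle.base E F π m)) 2 (m + 1),
      (IsSpacetimeDifferential Ω ΩI ∧ ∀ ΩI', IsSpacetimeDifferential Ω ΩI' → ΩI' = ΩI) ∧
    -- the canonical surjection
    ∃ Ψ : JetPhaseBundle E F π m → InfCovBundle E F π (m + 1),
      (IsJetPairing κ Ψ ∧ ∀ Ψ', IsJetPairing κ Ψ' → Ψ' = Ψ) ∧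
      Function.Surjective Ψ ∧
      IsSmoothSubmersion (E × JetFibre E (CovFibre E F m))
        (E × CovFibre E (JetFibre E F) (m + 1)) Ψ ∧
      IsFibrewiseLinear Ψ ∧
      -- its fibres are the degeneracy leaves
      (∀ ζ, {X | tmap (E × JetFibre E (CovFibre E F m))
        (E × CovFibre E (JetFibre E F) (m + 1)) Ψ ζ X = 0} = ΩI.degeneracy ζ) ∧
      (∀ η, ∃ ζ, Ψ ⁻¹' {η} = ΩI.leaf ζ) ∧
      (∀ ζ, ∃ η, ΩI.leaf ζ = Ψ ⁻¹' {η}) ∧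
      -- the induced identification of the infinitesimal phase bundle
      ∃ C : ChartedSpace (E × CovFibre E (JetFibre E F) (m + 1)) ΩI.LeafSpace,
        IsManifold 𝓘(ℝ, E × CovFibre E (JetFibre E F) (m + 1)) ∞ ΩI.LeafSpace ∧
        IsSmoothSubmersion (E × JetFibre E (CovFibre E F m))
          (E × CovFibre E (JetFibre E F) (m + 1))
          (fun ζ => (Quotient.mk _ ζ : ΩI.LeafSpace)) ∧
        ∃ Φ : Diffeomorph 𝓘(ℝ, E × CovFibre E (JetFibre E F) (m + 1))
            𝓘(ℝ, E × CovFibre E (JetFibre E F) (m + 1)) ΩI.LeafSpace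
            (InfCovBundle E F π (m + 1)) ∞,
          ∀ ζ, Φ (Quotient.mk _ ζ) = Ψ ζ := by
  refine ⟨interchangeDiffeo E F π, ⟨isInterchange_interchange E F π, fun _ h => h.eq_interchange⟩,
    canonicalTwoForm E F π m, ⟨isVerticalDifferential_canonicalTwoForm E F π m,
      fun _ h => h.eq_canonicalTwoForm⟩,
    jetTwoForm E F π m, ⟨isSpacetimeDifferential_jetTwoForm E F π m,
      fun _ h => h.unique (isSpacetimeDifferential_jetTwoForm E F π m)⟩,
    jetMomentum E F π m, ⟨isJetPairing_jetMomentum E F π m, fun _ h => h.eq_jetMomentum⟩,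
    jetMomentum_surjective hn, isSmoothSubmersion_jetMomentum hn, isFibrewiseLinear_jetMomentum,
    ker_tmap_jetMomentum hn, fun η => ?_, fun ζ => ⟨_, leaf_eq_preimage hn ζ⟩,
    -- The smooth structure is transported along a homeomorphism for the quotient topology, so the
    -- induced map is a diffeomorphism, and the quotient map inherits from `Ψ` the property of being
    -- a submersion.
    (leafSpaceHomeomorph E F π m hn).pullbackChartedSpace,
    Homeomorph.isManifold_pullback _, isSmoothSubmersion_leafSpace_mk hn,
    (leafSpaceHomeomorph E F π m hn).pullbackDiffeomorph, fun ζ => rfl⟩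
  obtain ⟨ζ, rfl⟩ := jetMomentum_surjective (π := π) hn η
  exact ⟨ζ, (leaf_eq_preimage hn ζ).symm⟩
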